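/- **Setting.** Let $V=\mathbb R^{3,1}$ with Minkowski metric $\eta$, and let $\mathfrak g=\mathfrak{so}(3,1)$ with Killing form $\langle\cdot,\cdot\rangle$, by which $\mathfrak g^*$ is identified with $\mathfrak g$. For $v,w\in V$ let $v\wedge w\in\mathfrak g$ be the element with $\langle\chi,v\wedge w\rangle=-\eta(\chi v,w)$ for all $\chi\in\mathfrak g$; the bracket $V\times V\to\mathfrak g^*$ of the trivial standard extension $\mathfrak d=\mathfrak g\oplus V\oplus\mathfrak g^*$ is then $[v,w]=-v\wedge w$. Let $\beta\in\mathbb R$, and let $T$ be an automorphism of the $\mathfrak g$-module $\mathfrak g$, i.e. a linear automorphism commuting with the adjoint action. Assume the invertibility condition $\beta T\neq-\mathrm{id}$. Let $N=\partial M$ be a non-empty closed oriented smooth 3-manifold with a principal $SO(3,1)$-bundle $P$, and denote by $\mathcal V$, $\mathrm{ad}P$ the associated bundles with fibres $V$, $\mathfrak g$. The boundary phase space of qeGR consists of $(A,e,S,B,\tau,c)$ with $A$ a connection on $P$, $e\in\Omega^1(N,\mathcal V)$, $S\in\Omega^1(N,\mathrm{ad}P)$, $B,c\in\Omega^2(N,\mathrm{ad}P)$,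 $\tau\in\Omega^2(N,\mathcal V)$, with symplectic form $$\varpi(X,Y)=\int_N\langle X_B,Y_A\rangle-\langle Y_B,X_A\rangle+\eta(X_\tau,Y_e)-\eta(Y_\tau,X_e)+\langle X_c,Y_S\rangle-\langle Y_c,X_S\rangle .$$ The Hamiltonian vector field $X_f$ of a functional $f$ is defined by $\varpi(X_f,\cdot)=-\delta f$, and $\{f,g\}=\delta g(X_f)$. For $\theta,\sigma\in\Omega^0(N,\mathrm{ad}P)$, $\epsilon\in\Omega^0(N,\mathcal V)$, $\alpha,\zeta\in\Omega^1(N,\mathrm{ad}P)$, $\rho\in\Omega^1(N,\mathcal V)$ put $$H_\theta=\int_N\langle d_AB-e\wedge\tau-[c,S],\theta\rangle,\qquad I_\epsilon=\int_N\eta(d_A\tau,\epsilon)+\langle c,e\wedge\epsilon\rangle,\qquad J_\sigma=\int_N\langle d_Ac,\sigma\rangle,$$ $$K_\alpha=\int_N\langle(\mathrm{id}+\beta T)B+d_AS+\tfrac12[e,e],\alpha\rangle,\quad L_\rho=\int_N\eta(d_Ae+(1+\beta)\tau,\rho),\quad M_\zeta=\int_N\langle F_A+(\mathrm{id}+\beta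 T)c,\zeta\rangle .$$ **Theorem.** (a) Each of the functionals $H_\theta,I_\epsilon,K_\alpha,L_\rho,M_\zeta$ has a unique Hamiltonian vector field. (b) $\mathrm{id}+\beta T$ is invertible, and everywhere on the phase space $$\{K_\alpha,K_{\bar\alpha}\}=0,\quad \{K_\alpha,L_\rho\}=\int_N\langle\beta(\mathrm{id}-T)\alpha,e\wedge\rho\rangle,\quad \{K_\alpha,M_\zeta\}=0,$$ $$\{K_\alpha,H_\theta\}=K_{[\theta,\alpha]},\quad \{K_\alpha,I_\epsilon\}=-L_{[\alpha,\epsilon]}+\int_N\langle\beta(\mathrm{id}-T)\alpha,\tau\wedge\epsilon\rangle,$$ $$\{L_\rho,L_{\bar\rho}\}=0,\quad \{L_\rho,M_\zeta\}=0,\quad \{L_\rho,H_\theta\}=L_{[\theta,\rho]},\quad \{L_\rho,I_\epsilon\}=M_{\rho\wedge\epsilon}+\int_N\langle\beta(\mathrm{id}-T)c,\rho\wedge\epsilon\rangle,$$ $$\{M_\zeta,M_{\bar\zeta}\}=0,\quad \{M_\zeta,H_\theta\}=M_{[\theta,\zeta]},\quad \{M_\zeta,I_\epsilon\}=0,$$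 $$\{H_\theta,H_{\bar\theta}\}=-H_{[\theta,\bar\theta]},\quad \{H_\theta,I_\epsilon\}=-I_{[\theta,\epsilon]},\quad \{I_\epsilon,I_{\bar\epsilon}\}=J_{\epsilon\wedge\bar\epsilon}=M_{-d_A((\mathrm{id}+\beta T)^{-1}(\epsilon\wedge\bar\epsilon))}.$$ (c) The constraint set $\{H_\theta,I_\epsilon,K_\alpha,L_\rho,M_\zeta\}$ is first class, i.e. the Poisson bracket of any two constraints vanishes on the common zero set of all constraints, if and only if $\beta T=\beta\,\mathrm{id}$ (the topological sector). -/

import Mathlib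

open Set MeasureTheory
open scoped Manifold ContDiff Matrix

-- Matrices are only normed in order to speak of smooth matrix-valued functions; all norms on a
-- finite-dimensional space give the same notion.
attribute [local instance] Matrix.normedAddCommGroup Matrix.normedSpace

noncomputable section

namespace QeGR

/-! ### Minkowski space, the Lie algebra `so(3,1)` and the group `SO(3,1)` -/

/-- Index set of Minkowski space: three space-like directions and a time-like one. -/
abbrev Idx := Fin 3 ⊕ Fin 1

/-- Minkowski space. -/
abbrev V := Idx → ℝ

/-- The matrix `diag(1, 1, 1, -1)` of the Minkowski metric. -/
abbrev etaM : Matrix Idx Idx ℝ := LieAlgebra.Orthogonal.indefiniteDiagonal (Fin 3) (Fin 1) ℝ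

/-- The Minkowski metric `η` on `V`. -/
def eta (v w : V) : ℝ := v ⬝ᵥ (etaM *ᵥ w)

/-- The Lie algebra `so(3,1)` of endomorphisms of `V` that are skew for `η`. -/
abbrev so31 := ↥(LieAlgebra.Orthogonal.so' (Fin 3) (Fin 1) ℝ)

/-- The action of `so(3,1)` on `V`. -/
def act (X : so31) (v : V) : V := (X : Matrix Idx Idx ℝ) *ᵥ v

/-- The Lie bracket of `so(3,1)`. -/
def lieB (X Y : so31) : so31 := ⁅X, Y⁆

/-- The Killing form of `so(3,1)`. It also identifies `so(3,1)` with its dual. -/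
def kil (X Y : so31) : ℝ := killingForm ℝ so31 X Y

theorem etaM_mul_self : etaM * etaM = 1 := by
  unfold etaM LieAlgebra.Orthogonal.indefiniteDiagonal
  rw [Matrix.diagonal_mul_diagonal, ← Matrix.diagonal_one]
  congr 1
  funext i
  rcases i with i | i <;> simp

theorem etaM_transpose : etaMᵀ = etaM := Matrix.diagonal_transpose _

theorem mem_so31_iff (X : Matrix Idx Idx ℝ) :
    X ∈ LieAlgebra.Orthogonal.so' (Fin 3) (Fin 1) ℝ ↔ Xᵀ * etaM = -(etaM * X) := by
  rw [LieAlgebra.Orthogonal.so', mem_skewAdjointMatricesLieSubalgebra,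
    mem_skewAdjointMatricesSubmodule, Matrix.IsSkewAdjoint, Matrix.IsAdjointPair, mul_neg]

/-- The identification `⋀² V ≃ so(3,1)`, normalised by
`⟨χ, v ∧ w⟩ = - η(χ v, w)` for the Killing form `⟨·, ·⟩`; see `kil_wedgeV`. -/
def wedgeV (v w : V) : so31 :=
  ⟨-(1 / 4 : ℝ) • (Matrix.vecMulVec v (etaM *ᵥ w) - Matrix.vecMulVec w (etaM *ᵥ v)), by
    rw [mem_so31_iff]
    have h (a b : V) : Matrix.vecMulVec a (etaM *ᵥ b) = Matrix.vecMulVec a b * etaM := by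
      rw [Matrix.vecMulVec_mul, ← Matrix.mulVec_transpose, etaM_transpose]
    simp only [h, Matrix.transpose_smul, Matrix.transpose_sub, Matrix.transpose_mul,
      Matrix.transpose_vecMulVec, etaM_transpose, Matrix.smul_mul, Matrix.mul_smul,
      Matrix.sub_mul, Matrix.mul_sub, Matrix.mul_assoc]
    module⟩

/-- The group `SO(3,1)` of matrices of determinant one preserving the Minkowski metric. -/
def SO31 : Type := {L : Matrix Idx Idx ℝ // Lᵀ * etaM * L = etaM ∧ L.det = 1}

/-- The vector representation of `SO(3,1)`. -/
def actV (L : SO31) (v : V) : V := L.1 *ᵥ v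

/-- The adjoint representation of `SO(3,1)`. -/
def Ad (L : SO31) (X : so31) : so31 :=
  ⟨L.1 * X.1 * L.1⁻¹, by
    obtain ⟨L, hL, hd⟩ := L
    have hu : IsUnit L.det := by rw [hd]; exact isUnit_one
    have hX := (mem_so31_iff X.1).1 X.2
    rw [mem_so31_iff]
    have h1 : Lᵀ * etaM = etaM * L⁻¹ := by
      calc Lᵀ * etaM = Lᵀ * etaM * (L * L⁻¹) := by rw [Matrix.mul_nonsing_inv _ hu, mul_one]
        _ = Lᵀ * etaM * L * L⁻¹ := by rw [mul_assoc (Lᵀ * etaM)]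
        _ = etaM * L⁻¹ := by rw [hL]
    have h2 : (L⁻¹)ᵀ * etaM = etaM * L := by
      calc (L⁻¹)ᵀ * etaM = (L⁻¹)ᵀ * (Lᵀ * etaM * L) := by rw [hL]
        _ = (L * L⁻¹)ᵀ * etaM * L := by rw [Matrix.transpose_mul]; simp only [mul_assoc]
        _ = etaM * L := by rw [Matrix.mul_nonsing_inv _ hu]; simp
    calc (L * X.1 * L⁻¹)ᵀ * etaM = (L⁻¹)ᵀ * X.1ᵀ * (Lᵀ * etaM) := by
          simp only [Matrix.transpose_mul, mul_assoc]
      _ = (L⁻¹)ᵀ * (X.1ᵀ * etaM) * L⁻¹ := by rw [h1]; simp only [mul_assoc]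
      _ = -((L⁻¹)ᵀ * etaM * X.1 * L⁻¹) := by rw [hX]; simp only [mul_assoc, mul_neg, neg_mul]
      _ = -(etaM * (L * X.1 * L⁻¹)) := by rw [h2]; simp only [mul_assoc]⟩

/-! ### The Killing form in terms of matrices -/

theorem trace_matrixEnd (f : Matrix Idx Idx ℝ →ₗ[ℝ] Matrix Idx Idx ℝ) :
    LinearMap.trace ℝ _ f = ∑ a, ∑ b, f (Matrix.single a b 1) a b := by
  rw [LinearMap.trace_eq_matrix_trace ℝ (Matrix.stdBasis ℝ Idx Idx), Matrix.trace,
    Fintype.sum_prod_type]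
  refine Finset.sum_congr rfl fun a _ => Finset.sum_congr rfl fun b _ => ?_
  rw [Matrix.diag_apply, LinearMap.toMatrix_apply, Matrix.stdBasis_eq_single]
  simp [Matrix.stdBasis]

/-- The projection of all matrices onto `so(3,1)`. -/
def projSo : Matrix Idx Idx ℝ →ₗ[ℝ] so31 where
  toFun M := ⟨(1 / 2 : ℝ) • (M - etaM * Mᵀ * etaM), by
    rw [mem_so31_iff]
    simp only [Matrix.transpose_smul, Matrix.transpose_sub, Matrix.transpose_mul,
      Matrix.transpose_transpose, etaM_transpose, Matrix.smul_mul, Matrix.mul_smul,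
      Matrix.sub_mul, Matrix.mul_sub, Matrix.mul_assoc, etaM_mul_self, mul_one]
    simp only [← Matrix.mul_assoc, etaM_mul_self, one_mul]
    module⟩
  map_add' M M' := by
    ext1
    simp only [Matrix.transpose_add, mul_add, add_mul, AddMemClass.mk_add_mk]
    module
  map_smul' r M := by
    ext1
    simp only [Matrix.transpose_smul, Matrix.mul_smul, Matrix.smul_mul, RingHom.id_apply,
      SetLike.mk_smul_mk]
    module

theorem projSo_coe (X : so31) : projSo X.1 = X := by
  ext1
  have hX := (mem_so31_iff X.1).1 X.2
  change (1 / 2 : ℝ) • (X.1 - etaM * X.1ᵀ * etaM) = X.1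
  rw [mul_assoc, hX, mul_neg, ← mul_assoc, etaM_mul_self, one_mul]
  module

/-- On `so(3,1)` the Killing form is twice the trace form of the vector representation. -/
theorem kil_eq_trace (X Y : so31) : kil X Y = 2 * (X.1 * Y.1).trace := by
  set f : so31 →ₗ[ℝ] so31 := LieAlgebra.ad ℝ so31 X ∘ₗ LieAlgebra.ad ℝ so31 Y with hf
  set inc : so31 →ₗ[ℝ] Matrix Idx Idx ℝ :=
    { toFun := fun Z => Z.1, map_add' := fun _ _ => rfl, map_smul' := fun _ _ => rfl } with hinc
  have h1 : kil X Y = LinearMap.trace ℝ _ (inc ∘ₗ (f ∘ₗ projSo)) := by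
    rw [LinearMap.trace_comp_comm', LinearMap.comp_assoc]
    have : projSo ∘ₗ inc = LinearMap.id := LinearMap.ext fun Z => projSo_coe Z
    rw [this, LinearMap.comp_id]
    exact killingForm_apply_apply ℝ so31 X Y
  have hX := fun a b => congrFun (congrFun ((mem_so31_iff X.1).1 X.2) a) b
  have hY := fun a b => congrFun (congrFun ((mem_so31_iff Y.1).1 Y.2) a) b
  have h2 (M : Matrix Idx Idx ℝ) : (inc ∘ₗ (f ∘ₗ projSo)) M =
      (1 / 2 : ℝ) • (X.1 * (Y.1 * (M - etaM * Mᵀ * etaM) - (M - etaM * Mᵀ * etaM) * Y.1) -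
        (Y.1 * (M - etaM * Mᵀ * etaM) - (M - etaM * Mᵀ * etaM) * Y.1) * X.1) := by
    change X.1 * (Y.1 * ((1 / 2 : ℝ) • (M - etaM * Mᵀ * etaM)) -
      ((1 / 2 : ℝ) • (M - etaM * Mᵀ * etaM)) * Y.1) - (Y.1 * ((1 / 2 : ℝ) • (M - etaM * Mᵀ * etaM))
      - ((1 / 2 : ℝ) • (M - etaM * Mᵀ * etaM)) * Y.1) * X.1 = _
    simp only [Matrix.mul_smul, Matrix.smul_mul, smul_sub, Matrix.mul_sub, Matrix.sub_mul]
  rw [h1, trace_matrixEnd]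
  obtain ⟨d, hη, hdd⟩ : ∃ d : Idx → ℝ, etaM = Matrix.diagonal d ∧ ∀ a, d a * d a = 1 :=
    ⟨_, rfl, fun a => by rcases a with a | a <;> simp⟩
  rw [hη] at hX hY h2
  have hX' (a b : Idx) : X.1 b a * d b = -(d a * X.1 a b) := by
    simpa [Matrix.mul_diagonal, Matrix.diagonal_mul] using hX a b
  have hY' (a b : Idx) : Y.1 b a * d b = -(d a * Y.1 a b) := by
    simpa [Matrix.mul_diagonal, Matrix.diagonal_mul] using hY a b
  have hXd (a : Idx) : X.1 a a = 0 := by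
    have h4 : 2 * (X.1 a a * (d a * d a)) = 0 := by linear_combination d a * hX' a a
    rw [hdd] at h4
    linarith
  have hE (a b : Idx) : Matrix.diagonal d * (Matrix.single a b (1 : ℝ))ᵀ * Matrix.diagonal d =
      (d a * d b) • Matrix.single b a 1 := by
    ext i j
    rw [Matrix.mul_diagonal, Matrix.diagonal_mul, Matrix.transpose_single, Matrix.smul_apply,
      smul_eq_mul, Matrix.single_apply]
    split_ifs with h
    · rw [← h.1, ← h.2]; ring
    · ring
  have hent (A B : Matrix Idx Idx ℝ) (i j k l : Idx) :
      (A * Matrix.single i j (1 : ℝ) * B) k l = A k i * B j l := by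
    simp [Matrix.mul_apply, Matrix.single_apply, ite_and]
  have hsum (a b : Idx) : (inc ∘ₗ (f ∘ₗ projSo)) (Matrix.single a b 1) a b =
      1 / 2 * ((X.1 * Y.1) a a + (Y.1 * X.1) b b) -
      (if a = b then 1 / 2 * ((X.1 * Y.1) a a + (Y.1 * X.1) a a) else 0) -
      1 / 2 * (X.1 b a * Y.1 a b + Y.1 b a * X.1 a b) := by
    have key (S S' : Matrix Idx Idx ℝ) (r : ℝ) :
        (1 / 2 : ℝ) • (X.1 * (Y.1 * (S - r • S') - (S - r • S') * Y.1) -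
          (Y.1 * (S - r • S') - (S - r • S') * Y.1) * X.1) =
        (1 / 2 : ℝ) • (((X.1 * Y.1) * S * 1 - X.1 * S * Y.1 - Y.1 * S * X.1 +
          1 * S * (Y.1 * X.1)) - r • ((X.1 * Y.1) * S' * 1 - X.1 * S' * Y.1 - Y.1 * S' * X.1 +
          1 * S' * (Y.1 * X.1))) := by
      simp only [Matrix.mul_sub, Matrix.sub_mul, Matrix.mul_smul, Matrix.smul_mul, mul_one,
        one_mul, Matrix.mul_assoc]
      module
    rw [h2, hE, key]
    simp only [Matrix.smul_apply, Matrix.sub_apply, Matrix.add_apply, smul_eq_mul, hent, hXd,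
      Matrix.one_apply]
    have e1 : d a * d b * X.1 a b = -X.1 b a := by
      linear_combination d b * hX' a b - X.1 b a * hdd b
    have e2 : d a * d b * Y.1 a b = -Y.1 b a := by
      linear_combination d b * hY' a b - Y.1 b a * hdd b
    rcases eq_or_ne a b with rfl | hab
    · simp only [if_true, hXd]
      linear_combination (-(1 / 2 : ℝ)) * ((X.1 * Y.1) a a + (Y.1 * X.1) a a) * hdd a
    · simp only [hab, if_false, if_true]
      linear_combination (1 / 2 : ℝ) * Y.1 a b * e1 + (1 / 2 : ℝ) * X.1 a b * e2
  have hc : (Y.1 * X.1).trace = (X.1 * Y.1).trace := Matrix.trace_mul_comm _ _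
  have t1 : ∑ a, (X.1 * Y.1) a a = (X.1 * Y.1).trace := rfl
  have t2 : ∑ a, (Y.1 * X.1) a a = (Y.1 * X.1).trace := rfl
  have t3 : ∑ a, ∑ b, X.1 b a * Y.1 a b = (X.1 * Y.1).trace := by
    rw [Finset.sum_comm]; rfl
  have t4 : ∑ a, ∑ b, Y.1 b a * X.1 a b = (Y.1 * X.1).trace := by
    rw [Finset.sum_comm]; rfl
  simp only [hsum, Finset.sum_sub_distrib, ← Finset.mul_sum, Finset.sum_add_distrib,
    Finset.sum_ite_eq, Finset.mem_univ, if_true, Finset.sum_const, ← Finset.smul_sum, t1, t2, t3, t4, hc]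
  norm_num
  ring

/-- The normalisation of the identification `⋀² V ≃ so(3,1)`. -/
theorem kil_wedgeV (X : so31) (v w : V) : kil X (wedgeV v w) = -eta (act X v) w := by
  have hX := (mem_so31_iff X.1).1 X.2
  rw [kil_eq_trace]
  change 2 * (X.1 * (-(1 / 4 : ℝ) • (Matrix.vecMulVec v (etaM *ᵥ w) -
    Matrix.vecMulVec w (etaM *ᵥ v)))).trace = -((X.1 *ᵥ v) ⬝ᵥ (etaM *ᵥ w))
  have h : (X.1 *ᵥ w) ⬝ᵥ (etaM *ᵥ v) = -((X.1 *ᵥ v) ⬝ᵥ (etaM *ᵥ w)) := by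
    have e (a b : V) : (X.1 *ᵥ a) ⬝ᵥ (etaM *ᵥ b) = a ⬝ᵥ ((X.1ᵀ * etaM) *ᵥ b) := by
      rw [← Matrix.mulVec_mulVec, Matrix.dotProduct_mulVec a, Matrix.vecMul_transpose]
    rw [e w v, hX, Matrix.neg_mulVec, dotProduct_neg, neg_inj, ← Matrix.mulVec_mulVec,
      Matrix.dotProduct_mulVec, ← Matrix.mulVec_transpose, etaM_transpose, dotProduct_comm]
  rw [Matrix.mul_smul, Matrix.mul_sub, Matrix.mul_vecMulVec, Matrix.mul_vecMulVec,
    Matrix.trace_smul, Matrix.trace_sub, Matrix.trace_vecMulVec, Matrix.trace_vecMulVec, h,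
    smul_eq_mul]
  ring

/-! ### Differential forms in a chart of a three-manifold

In a chart, a `1`-form `∑ₖ aₖ dxᵏ` is given by its components `aₖ`, a `2`-form
`∑ₖ bₖ dxᵏ⁺¹ ∧ dxᵏ⁺²` by its components `bₖ`, and a `3`-form `w dx⁰ ∧ dx¹ ∧ dx²` by `w`. Indices are
taken modulo three. -/

/-- The model space of the charts. -/
abbrev E3 := EuclideanSpace ℝ (Fin 3)

/-- `0`-forms in a chart. -/
abbrev F0 (X : Type*) := E3 → X
/-- `1`-forms in a chart. -/
abbrev F1 (X : Type*) := Fin 3 → E3 → X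
/-- `2`-forms in a chart. -/
abbrev F2 (X : Type*) := Fin 3 → E3 → X
/-- `3`-forms in a chart. -/
abbrev F3 (X : Type*) := E3 → X

/-- Partial derivative in the direction of the `k`-th coordinate. -/
def pd {X : Type*} [NormedAddCommGroup X] [NormedSpace ℝ X] (k : Fin 3) (u : E3 → X) : E3 → X :=
  fun x => fderiv ℝ u x (EuclideanSpace.single k 1)

section Operations

variable {X Y Z : Type*} [NormedAddCommGroup Z] [NormedSpace ℝ Z] (m : X → Y → Z)

/-- Product of a `0`-form and a `1`-form (or a `2`-form) along a bilinear map `m`. -/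
def w01 (f : F0 X) (a : F1 Y) : F1 Z := fun k x => m (f x) (a k x)

/-- Product of a `1`-form (or a `2`-form) and a `0`-form along a bilinear map `m`. -/
def w10 (a : F1 X) (f : F0 Y) : F1 Z := fun k x => m (a k x) (f x)

/-- Product of two `0`-forms along a bilinear map `m`. -/
def w00 (f : F0 X) (g : F0 Y) : F0 Z := fun x => m (f x) (g x)

/-- Wedge product of two `1`-forms along a bilinear map `m`. -/
def w11 (a : F1 X) (b : F1 Y) : F2 Z := fun k x =>
  m (a (k + 1) x) (b (k + 2) x) - m (a (k + 2) x) (b (k + 1) x)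

/-- Wedge product of a `1`-form and a `2`-form, or of a `2`-form and a `1`-form, along a bilinear
map `m`. (In both cases the sign is `+`, as `2`-forms commute with `1`-forms.) -/
def w12 (a : Fin 3 → E3 → X) (b : Fin 3 → E3 → Y) : F3 Z := fun x => ∑ k, m (a k x) (b k x)

/-- Product of a `3`-form and a `0`-form, or of a `0`-form and a `3`-form, along a bilinear map. -/
def w30 (w : E3 → X) (f : E3 → Y) : F3 Z := fun x => m (w x) (f x)

end Operations

section Covariant

variable {X : Type*} [NormedAddCommGroup X] [NormedSpace ℝ X] (r : so31 → X → X) (A : F1 so31)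

/-- `d_A u` for a `0`-form `u` with values in a representation `r`. -/
def dA0 (u : F0 X) : F1 X := fun k x => pd k u x + r (A k x) (u x)

/-- `d_A u` for a `1`-form `u` with values in a representation `r`. -/
def dA1 (u : F1 X) : F2 X := fun k x =>
  pd (k + 1) (u (k + 2)) x - pd (k + 2) (u (k + 1)) x + w11 r A u k x

/-- `d_A u` for a `2`-form `u` with values in a representation `r`. -/
def dA2 (u : F2 X) : F3 X := fun x => (∑ k, pd k (u k) x) + w12 r A u x

/-- The curvature `F_A = dA + ½ [A, A]`. -/
def curv (A : F1 so31) : F2 so31 := fun k x =>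
  pd (k + 1) (A (k + 2)) x - pd (k + 2) (A (k + 1)) x + (1 / 2 : ℝ) • w11 lieB A A k x

end Covariant

/-! ### Principal `SO(3,1)`-bundles over a closed oriented three-manifold -/

/-- The Jacobian matrix of a map of the model space. -/
def jac (ψ : E3 → E3) (x : E3) : Matrix (Fin 3) (Fin 3) ℝ :=
  Matrix.of fun l k => pd k (fun y => ψ y l) x

/-- A principal `SO(3,1)`-bundle over an oriented three-manifold `N`, presented by a finite oriented
atlas `(Uᵢ, chartᵢ)` of `N` over which the bundle is trivialised and by the transition functions
`gᵢⱼ : Uᵢ ∩ Uⱼ → SO(3,1)` (so that sections of an associated bundle satisfy `uᵢ = gᵢⱼ uⱼ`).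
A partition of unity subordinate to the atlas is included; it only serves to
compute integrals. -/
structure Bundle (ι : Type*) [Fintype ι] (N : Type*) [TopologicalSpace N]
    [ChartedSpace E3 N] where
  chart : ι → OpenPartialHomeomorph N E3
  chart_mem : ∀ i, chart i ∈ IsManifold.maximalAtlas (𝓡 3) ∞ N
  cover : ∀ p : N, ∃ i, p ∈ (chart i).source
  oriented : ∀ i j, ∀ x ∈ ((chart j).symm ≫ₕ chart i).source,
    0 < (jac (fun y => chart i ((chart j).symm y)) x).det
  g : ι → ι → N → SO31
  g_smooth : ∀ i j, ContDiffOn ℝ ∞ (fun x => (g j i ((chart j).symm x)).1)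
    ((chart j).symm ≫ₕ chart i).source
  g_cocycle : ∀ i j k, ∀ p ∈ (chart i).source ∩ (chart j).source ∩ (chart k).source,
    (g i j p).1 * (g j k p).1 = (g i k p).1
  pou : SmoothPartitionOfUnity ι (𝓡 3) N
  pou_subordinate : pou.IsSubordinate fun i => (chart i).source

/-- A point of the boundary phase space, or a tangent vector to it, in local components:
`A`, `e`, `S` are families of `1`-forms and `B`, `τ`, `c` are families of `2`-forms. The `so(3,1)*`-
valued forms `S` and `B` are written as `so(3,1)`-valued ones by means of the Killing form. -/
@[ext]
structure Config (ι : Type*) where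
  A : ι → F1 so31
  e : ι → F1 V
  S : ι → F1 so31
  B : ι → F2 so31
  τ : ι → F2 V
  c : ι → F2 so31

/-- The configuration `Φ + t Y`. -/
def Config.line {ι : Type*} (Φ Y : Config ι) (t : ℝ) : Config ι where
  A := Φ.A + t • Y.A
  e := Φ.e + t • Y.e
  S := Φ.S + t • Y.S
  B := Φ.B + t • Y.B
  τ := Φ.τ + t • Y.τ
  c := Φ.c + t • Y.c

namespace Bundle

variable {ι : Type*} [Fintype ι] {N : Type*} [TopologicalSpace N] [ChartedSpace E3 N]
  (P : Bundle ι N)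

/-- The change of coordinates from the `j`-th to the `i`-th chart. -/
def change (i j : ι) (x : E3) : E3 := P.chart i ((P.chart j).symm x)

/-- The domain of the change of coordinates from the `j`-th to the `i`-th chart. -/
def overlap (i j : ι) : Set E3 := ((P.chart j).symm ≫ₕ P.chart i).source

/-- The transition function `gⱼᵢ` in the coordinates of the `j`-th chart. -/
def gc (j i : ι) (x : E3) : SO31 := P.g j i ((P.chart j).symm x)

section Forms

variable {X : Type*} [NormedAddCommGroup X] [NormedSpace ℝ X] (r : SO31 → X → X)

/-- Smooth `0`-forms with values in the vector bundle associated with the representation `r`.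
Local components are set to zero outside the domain of the coordinates. -/
structure IsForm0 (u : ι → F0 X) : Prop where
  smooth : ∀ i, ContDiffOn ℝ ∞ (u i) (P.chart i).target
  supp : ∀ i, ∀ x ∉ (P.chart i).target, u i x = 0
  compat : ∀ i j, ∀ x ∈ P.overlap i j, u j x = r (P.gc j i x) (u i (P.change i j x))

/-- Smooth `1`-forms with values in the vector bundle associated with the representation `r`. -/
structure IsForm1 (u : ι → F1 X) : Prop where
  smooth : ∀ i k, ContDiffOn ℝ ∞ (u i k) (P.chart i).target
  supp : ∀ i k, ∀ x ∉ (P.chart i).target, u i k x = 0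
  compat : ∀ i j k, ∀ x ∈ P.overlap i j,
    u j k x = ∑ l, jac (P.change i j) x l k • r (P.gc j i x) (u i l (P.change i j x))

/-- Smooth `2`-forms with values in the vector bundle associated with the representation `r`.
They are pulled back with the `2 × 2` minors of the Jacobian matrix. -/
structure IsForm2 (u : ι → F2 X) : Prop where
  smooth : ∀ i k, ContDiffOn ℝ ∞ (u i k) (P.chart i).target
  supp : ∀ i k, ∀ x ∉ (P.chart i).target, u i k x = 0
  compat : ∀ i j k, ∀ x ∈ P.overlap i j,
    u j k x = ∑ l,
      (jac (P.change i j) x (l + 1) (k + 1) * jac (P.change i j) x (l + 2) (k + 2) -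
        jac (P.change i j) x (l + 1) (k + 2) * jac (P.change i j) x (l + 2) (k + 1)) •
      r (P.gc j i x) (u i l (P.change i j x))

end Forms

/-- Connections on the principal bundle: local `so(3,1)`-valued `1`-forms with
`Aⱼ = gⱼᵢ Aᵢ gⱼᵢ⁻¹ - dgⱼᵢ gⱼᵢ⁻¹`. -/
structure IsConnection (A : ι → F1 so31) : Prop where
  smooth : ∀ i k, ContDiffOn ℝ ∞ (A i k) (P.chart i).target
  supp : ∀ i k, ∀ x ∉ (P.chart i).target, A i k x = 0
  compat : ∀ i j k, ∀ x ∈ P.overlap i j,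
    (A j k x : Matrix Idx Idx ℝ) =
      (∑ l, jac (P.change i j) x l k • Ad (P.gc j i x) (A i l (P.change i j x)) : so31) -
        pd k (fun y => (P.gc j i y).1) x * (P.gc j i x).1⁻¹

/-- The integral over `N` of a `3`-form with components `w i`. -/
def integral (w : ι → F3 ℝ) : ℝ :=
  ∑ i, ∫ x in (P.chart i).target, P.pou i ((P.chart i).symm x) * w i x

/-! ### The boundary phase space -/

/-- The boundary phase space: connections `A` together with forms `e`, `S`, `B`, `τ`, `c`
with values in the bundles with fibres `V`, `so(3,1)*`, `so(3,1)*`, `V`, `so(3,1)`. -/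
def phaseSpace : Set (Config ι) :=
  {Φ | P.IsConnection Φ.A ∧ P.IsForm1 actV Φ.e ∧ P.IsForm1 Ad Φ.S ∧
    P.IsForm2 Ad Φ.B ∧ P.IsForm2 actV Φ.τ ∧ P.IsForm2 Ad Φ.c}

/-- The tangent space of the boundary phase space (at any of its points). -/
def tangentSpace : Set (Config ι) :=
  {Y | P.IsForm1 Ad Y.A ∧ P.IsForm1 actV Y.e ∧ P.IsForm1 Ad Y.S ∧
    P.IsForm2 Ad Y.B ∧ P.IsForm2 actV Y.τ ∧ P.IsForm2 Ad Y.c}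

/-- The symplectic form `∫ ⟨δB, δA⟩ + η(δτ, δe) + ⟨δc, δS⟩`, evaluated on two tangent vectors. -/
def symp (X Y : Config ι) : ℝ :=
  P.integral fun i x =>
    (w12 kil (X.B i) (Y.A i) x - w12 kil (Y.B i) (X.A i) x) +
    (w12 eta (X.τ i) (Y.e i) x - w12 eta (Y.τ i) (X.e i) x) +
    (w12 kil (X.c i) (Y.S i) x - w12 kil (Y.c i) (X.S i) x)

/-- `X` is the value at `Φ` of the Hamiltonian vector field of `f`: `ϖ(X, ·) = - δf`. For
`ϖ = δp δq` these are Hamilton's equations `q' = ∂f/∂p`, `p' = - ∂f/∂q`. -/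
def IsHamiltonianAt (f : Config ι → ℝ) (Φ X : Config ι) : Prop :=
  X ∈ P.tangentSpace ∧
    ∀ Y ∈ P.tangentSpace, HasDerivAt (fun t => f (Φ.line Y t)) (-P.symp X Y) 0

open Classical in
/-- The value at `Φ` of the Hamiltonian vector field of `f` (and zero if there is none). -/
def hamiltonianVector (f : Config ι → ℝ) (Φ : Config ι) : Config ι :=
  if h : ∃ X, P.IsHamiltonianAt f Φ X then h.choose else ⟨0, 0, 0, 0, 0, 0⟩

/-- The Poisson bracket `{f, g}`: the derivative of `g` along the Hamiltonian vector field
of `f`. -/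
def poisson (f g : Config ι → ℝ) (Φ : Config ι) : ℝ :=
  deriv (fun t => g (Φ.line (P.hamiltonianVector f Φ) t)) 0

/-! ### The constraints -/

/-- The map `id + β T`. -/
def idAdd (β : ℝ) (T : so31 ≃ₗ⁅ℝ, so31⁆ so31) (X : so31) : so31 := X + β • T X

/-- The map `β (id - T)`. -/
def defect (β : ℝ) (T : so31 ≃ₗ⁅ℝ, so31⁆ so31) (X : so31) : so31 := β • (X - T X)

/-- `H_θ = ∫ ⟨d_A B - e ∧ τ - [c, S], θ⟩`. -/
def H (θ : ι → F0 so31) (Φ : Config ι) : ℝ :=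
  P.integral fun i => w30 kil
    (dA2 lieB (Φ.A i) (Φ.B i) - w12 wedgeV (Φ.e i) (Φ.τ i) - w12 lieB (Φ.c i) (Φ.S i)) (θ i)

/-- `I_ε = ∫ η(d_A τ, ε) + ⟨c, e ∧ ε⟩`. -/
def I (ε : ι → F0 V) (Φ : Config ι) : ℝ :=
  P.integral fun i =>
    w30 eta (dA2 act (Φ.A i) (Φ.τ i)) (ε i) + w12 kil (Φ.c i) (w10 wedgeV (Φ.e i) (ε i))

/-- `J_σ = ∫ ⟨d_A c, σ⟩`. -/
def J (σ : ι → F0 so31) (Φ : Config ι) : ℝ :=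
  P.integral fun i => w30 kil (dA2 lieB (Φ.A i) (Φ.c i)) (σ i)

/-- `K_α = ∫ ⟨(id + β T) B + d_A S + ½ [e, e], α⟩`, where `[v, w] = - v ∧ w` is the bracket
`V × V → so(3,1)*` of the trivial standard extension, determined by
`⟨χ, [v, w]⟩ = η(χ v, w)`. -/
def K (β : ℝ) (T : so31 ≃ₗ⁅ℝ, so31⁆ so31) (α : ι → F1 so31) (Φ : Config ι) : ℝ :=
  P.integral fun i => w12 kil
    ((fun k x => idAdd β T (Φ.B i k x)) + dA1 lieB (Φ.A i) (Φ.S i) -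
      (1 / 2 : ℝ) • w11 wedgeV (Φ.e i) (Φ.e i)) (α i)

/-- `L_ρ = ∫ η(d_A e + (1 + β) τ, ρ)`. -/
def L (β : ℝ) (ρ : ι → F1 V) (Φ : Config ι) : ℝ :=
  P.integral fun i => w12 eta (dA1 act (Φ.A i) (Φ.e i) + (1 + β) • Φ.τ i) (ρ i)

/-- `M_ζ = ∫ ⟨F_A + (id + β T) c, ζ⟩`. -/
def M (β : ℝ) (T : so31 ≃ₗ⁅ℝ, so31⁆ so31) (ζ : ι → F1 so31) (Φ : Config ι) : ℝ :=
  P.integral fun i => w12 kil (curv (Φ.A i) + fun k x => idAdd β T (Φ.c i k x)) (ζ i)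

/-- The set of all constraint functionals `H_θ`, `I_ε`, `K_α`, `L_ρ`, `M_ζ`. -/
def constraints (β : ℝ) (T : so31 ≃ₗ⁅ℝ, so31⁆ so31) : Set (Config ι → ℝ) :=
  {f | (∃ θ, P.IsForm0 Ad θ ∧ f = P.H θ) ∨ (∃ ε, P.IsForm0 actV ε ∧ f = P.I ε) ∨
    (∃ α, P.IsForm1 Ad α ∧ f = P.K β T α) ∨ (∃ ρ, P.IsForm1 actV ρ ∧ f = P.L β ρ) ∨
    (∃ ζ, P.IsForm1 Ad ζ ∧ f = P.M β T ζ)}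

/-- The constraint surface: the common zeros of the constraints in the phase space. -/
def constraintSurface (β : ℝ) (T : so31 ≃ₗ⁅ℝ, so31⁆ so31) : Set (Config ι) :=
  {Φ | Φ ∈ P.phaseSpace ∧ ∀ f ∈ P.constraints β T, f Φ = 0}

/-- The constraint set is first class: all Poisson brackets of constraints vanish on the
constraint surface. -/
def FirstClass (β : ℝ) (T : so31 ≃ₗ⁅ℝ, so31⁆ so31) : Prop :=
  ∀ f ∈ P.constraints β T, ∀ f' ∈ P.constraints β T,
    ∀ Φ ∈ P.constraintSurface β T, P.poisson f f' Φ = 0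

end Bundle

/-- The topological sector condition `β T = β id`. -/
def TopologicalSector (β : ℝ) (T : so31 ≃ₗ⁅ℝ, so31⁆ so31) : Prop := ∀ X, β • T X = β • X

/-- The invertibility sector condition `β T ≠ - id`. -/
def InvertibilitySector (β : ℝ) (T : so31 ≃ₗ⁅ℝ, so31⁆ so31) : Prop := ¬ ∀ X, β • T X = -X

end QeGR

end

/-!
All bundle-valued forms are families of local components, and every argument is made pointwise in a
chart once two global facts are available.

* *Naturality.* A form of degree `p` with values in a representation is a section whose transition
  functions are a matrix built from the Jacobian matrix (`tr0`, `tr1`, `tr2`) times the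
  representation (`IsTensor`). Invariant products and covariant derivatives preserve this
  (`IsTensor.w01`, `IsTensor.w11`, `IsTensor.dA1`), because the inhomogeneous term of a connection
  cancels the derivative of the transition function (`IsConn.covariant`). The curvature is tensorial
  because it is the square of the covariant derivative (`IsConn.isTensor_curv`).
* *Stokes' theorem* (`stokes`), which with the Leibniz rule gives integration by parts for covariant
  derivatives (`integral_dA2_add`, `integral_dA1_sub`).

The integrands of the constraints are quadratic along every line in phase space, so their first
variations can be written down (`hasDerivAt_integral`). Integration by parts turns each variation
into `-ϖ(X, ·)` for an explicit tangent vector `X` (`vecH`, `vecI`, `vecK`, `vecL`, `vecM`).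
Uniqueness of `X` is the non-degeneracy of `ϖ` (`eq_of_symp_eq`), which reduces to the fundamental
lemma of the calculus of variations, with test forms extended by zero from a chart
(`eq_zero_of_integral`).

Since the Hamiltonian vectors are explicit, a bracket is the variation of one constraint along the
vector of the other. The Leibniz rules, `d_A d_A u = F_A · u` (`dA1_dA0`, `dA2_dA1`) and the
invariance of the pairings give the table of brackets, with the defect `β (id - T)` as the
difference between `1 + β` in `L` and `id + β T` in `K` and `M`. The last identity is the Bianchi
identity (`dA2_curv`) together with integration by parts (`J_eq_M`).

The algebraic input about `T` is that the commutant of the adjoint representation is `ℂ`, with the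
Hodge star as imaginary unit (`exists_eq_add_star`). A non-zero endomorphism is therefore invertible
(`commutant_inverse`), is symmetric for the Killing form (`commutant_kil`) and commutes with
`SO(3,1)` (`commutant_Ad`). This applies to `id + β T`, to its inverse and to `β (id - T)`.

If `β (id - T) = 0`, all brackets are constraints or zero. Conversely, the defect in `{L_ρ, I_ε}` is
detected on the configuration `c = -(id + β T)⁻¹ F_A`, `e = S = B = τ = 0`, which satisfies all
constraints. Connections exist by a partition of unity (`isConn_averageConn`), and one with
`F_A ≠ 0` at some point is obtained by a local modification (`exists_curv_ne_zero`). As `ρ` and `ε`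
are arbitrary, `β (id - T) c = 0` everywhere, and a non-zero `β (id - T)` is injective, so that
`F_A = 0`, a contradiction.
-/

noncomputable section

namespace QeGR

open scoped Topology

/-! ### Algebra of `so(3,1)` and its pairings -/

theorem so31_ext {X Y : so31} (h : X.1 = Y.1) : X = Y := Subtype.ext h

theorem act_add (X : so31) (v w : V) : act X (v + w) = act X v + act X w := Matrix.mulVec_add _ _ _
theorem add_act (X Y : so31) (v : V) : act (X + Y) v = act X v + act Y v := Matrix.add_mulVec _ _ _
theorem act_smul (r : ℝ) (X : so31) (v : V) : act X (r • v) = r • act X v :=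
  Matrix.mulVec_smul _ _ _
theorem smul_act (r : ℝ) (X : so31) (v : V) : act (r • X) v = r • act X v :=
  Matrix.smul_mulVec _ _ _

theorem coe_lieB (X Y : so31) : (lieB X Y).1 = X.1 * Y.1 - Y.1 * X.1 := rfl

theorem lieB_act (X Y : so31) (v : V) : act (lieB X Y) v = act X (act Y v) - act Y (act X v) := by
  simp only [act, coe_lieB, Matrix.sub_mulVec, Matrix.mulVec_mulVec]

theorem lieB_skew (X Y : so31) : lieB X Y = -lieB Y X := (lie_skew X Y).symm

theorem lieB_lieB (X Y Z : so31) :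
    lieB (lieB X Y) Z = lieB X (lieB Y Z) - lieB Y (lieB X Z) := lie_lie X Y Z

theorem kil_comm (X Y : so31) : kil X Y = kil Y X := by
  rw [kil_eq_trace, kil_eq_trace, Matrix.trace_mul_comm]

theorem kil_lieB (X Y Z : so31) : kil (lieB X Y) Z = kil X (lieB Y Z) := by
  rw [kil_eq_trace, kil_eq_trace, coe_lieB, coe_lieB, sub_mul, mul_sub, Matrix.trace_sub,
    Matrix.trace_sub, mul_assoc, ← mul_assoc X.1 Z.1, Matrix.trace_mul_comm (X.1 * Z.1), mul_assoc]

theorem eta_comm (v w : V) : eta v w = eta w v := by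
  rw [eta, eta, Matrix.dotProduct_mulVec, ← Matrix.mulVec_transpose, etaM_transpose,
    dotProduct_comm]

/-- Elements of `so(3,1)` are skew for the Minkowski metric. -/
theorem eta_act (X : so31) (v w : V) : eta (act X v) w = -eta v (act X w) := by
  have hX := (mem_so31_iff X.1).1 X.2
  simp only [eta, act]
  rw [dotProduct_comm, Matrix.dotProduct_mulVec, ← Matrix.mulVec_transpose, dotProduct_comm,
    Matrix.mulVec_mulVec, hX, Matrix.neg_mulVec, dotProduct_neg, Matrix.mulVec_mulVec]

theorem wedgeV_skew (v w : V) : wedgeV v w = -wedgeV w v := by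
  apply so31_ext
  change -(1 / 4 : ℝ) • _ = -(-(1 / 4 : ℝ) • _)
  module

theorem eta_etaM (v w : V) : eta v (etaM *ᵥ w) = v ⬝ᵥ w := by
  rw [eta, Matrix.mulVec_mulVec, etaM_mul_self, Matrix.one_mulVec]

/-- The Killing form is non-degenerate: its radical is read off from `kil_wedgeV`. -/
theorem eq_zero_of_kil (X : so31) (h : ∀ Y, kil X Y = 0) : X = 0 := by
  apply so31_ext
  have h1 : ∀ v w : V, eta (act X v) w = 0 := fun v w => by
    have := kil_wedgeV X v w
    rw [h] at this; linarith
  ext a b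
  have h2 := h1 (Pi.single b 1) (etaM *ᵥ Pi.single a 1)
  rw [eta_etaM] at h2
  simpa [act] using h2

theorem eq_zero_of_eta (v : V) (h : ∀ w, eta v w = 0) : v = 0 := by
  ext a
  have h2 := h (etaM *ᵥ Pi.single a 1)
  rw [eta_etaM] at h2
  simpa using h2

theorem eq_zero_of_act (X : so31) (h : ∀ v, act X v = 0) : X = 0 := by
  apply eq_zero_of_kil
  intro Y
  rw [kil_eq_trace]
  have : X.1 = 0 := by
    ext a b
    simpa [act] using congrFun (h (Pi.single b 1)) a
  simp [this]

/-! ### Equivariance under `SO(3,1)` -/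

theorem SO31.isUnit (L : SO31) : IsUnit L.1.det := by rw [L.2.2]; exact isUnit_one

theorem SO31.mul_inv (L : SO31) : L.1 * L.1⁻¹ = 1 := Matrix.mul_nonsing_inv _ L.isUnit
theorem SO31.inv_mul (L : SO31) : L.1⁻¹ * L.1 = 1 := Matrix.nonsing_inv_mul _ L.isUnit

theorem SO31.inv_eq (L : SO31) : L.1⁻¹ = etaM * L.1ᵀ * etaM := by
  apply Matrix.inv_eq_left_inv
  rw [mul_assoc, mul_assoc, ← mul_assoc _ etaM, L.2.1, etaM_mul_self]

theorem coe_Ad (L : SO31) (X : so31) : (Ad L X).1 = L.1 * X.1 * L.1⁻¹ := rfl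

theorem Ad_lieB (L : SO31) (X Y : so31) : Ad L (lieB X Y) = lieB (Ad L X) (Ad L Y) := by
  apply so31_ext
  have h (A B : Matrix Idx Idx ℝ) : L.1 * (A * B) * L.1⁻¹ =
      L.1 * A * L.1⁻¹ * (L.1 * B * L.1⁻¹) := by
    calc L.1 * (A * B) * L.1⁻¹ = L.1 * A * 1 * B * L.1⁻¹ := by simp only [mul_assoc, one_mul]
      _ = _ := by rw [← L.inv_mul]; simp only [mul_assoc]
  simp only [coe_lieB, coe_Ad, mul_sub, sub_mul, h]

theorem Ad_act (L : SO31) (X : so31) (v : V) : act (Ad L X) (actV L v) = actV L (act X v) := by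
  simp only [act, actV, coe_Ad, Matrix.mulVec_mulVec]
  rw [mul_assoc, L.inv_mul, mul_one]

theorem kil_Ad (L : SO31) (X Y : so31) : kil (Ad L X) (Ad L Y) = kil X Y := by
  rw [kil_eq_trace, kil_eq_trace, coe_Ad, coe_Ad]
  have : L.1 * X.1 * L.1⁻¹ * (L.1 * Y.1 * L.1⁻¹) = L.1 * (X.1 * Y.1) * L.1⁻¹ := by
    calc _ = L.1 * X.1 * (L.1⁻¹ * L.1) * Y.1 * L.1⁻¹ := by simp only [mul_assoc]
      _ = _ := by rw [L.inv_mul]; simp only [mul_assoc, one_mul]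
  rw [this, Matrix.trace_mul_comm, ← mul_assoc, L.inv_mul, one_mul]

theorem eta_actV (L : SO31) (v w : V) : eta (actV L v) (actV L w) = eta v w := by
  simp only [eta, actV]
  rw [dotProduct_comm, Matrix.dotProduct_mulVec, ← Matrix.mulVec_transpose, dotProduct_comm,
    Matrix.mulVec_mulVec, Matrix.mulVec_mulVec, L.2.1]

theorem Ad_add (L : SO31) (X Y : so31) : Ad L (X + Y) = Ad L X + Ad L Y := by
  apply so31_ext
  change L.1 * (X.1 + Y.1) * L.1⁻¹ = L.1 * X.1 * L.1⁻¹ + L.1 * Y.1 * L.1⁻¹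
  rw [mul_add, add_mul]

theorem Ad_smul (L : SO31) (r : ℝ) (X : so31) : Ad L (r • X) = r • Ad L X := by
  apply so31_ext
  change L.1 * (r • X.1) * L.1⁻¹ = r • (L.1 * X.1 * L.1⁻¹)
  rw [Matrix.mul_smul, Matrix.smul_mul]

/-- The matrix `K` is kept separate from the product `L M`, as `SO31` carries no multiplication. -/
theorem Ad_mul {L M K : SO31} (h : L.1 * M.1 = K.1) (X : so31) : Ad L (Ad M X) = Ad K X := by
  apply so31_ext
  simp only [coe_Ad, ← h, Matrix.mul_inv_rev, mul_assoc]

/-- The inverse of an element of `SO(3,1)`. -/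
def SO31.inv (L : SO31) : SO31 := ⟨L.1⁻¹, by
  constructor
  · calc (L.1⁻¹)ᵀ * etaM * L.1⁻¹ = (L.1⁻¹)ᵀ * (L.1ᵀ * etaM * L.1) * L.1⁻¹ := by rw [L.2.1]
      _ = (L.1 * L.1⁻¹)ᵀ * etaM * (L.1 * L.1⁻¹) := by
        rw [Matrix.transpose_mul]; simp only [mul_assoc]
      _ = etaM := by rw [L.mul_inv]; simp
  · rw [Matrix.det_nonsing_inv, L.2.2]; simp⟩

theorem Ad_Ad_inv (L : SO31) (X : so31) : Ad L (Ad L.inv X) = X := by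
  apply so31_ext
  rw [coe_Ad, coe_Ad]
  change L.1 * (L.1⁻¹ * X.1 * L.1⁻¹⁻¹) * L.1⁻¹ = _
  rw [Matrix.nonsing_inv_nonsing_inv _ L.isUnit]
  calc _ = L.1 * L.1⁻¹ * X.1 * (L.1 * L.1⁻¹) := by simp only [mul_assoc]
    _ = _ := by rw [L.mul_inv]; simp

theorem actV_actV_inv (L : SO31) (v : V) : actV L (actV L.inv v) = v := by
  change L.1 *ᵥ (L.1⁻¹ *ᵥ v) = v
  rw [Matrix.mulVec_mulVec, L.mul_inv, Matrix.one_mulVec]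

theorem Ad_wedgeV (L : SO31) (v w : V) : Ad L (wedgeV v w) = wedgeV (actV L v) (actV L w) := by
  rw [← sub_eq_zero]
  apply eq_zero_of_kil
  intro Y
  obtain ⟨Z, rfl⟩ : ∃ Z, Y = Ad L Z := ⟨_, (Ad_Ad_inv L Y).symm⟩
  have h : kil (Ad L (wedgeV v w) - wedgeV (actV L v) (actV L w)) (Ad L Z) =
      kil (Ad L (wedgeV v w)) (Ad L Z) - kil (wedgeV (actV L v) (actV L w)) (Ad L Z) := by
    simp only [kil, map_sub, LinearMap.sub_apply]
  rw [h, kil_Ad, kil_comm, kil_wedgeV, kil_comm, kil_wedgeV, Ad_act, eta_actV, sub_self]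

theorem lieB_wedgeV (X : so31) (v w : V) :
    lieB X (wedgeV v w) = wedgeV (act X v) w + wedgeV v (act X w) := by
  rw [← sub_eq_zero]
  apply eq_zero_of_kil
  intro Y
  have h : kil (lieB X (wedgeV v w) - (wedgeV (act X v) w + wedgeV v (act X w))) Y =
      kil (lieB X (wedgeV v w)) Y - (kil (wedgeV (act X v) w) Y + kil (wedgeV v (act X w)) Y) := by
    simp only [kil, map_sub, map_add, LinearMap.sub_apply, LinearMap.add_apply]
  rw [h, kil_comm, ← kil_lieB, kil_wedgeV, kil_comm, kil_wedgeV, kil_comm, kil_wedgeV, lieB_act]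
  have : eta (act Y (act X v) - act X (act Y v)) w =
      eta (act Y (act X v)) w - eta (act X (act Y v)) w := by
    simp only [eta, sub_dotProduct]
  rw [this, eta_act X]
  ring

/-! ### The commutant of the adjoint representation -/

/-- The element of `so(3,1)` with rotation part `x` and boost part `y`. As a complex Lie algebra
`so(3,1)` is `ℂ³` with the cross product, `x + i y` being the coordinates. -/
def ofCoords (x y : Fin 3 → ℝ) : so31 :=
  ⟨Matrix.fromBlocks !![0, -x 2, x 1; x 2, 0, -x 0; -x 1, x 0, 0] (Matrix.of fun a _ => y a)
    (Matrix.of fun _ a => y a) 0, by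
    rw [mem_so31_iff]
    ext a b
    rcases a with a | a <;> rcases b with b | b <;> fin_cases a <;> fin_cases b <;>
      simp [etaM, LieAlgebra.Orthogonal.indefiniteDiagonal, Matrix.mul_diagonal,
        Matrix.diagonal_mul]⟩

/-- The rotation part of an element of `so(3,1)`. -/
def rot (X : so31) : Fin 3 → ℝ :=
  ![X.1 (.inl 2) (.inl 1), X.1 (.inl 0) (.inl 2), X.1 (.inl 1) (.inl 0)]

/-- The boost part of an element of `so(3,1)`. -/
def boost (X : so31) : Fin 3 → ℝ := fun a => X.1 (.inl a) (.inr 0)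

theorem ofCoords_rot_boost (X : so31) : ofCoords (rot X) (boost X) = X := by
  have hX := fun a b => congrFun (congrFun ((mem_so31_iff X.1).1 X.2) a) b
  simp [etaM, LieAlgebra.Orthogonal.indefiniteDiagonal, Matrix.mul_diagonal,
        Matrix.diagonal_mul, -Sum.forall] at hX
  apply so31_ext
  ext a b
  have h1 := hX a b
  have h2 := hX b a
  rcases a with a | a <;> rcases b with b | b <;> fin_cases a <;> fin_cases b <;>
    simp [ofCoords, rot, boost] at h1 h2 ⊢ <;> linarith

theorem rot_ofCoords (x y : Fin 3 → ℝ) : rot (ofCoords x y) = x := by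
  ext a; fin_cases a <;> simp [rot, ofCoords]

theorem boost_ofCoords (x y : Fin 3 → ℝ) : boost (ofCoords x y) = y := by
  ext a; fin_cases a <;> simp [boost, ofCoords]

theorem coords_ext {X Y : so31} (h : rot X = rot Y) (h' : boost X = boost Y) : X = Y := by
  rw [← ofCoords_rot_boost X, ← ofCoords_rot_boost Y, h, h']

theorem rot_add (X Y : so31) : rot (X + Y) = rot X + rot Y := by
  ext a; fin_cases a <;> rfl
theorem boost_add (X Y : so31) : boost (X + Y) = boost X + boost Y := rfl
theorem rot_smul (r : ℝ) (X : so31) : rot (r • X) = r • rot X := by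
  ext a; fin_cases a <;> rfl
theorem boost_smul (r : ℝ) (X : so31) : boost (r • X) = r • boost X := rfl

open scoped Matrix in
theorem rot_lieB (X Y : so31) : rot (lieB X Y) =
    crossProduct (rot X) (rot Y) - crossProduct (boost X) (boost Y) := by
  rw [← ofCoords_rot_boost X, ← ofCoords_rot_boost Y]
  simp only [rot_ofCoords, boost_ofCoords]
  ext a; fin_cases a <;>
  simp [rot, coe_lieB, ofCoords, Matrix.fromBlocks_multiply, crossProduct,
    Matrix.mul_apply] <;> ring

theorem boost_lieB (X Y : so31) : boost (lieB X Y) =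
    crossProduct (rot X) (boost Y) + crossProduct (boost X) (rot Y) := by
  rw [← ofCoords_rot_boost X, ← ofCoords_rot_boost Y]
  simp only [rot_ofCoords, boost_ofCoords]
  ext a; fin_cases a <;>
  simp [boost, coe_lieB, ofCoords, Matrix.fromBlocks_multiply, crossProduct, Matrix.vecHead,
    Matrix.vecTail] <;> ring

theorem kil_coords (X Y : so31) :
    kil X Y = 4 * (boost X ⬝ᵥ boost Y - rot X ⬝ᵥ rot Y) := by
  rw [← ofCoords_rot_boost X, ← ofCoords_rot_boost Y, kil_eq_trace]
  simp only [rot_ofCoords, boost_ofCoords]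
  simp [ofCoords, Matrix.fromBlocks_multiply, Matrix.trace, Matrix.mul_apply,
    Fin.sum_univ_three, dotProduct, Matrix.vecHead, Matrix.vecTail]
  ring

/-- The Hodge star of `so(3,1) = ⋀² V`, which is multiplication by `i` in the complex
coordinates. -/
def star (X : so31) : so31 := ofCoords (-boost X) (rot X)

/-- An endomorphism of the adjoint representation is multiplication by a complex number: the image
of a basis vector commutes with that vector, hence is a complex multiple of it, and the bracket
carries the factor over to the other basis vectors. -/
theorem exists_eq_add_star (T : so31 →ₗ[ℝ] so31) (hT : ∀ X Y, T (lieB X Y) = lieB X (T Y)) :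
    ∃ a b : ℝ, ∀ X, T X = a • X + b • star X := by
  set e : Fin 3 → so31 := fun k => ofCoords (Pi.single k 1) 0 with he
  set f : Fin 3 → so31 := fun k => ofCoords 0 (Pi.single k 1) with hf
  have hre (k) : rot (e k) = Pi.single k 1 := rot_ofCoords _ _
  have hbe (k) : boost (e k) = 0 := boost_ofCoords _ _
  have hrf (k) : rot (f k) = 0 := rot_ofCoords _ _
  have hbf (k) : boost (f k) = Pi.single k 1 := boost_ofCoords _ _
  have h0 : lieB (e 0) (T (e 0)) = 0 := by
    rw [← hT, show lieB (e 0) (e 0) = 0 from lie_self _, map_zero]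
  have hr := congrArg rot h0
  have hb := congrArg boost h0
  rw [rot_lieB, hre, hbe] at hr
  rw [boost_lieB, hre, hbe] at hb
  have hr1 := congrFun hr 1
  have hr2 := congrFun hr 2
  have hb1 := congrFun hb 1
  have hb2 := congrFun hb 2
  simp [crossProduct, rot, boost] at hr1 hr2 hb1 hb2
  have c3 (x y : Fin 3 → ℝ) (h1 : x 0 = y 0) (h2 : x 1 = y 1) (h3 : x 2 = y 2) : x = y := by
    ext a; fin_cases a <;> assumption
  have he0 : T (e 0) = rot (T (e 0)) 0 • e 0 + boost (T (e 0)) 0 • f 0 := by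
    apply coords_ext
    · rw [rot_add, rot_smul, rot_smul, hre, hrf]
      apply c3 <;> simp [rot, hr1, hr2]
    · rw [boost_add, boost_smul, boost_smul, hbe, hbf]
      apply c3 <;> simp [boost, hb1, hb2]
  have hs (X Y Z : so31) (h : lieB X Y = Z) : T Z = lieB X (T Y) := by rw [← h, hT]
  have b1 : lieB (e 2) (e 0) = e 1 := by
    apply coords_ext
    · rw [rot_lieB, hre, hre, hre, hbe, hbe]; apply c3 <;> simp [crossProduct]
    · rw [boost_lieB, hre, hre, hbe, hbe, hbe]; apply c3 <;> simp
  have b2 : lieB (-e 1) (e 0) = e 2 := by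
    rw [← neg_one_smul ℝ (e 1)]
    apply coords_ext
    · rw [rot_lieB, rot_smul, boost_smul, hre, hre, hre, hbe, hbe]
      apply c3 <;> simp [crossProduct]
    · rw [boost_lieB, rot_smul, boost_smul, hre, hre, hbe, hbe, hbe]; apply c3 <;> simp
  have b3 : lieB (f 2) (e 0) = f 1 := by
    apply coords_ext
    · rw [rot_lieB, hrf, hre, hrf, hbf, hbe]; apply c3 <;> simp
    · rw [boost_lieB, hre, hrf, hbf, hbe, hbf]; apply c3 <;> simp [crossProduct]
  have b4 : lieB (-f 1) (e 0) = f 2 := by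
    rw [← neg_one_smul ℝ (f 1)]
    apply coords_ext
    · rw [rot_lieB, rot_smul, boost_smul, hrf, hre, hrf, hbf, hbe]; apply c3 <;> simp
    · rw [boost_lieB, rot_smul, boost_smul, hre, hrf, hbf, hbe, hbf]
      apply c3 <;> simp [crossProduct]
  have b5 : lieB (f 1) (e 2) = f 0 := by
    apply coords_ext
    · rw [rot_lieB, hrf, hre, hrf, hbf, hbe]; apply c3 <;> simp
    · rw [boost_lieB, hre, hrf, hbf, hbe, hbf]; apply c3 <;> simp [crossProduct]
  have t1 := hs _ _ _ b1
  have t2 := hs _ _ _ b2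
  have t3 := hs _ _ _ b3
  have t4 := hs _ _ _ b4
  have t5 := hs _ _ _ b5
  rw [t2] at t5
  generalize rot (T (e 0)) 0 = a at *
  generalize boost (T (e 0)) 0 = b at *
  rw [he0] at t1 t2 t3 t4 t5
  refine ⟨a, b, fun X => ?_⟩
  have hX : X = rot X 0 • e 0 + rot X 1 • e 1 + rot X 2 • e 2 + boost X 0 • f 0 +
      boost X 1 • f 1 + boost X 2 • f 2 := by
    apply coords_ext
    · simp only [rot_add, rot_smul, hre, hrf]; apply c3 <;> simp
    · simp only [boost_add, boost_smul, hbe, hbf]; apply c3 <;> simp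
  have hTX : T X = rot X 0 • T (e 0) + rot X 1 • T (e 1) + rot X 2 • T (e 2) +
      boost X 0 • T (f 0) + boost X 1 • T (f 1) + boost X 2 • T (f 2) := by
    conv_lhs => rw [hX]
    simp only [map_add, map_smul]
  rw [hTX, he0, t1, t2, t3, t4, t5, ← neg_one_smul ℝ (e 1), ← neg_one_smul ℝ (f 1)]
  apply coords_ext
  · simp only [rot_lieB, boost_lieB, rot_add, rot_smul, boost_add, boost_smul, hre, hrf, hbe, hbf,
      star, rot_ofCoords]
    apply c3 <;> simp [crossProduct, Matrix.vecHead, Matrix.vecTail] <;> ring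
  · simp only [rot_lieB, boost_lieB, rot_add, rot_smul, boost_add, boost_smul, hre, hrf, hbe, hbf,
      star, boost_ofCoords]
    apply c3 <;> simp [crossProduct, Matrix.vecHead, Matrix.vecTail] <;> ring

theorem star_star (X : so31) : star (star X) = -X := by
  apply coords_ext
  · rw [← neg_one_smul ℝ X, rot_smul]; simp [star, rot_ofCoords, boost_ofCoords]
  · rw [← neg_one_smul ℝ X, boost_smul]; simp [star, rot_ofCoords, boost_ofCoords]

theorem star_add (X Y : so31) : star (X + Y) = star X + star Y := by
  apply coords_ext
  · simp [star, rot_ofCoords, rot_add, boost_add, add_comm]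
  · simp [star, boost_ofCoords, rot_add, boost_add]

theorem star_smul (r : ℝ) (X : so31) : star (r • X) = r • star X := by
  apply coords_ext
  · simp [star, rot_ofCoords, rot_smul, boost_smul]
  · simp [star, boost_ofCoords, rot_smul, boost_smul]

theorem kil_star (X Y : so31) : kil (star X) Y = kil X (star Y) := by
  simp only [kil_coords, star, rot_ofCoords, boost_ofCoords, neg_dotProduct, dotProduct_neg]
  ring

/-! ### Equivariance and inverses of the commutant -/

/-- The Pfaffian of a `4 × 4` matrix that is skew-symmetric. -/
def pfaffian (N : Matrix (Fin 4) (Fin 4) ℝ) : ℝ :=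
  N 0 1 * N 2 3 - N 0 2 * N 1 3 + N 0 3 * N 1 2

theorem pfaffian_conj (L : Matrix (Fin 4) (Fin 4) ℝ) (x y : Fin 3 → ℝ) :
    pfaffian (L * !![0, -x 2, x 1, -y 0; x 2, 0, -x 0, -y 1; -x 1, x 0, 0, -y 2;
      y 0, y 1, y 2, 0] * Lᵀ) = L.det * (x 0 * y 0 + x 1 * y 1 + x 2 * y 2) := by
  rw [Matrix.det_succ_row_zero]
  simp [pfaffian, Matrix.mul_apply, Fin.sum_univ_four, Matrix.det_fin_three, Fin.succAbove]
  ring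

/-- The enumeration of the index set of Minkowski space. -/
def idxEquiv : Fin 4 ≃ Idx := (finSumFinEquiv (m := 3) (n := 1)).symm

theorem submatrix_mul_etaM (X : so31) : (X.1 * etaM).submatrix idxEquiv idxEquiv =
      !![0, -rot X 2, rot X 1, -boost X 0; rot X 2, 0, -rot X 0, -boost X 1;
        -rot X 1, rot X 0, 0, -boost X 2; boost X 0, boost X 1, boost X 2, 0] := by
  have i0 : idxEquiv 0 = .inl 0 := rfl
  have i1 : idxEquiv 1 = .inl 1 := rfl
  have i2 : idxEquiv 2 = .inl 2 := rfl
  have i3 : idxEquiv 3 = .inr 0 := rfl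
  rw [← ofCoords_rot_boost X]
  simp only [rot_ofCoords, boost_ofCoords]
  ext a b
  fin_cases a <;> fin_cases b <;>
    simp [i0, i1, i2, i3, etaM, LieAlgebra.Orthogonal.indefiniteDiagonal, Matrix.mul_diagonal,
      ofCoords]

/-- Up to a factor, `kil (star X) X` is the Pfaffian of the skew-symmetric matrix `X η`, which
elements of determinant one preserve. -/
theorem kil_star_Ad_self (L : SO31) (X : so31) :
    kil (star (Ad L X)) (Ad L X) = kil (star X) X := by
  have h1 (X : so31) : kil (star X) X =
      8 * pfaffian ((X.1 * etaM).submatrix idxEquiv idxEquiv) := by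
    rw [submatrix_mul_etaM, kil_coords]
    simp [star, rot_ofCoords, boost_ofCoords, pfaffian, dotProduct, Fin.sum_univ_three]
    ring
  have h2 : (Ad L X).1 * etaM = L.1 * (X.1 * etaM) * L.1ᵀ := by
    rw [coe_Ad, L.inv_eq]
    simp only [mul_assoc, etaM_mul_self, mul_one]
  have h3 : (L.1 * (X.1 * etaM) * L.1ᵀ).submatrix idxEquiv idxEquiv =
      L.1.submatrix idxEquiv idxEquiv * (X.1 * etaM).submatrix idxEquiv idxEquiv *
        (L.1.submatrix idxEquiv idxEquiv)ᵀ := by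
    rw [Matrix.transpose_submatrix, Matrix.submatrix_mul_equiv, Matrix.submatrix_mul_equiv]
  rw [h1 (Ad L X), h2, h3, submatrix_mul_etaM, pfaffian_conj, Matrix.det_submatrix_equiv_self,
    L.2.2, h1, submatrix_mul_etaM]
  simp [pfaffian]
  ring

/-- The quadratic form `kil (star X) X` is invariant, hence so is its polarisation, and the Killing
form is invariant and non-degenerate. -/
theorem Ad_star (L : SO31) (X : so31) : Ad L (star X) = star (Ad L X) := by
  have ka (X Y Z : so31) : kil (X + Y) Z = kil X Z + kil Y Z := by simp [kil]
  have ka' (X Y Z : so31) : kil X (Y + Z) = kil X Y + kil X Z := by simp [kil]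
  have h (Z : so31) : kil (star (Ad L X)) (Ad L Z) = kil (star X) Z := by
    have h1 := kil_star_Ad_self L (X + Z)
    rw [Ad_add, star_add, star_add, ka, ka', ka', ka, ka', ka', kil_star_Ad_self,
      kil_star_Ad_self, kil_star (Ad L Z), kil_comm (Ad L Z), kil_star Z, kil_comm Z] at h1
    have h2 : kil (star Z) X = kil (star X) Z := by rw [kil_star, kil_comm]
    linarith
  have ks (X Y Z : so31) : kil (X - Y) Z = kil X Z - kil Y Z := by simp [kil]
  rw [← sub_eq_zero]
  refine eq_zero_of_kil _ fun Y => ?_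
  rw [← Ad_Ad_inv L Y, ks, kil_Ad, h, sub_self]

/-- Multiplication by a complex number is symmetric, as the Killing form is the real part of a
complex bilinear form. -/
theorem commutant_kil {S : so31 →ₗ[ℝ] so31} (hS : ∀ X Y, S (lieB X Y) = lieB X (S Y))
    (X Y : so31) : kil (S X) Y = kil X (S Y) := by
  obtain ⟨a, b, h⟩ := exists_eq_add_star S hS
  have h1 (X Y Z : so31) : kil (a • X + b • Y) Z = a * kil X Z + b * kil Y Z := by simp [kil]
  have h2 (X Y Z : so31) : kil Z (a • X + b • Y) = a * kil Z X + b * kil Z Y := by simp [kil]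
  rw [h, h, h1, h2, kil_star]

/-- Endomorphisms of the Lie algebra module commute with all of `SO(3,1)`, which is not connected:
the Hodge star is preserved by every isometry of determinant one. -/
theorem commutant_Ad {S : so31 →ₗ[ℝ] so31} (hS : ∀ X Y, S (lieB X Y) = lieB X (S Y))
    (L : SO31) (X : so31) : S (Ad L X) = Ad L (S X) := by
  obtain ⟨a, b, h⟩ := exists_eq_add_star S hS
  rw [h, h, Ad_add, Ad_smul, Ad_smul, Ad_star]

/-- A non-zero endomorphism of the adjoint representation has an inverse, which again is one. -/
theorem commutant_inverse {S : so31 →ₗ[ℝ] so31} (hS : ∀ X Y, S (lieB X Y) = lieB X (S Y))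
    (h0 : ∃ X, S X ≠ 0) : ∃ R : so31 →ₗ[ℝ] so31,
    (∀ X, R (S X) = X) ∧ (∀ X, S (R X) = X) ∧ ∀ X Y, R (lieB X Y) = lieB X (R Y) := by
  obtain ⟨a, b, h⟩ := exists_eq_add_star S hS
  have hd : a ^ 2 + b ^ 2 ≠ 0 := by
    intro hd
    have ha : a = 0 := by nlinarith [sq_nonneg a, sq_nonneg b]
    have hb : b = 0 := by nlinarith [sq_nonneg a, sq_nonneg b]
    obtain ⟨X, hX⟩ := h0
    exact hX (by rw [h, ha, hb]; simp)
  have hl (X Y : so31) : lieB X (star Y) = star (lieB X Y) := by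
    apply coords_ext
    · simp only [rot_lieB, boost_lieB, star, rot_ofCoords, boost_ofCoords]
      ext a; fin_cases a <;> simp [crossProduct, Matrix.vecHead, Matrix.vecTail] <;> ring
    · simp only [rot_lieB, boost_lieB, star, rot_ofCoords, boost_ofCoords]
      ext a; fin_cases a <;> simp [crossProduct] <;> ring
  set st : so31 →ₗ[ℝ] so31 := ⟨⟨star, star_add⟩, star_smul⟩ with hst
  have hst' (X) : st X = star X := rfl
  -- the inverse of the complex number `a + i b`
  refine ⟨(a ^ 2 + b ^ 2)⁻¹ • (a • LinearMap.id - b • st), fun X => ?_, fun X => ?_,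
    fun X Y => ?_⟩
  · simp only [LinearMap.smul_apply, LinearMap.sub_apply, LinearMap.id_apply, h, hst', star_add,
      star_smul, star_star]
    rw [inv_smul_eq_iff₀ hd]
    module
  · simp only [LinearMap.smul_apply, LinearMap.sub_apply, LinearMap.id_apply, h, ← hst', map_smul,
      map_sub]
    simp only [hst', star_star]
    rw [smul_comm a, smul_comm b, ← smul_add, inv_smul_eq_iff₀ hd]
    module
  · simp only [LinearMap.smul_apply, LinearMap.sub_apply, LinearMap.id_apply, hst']
    have h1 (r : ℝ) (U : so31) : lieB X (r • U) = r • lieB X U := lie_smul r X U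
    have h2 (U W : so31) : lieB X (U - W) = lieB X U - lieB X W := lie_sub X U W
    rw [h1, h2, h1, h1, hl]

/-! ### Calculus in a chart -/

section Calculus

variable {X Y Z : Type*} [NormedAddCommGroup X] [NormedSpace ℝ X] [NormedAddCommGroup Y]
  [NormedSpace ℝ Y] [NormedAddCommGroup Z] [NormedSpace ℝ Z]

/-- The map `m` is bilinear and continuous. -/
def IsBil (m : X → Y → Z) : Prop := ∃ B : X →L[ℝ] Y →L[ℝ] Z, ∀ x y, m x y = B x y

namespace IsBil

variable {m : X → Y → Z}

theorem add_left (hm : IsBil m) (x x' : X) (y : Y) : m (x + x') y = m x y + m x' y := by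
  obtain ⟨B, h⟩ := hm; simp [h]
theorem add_right (hm : IsBil m) (x : X) (y y' : Y) : m x (y + y') = m x y + m x y' := by
  obtain ⟨B, h⟩ := hm; simp [h]
theorem sub_left (hm : IsBil m) (x x' : X) (y : Y) : m (x - x') y = m x y - m x' y := by
  obtain ⟨B, h⟩ := hm; simp [h]
theorem sub_right (hm : IsBil m) (x : X) (y y' : Y) : m x (y - y') = m x y - m x y' := by
  obtain ⟨B, h⟩ := hm; simp [h]
theorem neg_left (hm : IsBil m) (x : X) (y : Y) : m (-x) y = -m x y := by
  obtain ⟨B, h⟩ := hm; simp [h]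
theorem neg_right (hm : IsBil m) (x : X) (y : Y) : m x (-y) = -m x y := by
  obtain ⟨B, h⟩ := hm; simp [h]
theorem smul_left (hm : IsBil m) (r : ℝ) (x : X) (y : Y) : m (r • x) y = r • m x y := by
  obtain ⟨B, h⟩ := hm; simp [h]
theorem smul_right (hm : IsBil m) (r : ℝ) (x : X) (y : Y) : m x (r • y) = r • m x y := by
  obtain ⟨B, h⟩ := hm; simp [h]
theorem zero_left (hm : IsBil m) (y : Y) : m 0 y = 0 := by
  obtain ⟨B, h⟩ := hm; simp [h]
theorem zero_right (hm : IsBil m) (x : X) : m x 0 = 0 := by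
  obtain ⟨B, h⟩ := hm; simp [h]
theorem sum_left (hm : IsBil m) {κ : Type*} (s : Finset κ) (f : κ → X) (y : Y) :
    m (∑ a ∈ s, f a) y = ∑ a ∈ s, m (f a) y := by
  obtain ⟨B, h⟩ := hm; simp [h]
theorem sum_right (hm : IsBil m) {κ : Type*} (s : Finset κ) (x : X) (f : κ → Y) :
    m x (∑ a ∈ s, f a) = ∑ a ∈ s, m x (f a) := by
  obtain ⟨B, h⟩ := hm; simp [h]

theorem contDiffOn (hm : IsBil m) {a : E3 → X} {b : E3 → Y} {s : Set E3} (ha : ContDiffOn ℝ ∞ a s)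
    (hb : ContDiffOn ℝ ∞ b s) : ContDiffOn ℝ ∞ (fun x => m (a x) (b x)) s := by
  obtain ⟨B, h⟩ := hm
  simp only [h]
  exact B.isBoundedBilinearMap.contDiff.comp_contDiffOn (ha.prodMk hb)

theorem differentiableAt (hm : IsBil m) {a : E3 → X} {b : E3 → Y} {x : E3}
    (ha : DifferentiableAt ℝ a x)
    (hb : DifferentiableAt ℝ b x) : DifferentiableAt ℝ (fun x => m (a x) (b x)) x := by
  obtain ⟨B, h⟩ := hm
  simp only [h]
  exact (B.hasFDerivAt_of_bilinear ha.hasFDerivAt hb.hasFDerivAt).differentiableAt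

/-- The Leibniz rule. -/
theorem pd (hm : IsBil m) {a : E3 → X} {b : E3 → Y} {x : E3} (ha : DifferentiableAt ℝ a x)
    (hb : DifferentiableAt ℝ b x) (k : Fin 3) :
    pd k (fun x => m (a x) (b x)) x = m (pd k a x) (b x) + m (a x) (pd k b x) := by
  obtain ⟨B, h⟩ := hm
  simp only [h, QeGR.pd]
  rw [(B.hasFDerivAt_of_bilinear ha.hasFDerivAt hb.hasFDerivAt).fderiv]
  simp [add_comm]

end IsBil

theorem IsBil.of_finite [FiniteDimensional ℝ X] [FiniteDimensional ℝ Y] {m : X → Y → Z}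
    (h1 : ∀ x x' y, m (x + x') y = m x y + m x' y) (h2 : ∀ (r : ℝ) x y, m (r • x) y = r • m x y)
    (h3 : ∀ x y y', m x (y + y') = m x y + m x y')
    (h4 : ∀ (r : ℝ) x y, m x (r • y) = r • m x y) : IsBil m :=
  ⟨(LinearMap.mk₂ ℝ m h1 h2 h3 h4).toContinuousBilinearMap, fun _ _ => rfl⟩

theorem pd_add {a b : E3 → X} {x : E3} (ha : DifferentiableAt ℝ a x)
    (hb : DifferentiableAt ℝ b x) (k : Fin 3) :
    pd k (fun x => a x + b x) x = pd k a x + pd k b x := by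
  simp only [pd]; rw [fderiv_fun_add ha hb]; rfl

theorem pd_sub {a b : E3 → X} {x : E3} (ha : DifferentiableAt ℝ a x)
    (hb : DifferentiableAt ℝ b x) (k : Fin 3) :
    pd k (fun x => a x - b x) x = pd k a x - pd k b x := by
  simp only [pd]; rw [fderiv_fun_sub ha hb]; rfl

theorem pd_sum {κ : Type*} (s : Finset κ) {a : κ → E3 → X} {x : E3}
    (ha : ∀ l ∈ s, DifferentiableAt ℝ (a l) x) (k : Fin 3) :
    pd k (fun x => ∑ l ∈ s, a l x) x = ∑ l ∈ s, pd k (a l) x := by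
  simp only [pd]; rw [fderiv_fun_sum ha]; simp

theorem pd_neg (a : E3 → X) (x : E3) (k : Fin 3) : pd k (fun x => -a x) x = -pd k a x := by
  simp only [pd]; rw [fderiv_fun_neg]; rfl

theorem pd_const_smul {a : E3 → X} {x : E3} (r : ℝ) (ha : DifferentiableAt ℝ a x)
    (k : Fin 3) : pd k (fun x => r • a x) x = r • pd k a x := by
  simp only [pd]; rw [fderiv_fun_const_smul ha]; rfl

theorem isBil_smul : IsBil fun (r : ℝ) (x : X) => r • x :=
  ⟨ContinuousLinearMap.lsmul ℝ ℝ, fun _ _ => rfl⟩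

theorem pd_clm (f : X →L[ℝ] Y) {a : E3 → X} {x : E3} (ha : DifferentiableAt ℝ a x) (k : Fin 3) :
    pd k (fun x => f (a x)) x = f (pd k a x) := by
  simp only [pd]; rw [fderiv_fun_comp x f.differentiableAt ha, f.fderiv]; rfl

theorem pd_congr {a b : E3 → X} {x : E3} (h : a =ᶠ[𝓝 x] b) (k : Fin 3) : pd k a x = pd k b x := by
  simp only [pd]; rw [h.fderiv_eq]

theorem pd_congr_on {a b : E3 → X} {s : Set E3} (hs : IsOpen s) (h : ∀ x ∈ s, a x = b x) {x : E3}
    (hx : x ∈ s) (k : Fin 3) : pd k a x = pd k b x :=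
  pd_congr (Filter.eventually_of_mem (hs.mem_nhds hx) h) k

theorem pd_const (c : X) (x : E3) (k : Fin 3) : pd k (fun _ => c) x = 0 := by simp [pd]

theorem differentiableAt_of_contDiffOn {a : E3 → X} {s : Set E3} (hs : IsOpen s)
    (ha : ContDiffOn ℝ ∞ a s) {x : E3} (hx : x ∈ s) : DifferentiableAt ℝ a x :=
  (ha.contDiffAt (hs.mem_nhds hx)).differentiableAt (by simp)

theorem contDiffOn_pd {a : E3 → X} {s : Set E3} (hs : IsOpen s)
    (ha : ContDiffOn ℝ ∞ a s) (k : Fin 3) : ContDiffOn ℝ ∞ (pd k a) s :=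
  (ha.fderiv_of_isOpen hs (by simp)).clm_apply contDiffOn_const

/-- Partial derivatives commute. -/
theorem pd_comm {a : E3 → X} {s : Set E3} (hs : IsOpen s)
    (ha : ContDiffOn ℝ ∞ a s) {x : E3} (hx : x ∈ s) (k l : Fin 3) :
    pd k (pd l a) x = pd l (pd k a) x := by
  have h := (ha.contDiffAt (hs.mem_nhds hx)).isSymmSndFDerivAt
    (by rw [minSmoothness_of_isRCLikeNormedField]
        exact WithTop.coe_le_coe.2 (le_top (a := (2 : ℕ∞))))
  have hd : DifferentiableAt ℝ (fderiv ℝ a) x :=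
    ((ha.fderiv_of_isOpen hs (m := ∞) (by simp)).contDiffAt (hs.mem_nhds hx)).differentiableAt
      (by simp)
  have e (v w : E3) : fderiv ℝ (fun y => fderiv ℝ a y v) x w = fderiv ℝ (fderiv ℝ a) x w v := by
    rw [fderiv_clm_apply hd (differentiableAt_const v)]; simp
  change fderiv ℝ (fun y => fderiv ℝ a y _) x _ = fderiv ℝ (fun y => fderiv ℝ a y _) x _
  rw [e, e, h.eq]

theorem fderiv_eq_sum_pd (a : E3 → X) (x v : E3) : fderiv ℝ a x v = ∑ l, v l • pd l a x := by
  have : v = ∑ l, v l • EuclideanSpace.single l (1 : ℝ) := by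
    ext i; simp [Pi.single_apply]
  conv_lhs => rw [this, map_sum]
  simp [pd]

/-- The chain rule. -/
theorem pd_comp {a : E3 → X} {φ : E3 → E3} {x : E3} (ha : DifferentiableAt ℝ a (φ x))
    (hφ : DifferentiableAt ℝ φ x) (k : Fin 3) :
    pd k (fun y => a (φ y)) x = ∑ l, jac φ x l k • pd l a (φ x) := by
  have h : fderiv ℝ (fun y => a (φ y)) x = (fderiv ℝ a (φ x)).comp (fderiv ℝ φ x) :=
    fderiv_comp x ha hφ
  rw [pd, h, ContinuousLinearMap.comp_apply, fderiv_eq_sum_pd]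
  refine Finset.sum_congr rfl fun l _ => ?_
  congr 1
  exact (pd_clm (EuclideanSpace.proj l) hφ k).symm

end Calculus

/-! ### Representations and invariant products -/

/-- The Maurer-Cartan form `∂ₖg g⁻¹` of an `SO(3,1)`-valued function in a chart. -/
def mc (k : Fin 3) (g : E3 → SO31) (x : E3) : so31 :=
  projSo (pd k (fun y => (g y).1) x * (g x).1⁻¹)

/-- Multiplication of matrices. -/
theorem isBil_matMul : IsBil fun A B : Matrix Idx Idx ℝ => A * B :=
  .of_finite (fun _ _ _ => add_mul _ _ _) (fun _ _ _ => Matrix.smul_mul _ _ _)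
    (fun _ _ _ => mul_add _ _ _) (fun _ _ _ => Matrix.mul_smul _ _ _)

/-- A linear map of finite-dimensional normed spaces as a continuous linear map. The topologies are
those of the norms. -/
def toCLM {X Y : Type*} [NormedAddCommGroup X] [NormedSpace ℝ X] [FiniteDimensional ℝ X]
    [NormedAddCommGroup Y] [NormedSpace ℝ Y] (f : X → Y) (h1 : ∀ x y, f (x + y) = f x + f y)
    (h2 : ∀ (r : ℝ) x, f (r • x) = r • f x) : X →L[ℝ] Y :=
  LinearMap.toContinuousLinearMap ⟨⟨f, h1⟩, h2⟩

/-- The adjoint `L ↦ η Lᵀ η` of matrices with respect to the Minkowski metric. -/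
def adjM := toCLM (fun L : Matrix Idx Idx ℝ => etaM * Lᵀ * etaM)
  (fun _ _ => by simp [mul_add, add_mul]) (fun _ _ => by simp)

theorem adjM_apply (L : Matrix Idx Idx ℝ) : adjM L = etaM * Lᵀ * etaM := rfl

theorem adjM_mul (L M : Matrix Idx Idx ℝ) : adjM (L * M) = adjM M * adjM L := by
  simp only [adjM_apply, Matrix.transpose_mul, mul_assoc]
  rw [← mul_assoc etaM etaM, etaM_mul_self, one_mul]

theorem adjM_adjM (L : Matrix Idx Idx ℝ) : adjM (adjM L) = L := by
  simp only [adjM_apply, Matrix.transpose_mul, Matrix.transpose_transpose, etaM_transpose]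
  simp only [mul_assoc, etaM_mul_self, mul_one]
  rw [← mul_assoc, etaM_mul_self, one_mul]

theorem adjM_coe (X : so31) : adjM X.1 = -X.1 := by
  have hX := (mem_so31_iff X.1).1 X.2
  rw [adjM_apply, mul_assoc, hX, mul_neg, ← mul_assoc, etaM_mul_self, one_mul]

theorem adjM_SO31 (L : SO31) : adjM L.1 = L.1⁻¹ := by rw [adjM_apply, L.inv_eq]

theorem mem_so31_of_adjM {M : Matrix Idx Idx ℝ} (h : adjM M = -M) : (projSo M).1 = M := by
  change (1 / 2 : ℝ) • (M - etaM * Mᵀ * etaM) = M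
  rw [← adjM_apply, h]
  module

theorem coe_mc {g : E3 → SO31} {x : E3} (hg : DifferentiableAt ℝ (fun y => (g y).1) x)
    (k : Fin 3) : (mc k g x).1 = pd k (fun y => (g y).1) x * (g x).1⁻¹ := by
  apply mem_so31_of_adjM
  have h1 : pd k (fun y => adjM (g y).1 * (g y).1) x = 0 := by
    rw [pd_congr_on (b := fun _ => 1) isOpen_univ _ (mem_univ x), pd_const]
    intro y _
    rw [adjM_SO31, (g y).inv_mul]
  have hg' : DifferentiableAt ℝ (fun y => adjM (g y).1) x := adjM.differentiableAt.comp x hg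
  rw [isBil_matMul.pd hg' hg, pd_clm adjM hg, adjM_SO31] at h1
  rw [adjM_mul, ← adjM_SO31 (g x), adjM_adjM, adjM_SO31, eq_neg_iff_add_eq_zero]
  have h2 : (g x).1 * (adjM (pd k (fun y => (g y).1) x) * (g x).1 +
      (g x).1⁻¹ * pd k (fun y => (g y).1) x) * (g x).1⁻¹ = 0 := by
    rw [h1]; simp
  rw [mul_add, add_mul] at h2
  simp only [mul_assoc, (g x).mul_inv, mul_one] at h2
  rw [← mul_assoc (g x).1 (g x).1⁻¹, (g x).mul_inv, one_mul] at h2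
  exact h2

/-- The function `r` is a smooth linear representation of `SO(3,1)` with infinitesimal action `r'`.
Products of group elements are expressed by their matrices. The derivative enters through the
Leibniz rule `pd` for the action of a group-valued function. -/
structure IsRep {X : Type*} [NormedAddCommGroup X] [NormedSpace ℝ X] (r : SO31 → X → X)
    (r' : so31 → X → X) : Prop where
  bil : IsBil r'
  lin : ∀ L, ∃ f : X →L[ℝ] X, ∀ x, r L x = f x
  mul : ∀ L M K : SO31, L.1 * M.1 = K.1 → ∀ x, r L (r M x) = r K x
  surj : ∀ L x, ∃ y, r L y = x
  conj : ∀ L Z x, r' (Ad L Z) (r L x) = r L (r' Z x)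
  bracket : ∀ Z W x, r' (lieB Z W) x = r' Z (r' W x) - r' W (r' Z x)
  smooth : ∀ (s : Set E3) (g : E3 → SO31) (u : E3 → X), ContDiffOn ℝ ∞ (fun x => (g x).1) s →
    ContDiffOn ℝ ∞ u s → ContDiffOn ℝ ∞ (fun x => r (g x) (u x)) s
  pd : ∀ (g : E3 → SO31) (u : E3 → X) (x : E3) (k : Fin 3),
    DifferentiableAt ℝ (fun y => (g y).1) x → DifferentiableAt ℝ u x →
    pd k (fun y => r (g y) (u y)) x = r (g x) (pd k u x) + r' (mc k g x) (r (g x) (u x))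

theorem isBil_act : IsBil act :=
  .of_finite add_act smul_act act_add act_smul

theorem isBil_lieB : IsBil lieB :=
  .of_finite (fun _ _ _ => add_lie _ _ _) (fun _ _ _ => smul_lie _ _ _)
    (fun _ _ _ => lie_add _ _ _) (fun _ _ _ => lie_smul _ _ _)

theorem isBil_kil : IsBil kil :=
  .of_finite (by simp [kil]) (by simp [kil]) (by simp [kil]) (by simp [kil])

theorem isBil_eta : IsBil eta :=
  .of_finite (by simp [eta]) (by simp [eta]) (by simp [eta, Matrix.mulVec_add])
    (by simp [eta, Matrix.mulVec_smul])

theorem isBil_wedgeV : IsBil wedgeV := by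
  have h1 (x x' y : V) : wedgeV (x + x') y = wedgeV x y + wedgeV x' y := by
    apply so31_ext
    change -(1 / 4 : ℝ) • _ = -(1 / 4 : ℝ) • _ + -(1 / 4 : ℝ) • _
    rw [Matrix.add_vecMulVec, Matrix.mulVec_add, Matrix.vecMulVec_add]
    module
  have h2 (r : ℝ) (x y : V) : wedgeV (r • x) y = r • wedgeV x y := by
    apply so31_ext
    change -(1 / 4 : ℝ) • _ = r • -(1 / 4 : ℝ) • _
    rw [Matrix.smul_vecMulVec, Matrix.mulVec_smul, Matrix.vecMulVec_smul]
    module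
  refine .of_finite h1 h2 (fun x y y' => ?_) (fun r x y => ?_)
  · rw [wedgeV_skew, h1, wedgeV_skew y, wedgeV_skew y']; abel
  · rw [wedgeV_skew, h2, wedgeV_skew y, smul_neg, neg_neg]

theorem isRep_trivial : IsRep (fun _ (t : ℝ) => t) (fun _ _ => (0 : ℝ)) where
  bil := ⟨0, fun _ _ => rfl⟩
  lin _ := ⟨.id ℝ ℝ, fun _ => rfl⟩
  mul _ _ _ _ _ := rfl
  surj _ t := ⟨t, rfl⟩
  conj _ _ _ := rfl
  bracket _ _ _ := by simp
  smooth _ _ _ _ h := h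
  pd _ _ _ _ _ _ := by simp

theorem isBil_mulVec : IsBil fun (A : Matrix Idx Idx ℝ) (v : V) => A *ᵥ v :=
  .of_finite (fun _ _ _ => Matrix.add_mulVec _ _ _) (fun _ _ _ => Matrix.smul_mulVec _ _ _)
    (fun _ _ _ => Matrix.mulVec_add _ _ _) (fun _ _ _ => Matrix.mulVec_smul _ _ _)

theorem isRep_actV : IsRep actV act where
  bil := isBil_act
  lin L := ⟨toCLM (actV L) (fun _ _ => Matrix.mulVec_add _ _ _)
    (fun _ _ => Matrix.mulVec_smul _ _ _), fun _ => rfl⟩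
  mul L M K h v := by simp only [actV, Matrix.mulVec_mulVec, h]
  surj L v := ⟨_, actV_actV_inv L v⟩
  conj := Ad_act
  bracket := lieB_act
  smooth s g u hg hu := isBil_mulVec.contDiffOn hg hu
  pd g u x k hg hu := by
    have h : pd k (fun y => actV (g y) (u y)) x =
        pd k (fun y => (g y).1) x *ᵥ u x + (g x).1 *ᵥ pd k u x := isBil_mulVec.pd hg hu k
    rw [h, add_comm, act, coe_mc hg, actV, actV, Matrix.mulVec_mulVec, mul_assoc, (g x).inv_mul,
      mul_one]

/-- The inclusion of `so(3,1)` into the matrices. -/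
def coeCLM := toCLM (fun X : so31 => X.1) (fun _ _ => rfl) (fun _ _ => rfl)

theorem coeCLM_apply (X : so31) : coeCLM X = X.1 := rfl

/-- The projection onto `so(3,1)` as a continuous map. -/
def projCLM := toCLM (fun M : Matrix Idx Idx ℝ => projSo M) projSo.map_add projSo.map_smul

theorem projCLM_apply (M : Matrix Idx Idx ℝ) : projCLM M = projSo M := rfl

theorem Ad_eq_projCLM (L : SO31) (X : so31) : Ad L X = projCLM (L.1 * coeCLM X * adjM L.1) := by
  rw [adjM_SO31]
  exact (projSo_coe (Ad L X)).symm

theorem isRep_Ad : IsRep Ad lieB where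
  bil := isBil_lieB
  lin L := ⟨toCLM (Ad L) (Ad_add L) (Ad_smul L), fun _ => rfl⟩
  mul _ _ _ h X := Ad_mul h X
  surj L X := ⟨_, Ad_Ad_inv L X⟩
  conj L Z X := (Ad_lieB L Z X).symm
  bracket := lieB_lieB
  smooth s g u hg hu := by
    simp only [Ad_eq_projCLM]
    exact projCLM.contDiff.comp_contDiffOn (isBil_matMul.contDiffOn (isBil_matMul.contDiffOn hg
      (coeCLM.contDiff.comp_contDiffOn hu)) (adjM.contDiff.comp_contDiffOn hg))
  pd g u x k hg hu := by
    have h : (fun x => Ad (g x) (u x)) =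
        fun x => projCLM ((g x).1 * coeCLM (u x) * adjM (g x).1) :=
      funext fun x => Ad_eq_projCLM _ _
    have h2 : pd k (fun y => (g y).1) x = (mc k g x).1 * (g x).1 := by
      rw [coe_mc hg, mul_assoc, (g x).inv_mul, mul_one]
    have hu' : DifferentiableAt ℝ (fun y => coeCLM (u y)) x := coeCLM.differentiableAt.comp x hu
    have hg' : DifferentiableAt ℝ (fun y => adjM (g y).1) x := adjM.differentiableAt.comp x hg
    have h1 := isBil_matMul.differentiableAt hg hu'
    have h3 := isBil_matMul.differentiableAt h1 hg'
    rw [h, pd_clm projCLM h3, isBil_matMul.pd h1 hg', isBil_matMul.pd hg hu', pd_clm coeCLM hu,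
      pd_clm adjM hg, ← projSo_coe (_ + _), projCLM_apply]
    congr 1
    rw [h2, adjM_mul, adjM_coe, adjM_SO31]
    change _ = (Ad (g x) (pd k u x)).1 + (lieB (mc k g x) (Ad (g x) (u x))).1
    rw [coe_lieB, coe_Ad, coe_Ad, coeCLM_apply, coeCLM_apply]
    noncomm_ring

/-- The bilinear map `m` intertwines the representations `r₁`, `r₂`, `r₃` of the group (`gr`) and
the corresponding representations of the Lie algebra (`al`). -/
structure IsInv {X Y Z : Type*} [NormedAddCommGroup X] [NormedSpace ℝ X] [NormedAddCommGroup Y]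
    [NormedSpace ℝ Y] [NormedAddCommGroup Z] [NormedSpace ℝ Z]
    (r₁ : SO31 → X → X) (r₁' : so31 → X → X) (r₂ : SO31 → Y → Y) (r₂' : so31 → Y → Y)
    (r₃ : SO31 → Z → Z) (r₃' : so31 → Z → Z) (m : X → Y → Z) : Prop where
  bil : IsBil m
  gr : ∀ L x y, m (r₁ L x) (r₂ L y) = r₃ L (m x y)
  al : ∀ W x y, r₃' W (m x y) = m (r₁' W x) y + m x (r₂' W y)

theorem isInv_lieB : IsInv Ad lieB Ad lieB Ad lieB lieB where
  bil := isBil_lieB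
  gr L X Y := (Ad_lieB L X Y).symm
  al W X Y := by rw [lieB_lieB W X Y]; abel

theorem isInv_act : IsInv Ad lieB actV act actV act act where
  bil := isBil_act
  gr := Ad_act
  al W X v := by rw [lieB_act]; abel

theorem isInv_wedgeV : IsInv actV act actV act Ad lieB wedgeV where
  bil := isBil_wedgeV
  gr L v w := (Ad_wedgeV L v w).symm
  al := lieB_wedgeV

theorem isInv_kil : IsInv Ad lieB Ad lieB (fun _ t => t) (fun _ _ => 0) kil where
  bil := isBil_kil
  gr := kil_Ad
  al W X Y := by rw [lieB_skew W X, isBil_kil.neg_left, kil_lieB]; simp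

theorem isInv_eta : IsInv actV act actV act (fun _ t => t) (fun _ _ => 0) eta where
  bil := isBil_eta
  gr := eta_actV
  al W X Y := by rw [eta_act]; simp

namespace Bundle

variable {ι : Type*} [Fintype ι] {N : Type*} [TopologicalSpace N] [ChartedSpace E3 N]
  (P : Bundle ι N)

/-! ### Changes of coordinates -/

theorem mem_overlap {i j : ι} {x : E3} :
    x ∈ P.overlap i j ↔ x ∈ (P.chart j).target ∧ (P.chart j).symm x ∈ (P.chart i).source := by
  simp [overlap]

theorem isOpen_overlap (i j : ι) : IsOpen (P.overlap i j) :=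
  ((P.chart j).symm ≫ₕ P.chart i).open_source

theorem overlap_subset (i j : ι) : P.overlap i j ⊆ (P.chart j).target :=
  fun _ hx => (P.mem_overlap.1 hx).1

theorem symm_change {i j : ι} {x : E3} (hx : x ∈ P.overlap i j) :
    (P.chart i).symm (P.change i j x) = (P.chart j).symm x :=
  (P.chart i).left_inv (P.mem_overlap.1 hx).2

theorem change_mem_target {i j : ι} {x : E3} (hx : x ∈ P.overlap i j) :
    P.change i j x ∈ (P.chart i).target :=
  (P.chart i).map_source (P.mem_overlap.1 hx).2

theorem change_mem {i j k : ι} {x : E3} (hx : x ∈ P.overlap i j)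
    (hk : (P.chart j).symm x ∈ (P.chart k).source) : P.change i j x ∈ P.overlap k i :=
  P.mem_overlap.2 ⟨P.change_mem_target hx, by rwa [P.symm_change hx]⟩

theorem change_mem_overlap {i j : ι} {x : E3} (hx : x ∈ P.overlap i j) :
    P.change i j x ∈ P.overlap j i :=
  P.change_mem hx ((P.chart j).map_target (P.overlap_subset i j hx))

theorem change_change {i j k : ι} {x : E3} (hx : x ∈ P.overlap i j) :
    P.change k i (P.change i j x) = P.change k j x := by
  rw [change, P.symm_change hx]; rfl

theorem change_self {i : ι} {x : E3} (hx : x ∈ (P.chart i).target) : P.change i i x = x :=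
  (P.chart i).right_inv hx

theorem overlap_self (i : ι) : P.overlap i i = (P.chart i).target := by
  ext x
  rw [mem_overlap]
  exact ⟨fun h => h.1, fun h => ⟨h, (P.chart i).map_target h⟩⟩

theorem contDiffOn_change [IsManifold (𝓡 3) ∞ N] (i j : ι) :
    ContDiffOn ℝ ∞ (P.change i j) (P.overlap i j) := by
  have h := (contDiffGroupoid ∞ (𝓡 3)).compatible_of_mem_maximalAtlas (P.chart_mem j)
    (P.chart_mem i)
  exact contMDiffOn_iff_contDiffOn.1 (contMDiffOn_of_mem_contDiffGroupoid h)

theorem differentiableAt_change [IsManifold (𝓡 3) ∞ N] {i j : ι} {x : E3}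
    (hx : x ∈ P.overlap i j) : DifferentiableAt ℝ (P.change i j) x :=
  differentiableAt_of_contDiffOn (P.isOpen_overlap i j) (P.contDiffOn_change i j) hx

theorem contDiffOn_change_apply [IsManifold (𝓡 3) ∞ N] (i j : ι) (l : Fin 3) :
    ContDiffOn ℝ ∞ (fun y => P.change i j y l) (P.overlap i j) :=
  (EuclideanSpace.proj l : E3 →L[ℝ] ℝ).contDiff.comp_contDiffOn
    (P.contDiffOn_change i j)

theorem contDiffOn_gc (i j : ι) :
    ContDiffOn ℝ ∞ (fun x => (P.gc j i x).1) (P.overlap i j) := P.g_smooth i j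

theorem differentiableAt_gc {i j : ι} {x : E3} (hx : x ∈ P.overlap i j) :
    DifferentiableAt ℝ (fun x => (P.gc j i x).1) x :=
  differentiableAt_of_contDiffOn (P.isOpen_overlap i j) (P.contDiffOn_gc i j) hx

theorem gc_mul {i j m : ι} {x : E3} (hj : x ∈ P.overlap j m) (hi : x ∈ P.overlap i m) :
    (P.gc m j x).1 * (P.gc j i (P.change j m x)).1 = (P.gc m i x).1 := by
  rw [gc, gc, gc, P.symm_change hj]
  exact P.g_cocycle _ _ _ _ ⟨⟨(P.chart m).map_target (P.overlap_subset _ _ hj),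
    (P.mem_overlap.1 hj).2⟩, (P.mem_overlap.1 hi).2⟩

theorem gc_self {i : ι} {x : E3} (hx : x ∈ (P.chart i).target) : (P.gc i i x).1 = 1 := by
  have hx' : x ∈ P.overlap i i := by rwa [P.overlap_self]
  have h := P.gc_mul hx' hx'
  rw [P.change_self hx] at h
  calc (P.gc i i x).1 = (P.gc i i x).1 * (P.gc i i x).1 * (P.gc i i x).1⁻¹ := by
        rw [mul_assoc, SO31.mul_inv, mul_one]
    _ = 1 := by rw [h, SO31.mul_inv]

/-! ### Tensorial objects in local coordinates

Forms of all degrees are sections of vector bundles whose transition functions are the product of a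
representation and a matrix `C i j` formed from the Jacobian matrix of the change of coordinates. -/

/-- A cocycle of matrices over the changes of coordinates. -/
structure IsCocycle {κ : Type*} [Fintype κ] (C : ι → ι → E3 → κ → κ → ℝ) : Prop where
  smooth : ∀ i j l k, ContDiffOn ℝ ∞ (fun x => C i j x l k) (P.overlap i j)
  comp : ∀ i j m x, x ∈ P.overlap j m → x ∈ P.overlap i m → ∀ l k,
    C i m x l k = ∑ n, C j m x n k * C i j (P.change j m x) l n
  self : ∀ i, ∀ x ∈ (P.chart i).target, ∀ u : κ → ℝ, ∀ k, ∑ l, C i i x l k * u l = u k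

/-- The transformation matrix of `0`-forms. -/
def tr0 (_ _ : ι) (_ : E3) (_ _ : Unit) : ℝ := 1

/-- The transformation matrix of `1`-forms. -/
def tr1 (i j : ι) (x : E3) (l k : Fin 3) : ℝ := jac (P.change i j) x l k

/-- The transformation matrix of `2`-forms. -/
def tr2 (i j : ι) (x : E3) (l k : Fin 3) : ℝ :=
  jac (P.change i j) x (l + 1) (k + 1) * jac (P.change i j) x (l + 2) (k + 2) -
    jac (P.change i j) x (l + 1) (k + 2) * jac (P.change i j) x (l + 2) (k + 1)

theorem fin3_facts : (0 + 1 : Fin 3) = 1 ∧ (1 + 1 : Fin 3) = 2 ∧ (2 + 1 : Fin 3) = 0 ∧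
    (0 + 2 : Fin 3) = 2 ∧ (1 + 2 : Fin 3) = 0 ∧ (2 + 2 : Fin 3) = 1 := by decide

theorem isCocycle_tr0 : P.IsCocycle (tr0 (ι := ι)) where
  smooth _ _ _ _ := contDiffOn_const
  comp _ _ _ _ _ _ _ _ := by simp [tr0]
  self _ _ _ _ _ := by simp [tr0]

theorem jac_self {i : ι} {x : E3} (hx : x ∈ (P.chart i).target) (l k : Fin 3) :
    jac (P.change i i) x l k = if l = k then 1 else 0 := by
  change pd k (fun y => P.change i i y l) x = _
  rw [pd_congr_on (b := fun y => (EuclideanSpace.proj l : E3 →L[ℝ] ℝ) y)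
    (P.chart i).open_target _ hx, pd,
    (EuclideanSpace.proj l : E3 →L[ℝ] ℝ).fderiv]
  · simp
  · intro y hy
    rw [P.change_self hy]; rfl

theorem jac_comp [IsManifold (𝓡 3) ∞ N] {i j m : ι} {x : E3} (hj : x ∈ P.overlap j m)
    (hi : x ∈ P.overlap i m) (l k : Fin 3) : jac (P.change i m) x l k =
      ∑ n, jac (P.change j m) x n k * jac (P.change i j) (P.change j m x) l n := by
  change pd k (fun y => P.change i m y l) x = _
  have h : ∀ y ∈ P.overlap j m ∩ P.overlap i m,
      P.change i m y l = P.change i j (P.change j m y) l := fun y hy => by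
    rw [P.change_change hy.1]
  have hd : P.change j m x ∈ P.overlap i j := P.change_mem hj (P.mem_overlap.1 hi).2
  rw [pd_congr_on ((P.isOpen_overlap j m).inter (P.isOpen_overlap i m)) h ⟨hj, hi⟩,
    pd_comp (a := fun y => P.change i j y l) (differentiableAt_of_contDiffOn (P.isOpen_overlap i j)
      (P.contDiffOn_change_apply i j l) hd) (P.differentiableAt_change hj)]
  rfl

theorem isCocycle_tr1 [IsManifold (𝓡 3) ∞ N] : P.IsCocycle P.tr1 where
  smooth i j l k := contDiffOn_pd (P.isOpen_overlap i j) (P.contDiffOn_change_apply i j l) k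
  comp i j m x hj hi l k := P.jac_comp hj hi l k
  self i x hx u k := by simp [tr1, P.jac_self hx]

theorem isCocycle_tr2 [IsManifold (𝓡 3) ∞ N] : P.IsCocycle P.tr2 where
  smooth i j l k := by
    have h := P.isCocycle_tr1.smooth i j
    exact ((h _ _).mul (h _ _)).sub ((h _ _).mul (h _ _))
  comp i j m x hj hi l k := by
    obtain ⟨f1, f2, f3, f4, f5, f6⟩ := fin3_facts
    simp only [tr2, P.jac_comp hj hi, Fin.sum_univ_three, f1, f2, f3, f4, f5, f6]
    ring
  self i x hx u k := by
    simp only [tr2, P.jac_self hx, Fin.sum_univ_three]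
    fin_cases k <;> simp

/-- Cofactor expansion of the Jacobian determinant. -/
theorem sum_tr1_mul_tr2 (i j : ι) (x : E3) (l l' : Fin 3) :
    ∑ k, P.tr1 i j x l k * P.tr2 i j x l' k = if l = l' then (jac (P.change i j) x).det else 0 := by
  rw [Matrix.det_fin_three]
  simp only [tr1, tr2, Fin.sum_univ_three]
  fin_cases l <;> fin_cases l' <;> simp [fin3_facts] <;> ring

end Bundle

namespace Bundle

variable {ι : Type*} [Fintype ι] {N : Type*} [TopologicalSpace N] [ChartedSpace E3 N]
  (P : Bundle ι N)

section Cut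

variable {κ : Type*} {X : Type*} [Zero X]

open Classical in
/-- The components of `u`, set to zero outside the domains of the coordinates. -/
def cut (u : ι → κ → E3 → X) (i : ι) (k : κ) (x : E3) : X :=
  if x ∈ (P.chart i).target then u i k x else 0

theorem cut_apply (u : ι → κ → E3 → X) {i : ι} {x : E3} (hx : x ∈ (P.chart i).target) (k : κ) :
    P.cut u i k x = u i k x := if_pos hx

theorem cut_apply_of_notMem (u : ι → κ → E3 → X) {i : ι} {x : E3} (hx : x ∉ (P.chart i).target)
    (k : κ) : P.cut u i k x = 0 := if_neg hx

end Cut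

section Tensor

variable {κ : Type*} [Fintype κ] {X : Type*} [NormedAddCommGroup X] [NormedSpace ℝ X]

/-- Smooth sections of the vector bundle with transition functions `C ⊗ r`. Nothing is required
outside the domains of the coordinates. -/
structure IsTensor (C : ι → ι → E3 → κ → κ → ℝ) (r : SO31 → X → X) (u : ι → κ → E3 → X) :
    Prop where
  smooth : ∀ i k, ContDiffOn ℝ ∞ (u i k) (P.chart i).target
  compat : ∀ i j k, ∀ x ∈ P.overlap i j,
    u j k x = ∑ l, C i j x l k • r (P.gc j i x) (u i l (P.change i j x))

variable {P}

theorem IsTensor.diff {C : ι → ι → E3 → κ → κ → ℝ} {r : SO31 → X → X} {u : ι → κ → E3 → X}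
    (hu : P.IsTensor C r u) (i : ι) (k : κ) {x : E3} (hx : x ∈ (P.chart i).target) :
    DifferentiableAt ℝ (u i k) x :=
  differentiableAt_of_contDiffOn (P.chart i).open_target (hu.smooth i k) hx

theorem IsForm0.tensor {r : SO31 → X → X} {u : ι → F0 X} (hu : P.IsForm0 r u) :
    P.IsTensor tr0 r fun i (_ : Unit) => u i :=
  ⟨fun i _ => hu.smooth i, fun i j _ x hx => by simpa [tr0] using hu.compat i j x hx⟩

theorem IsForm1.tensor {r : SO31 → X → X} {u : ι → F1 X} (hu : P.IsForm1 r u) :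
    P.IsTensor P.tr1 r u := ⟨hu.smooth, hu.compat⟩

theorem IsForm2.tensor {r : SO31 → X → X} {u : ι → F2 X} (hu : P.IsForm2 r u) :
    P.IsTensor P.tr2 r u := ⟨hu.smooth, hu.compat⟩

theorem IsTensor.congr {C : ι → ι → E3 → κ → κ → ℝ} {r : SO31 → X → X} {u v : ι → κ → E3 → X}
    (hu : P.IsTensor C r u) (h : ∀ i k, ∀ x ∈ (P.chart i).target, v i k x = u i k x) :
    P.IsTensor C r v where
  smooth i k := (hu.smooth i k).congr (h i k)
  compat i j k x hx := by
    rw [h j k x (P.overlap_subset i j hx), hu.compat i j k x hx]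
    exact Finset.sum_congr rfl fun l _ => by rw [h i l _ (P.change_mem_target hx)]

theorem IsTensor.cut {C : ι → ι → E3 → κ → κ → ℝ} {r : SO31 → X → X} {u : ι → κ → E3 → X}
    (hu : P.IsTensor C r u) : P.IsTensor C r (P.cut u) :=
  hu.congr fun _ k _ hx => P.cut_apply u hx k

theorem IsTensor.isForm0 {r : SO31 → X → X} {u : ι → Unit → E3 → X} (hu : P.IsTensor tr0 r u)
    (h : ∀ i k, ∀ x ∉ (P.chart i).target, u i k x = 0) : P.IsForm0 r fun i => u i () :=
  ⟨fun i => hu.smooth i (), fun i => h i (),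
    fun i j x hx => by simpa [tr0] using hu.compat i j () x hx⟩

theorem IsTensor.isForm1 {r : SO31 → X → X} {u : ι → F1 X} (hu : P.IsTensor P.tr1 r u) :
    P.IsForm1 r (P.cut u) :=
  ⟨hu.cut.smooth, fun _ k _ hx => P.cut_apply_of_notMem u hx k, hu.cut.compat⟩

theorem IsTensor.isForm2 {r : SO31 → X → X} {u : ι → F2 X} (hu : P.IsTensor P.tr2 r u) :
    P.IsForm2 r (P.cut u) :=
  ⟨hu.cut.smooth, fun _ k _ hx => P.cut_apply_of_notMem u hx k, hu.cut.compat⟩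

theorem IsTensor.map {C : ι → ι → E3 → κ → κ → ℝ} {r : SO31 → X → X} {u : ι → κ → E3 → X}
    (hu : P.IsTensor C r u) {f : X → X} (f' : X →L[ℝ] X) (hf : ∀ x, f x = f' x)
    (hr : ∀ L x, f (r L x) = r L (f x)) : P.IsTensor C r fun i k x => f (u i k x) where
  smooth i k := by simp only [hf]; exact f'.contDiff.comp_contDiffOn (hu.smooth i k)
  compat i j k x hx := by
    simp only [hu.compat i j k x hx, ← hr]
    simp only [hf, map_sum, map_smul]

theorem IsTensor.const_smul {C : ι → ι → E3 → κ → κ → ℝ} {r : SO31 → X → X} {r' : so31 → X → X}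
    (hr : IsRep r r') {u : ι → κ → E3 → X}
    (hu : P.IsTensor C r u) (c : ℝ) : P.IsTensor C r fun i k x => c • u i k x :=
  hu.map (c • .id ℝ X) (fun _ => rfl) fun L x => by
    obtain ⟨f, hf⟩ := hr.lin L
    simp [hf]

theorem IsTensor.neg {C : ι → ι → E3 → κ → κ → ℝ} {r : SO31 → X → X} {r' : so31 → X → X}
    (hr : IsRep r r') {u : ι → κ → E3 → X}
    (hu : P.IsTensor C r u) : P.IsTensor C r fun i k x => -u i k x :=
  (hu.const_smul hr (-1)).congr fun _ _ _ _ => by simp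

end Tensor

section Products

variable {X Y Z : Type*} [NormedAddCommGroup X] [NormedSpace ℝ X] [NormedAddCommGroup Y]
  [NormedSpace ℝ Y] [NormedAddCommGroup Z] [NormedSpace ℝ Z]
  {r₁ : SO31 → X → X} {r₁' : so31 → X → X} {r₂ : SO31 → Y → Y} {r₂' : so31 → Y → Y}
  {r₃ : SO31 → Z → Z} {r₃' : so31 → Z → Z} {m : X → Y → Z} {P}

theorem IsTensor.w00 (hm : IsInv r₁ r₁' r₂ r₂' r₃ r₃' m) {u : ι → F0 X} {v : ι → F0 Y}
    (hu : P.IsTensor tr0 r₁ fun i (_ : Unit) => u i)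
    (hv : P.IsTensor tr0 r₂ fun i (_ : Unit) => v i) :
    P.IsTensor tr0 r₃ fun i (_ : Unit) => w00 m (u i) (v i) where
  smooth i k := hm.bil.contDiffOn (hu.smooth i ()) (hv.smooth i ())
  compat i j k x hx := by
    have h1 := hu.compat i j () x hx
    have h2 := hv.compat i j () x hx
    simp only [tr0, one_smul, Finset.univ_unique, Finset.sum_singleton] at h1 h2 ⊢
    simp only [QeGR.w00, h1, h2, hm.gr]

theorem IsTensor.w01 {κ : Type*} [Fintype κ] {C : ι → ι → E3 → κ → κ → ℝ}
    (hm : IsInv r₁ r₁' r₂ r₂' r₃ r₃' m) {u : ι → F0 X} {v : ι → κ → E3 → Y}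
    (hu : P.IsTensor tr0 r₁ fun i (_ : Unit) => u i) (hv : P.IsTensor C r₂ v) :
    P.IsTensor C r₃ fun i k x => m (u i x) (v i k x) where
  smooth i k := hm.bil.contDiffOn (hu.smooth i ()) (hv.smooth i k)
  compat i j k x hx := by
    have h1 := hu.compat i j () x hx
    simp only [tr0, one_smul, Finset.univ_unique, Finset.sum_singleton] at h1
    simp only [h1, hv.compat i j k x hx, hm.bil.sum_right, hm.bil.smul_right, hm.gr]

theorem IsTensor.w10 {κ : Type*} [Fintype κ] {C : ι → ι → E3 → κ → κ → ℝ}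
    (hm : IsInv r₁ r₁' r₂ r₂' r₃ r₃' m) {u : ι → κ → E3 → X} {v : ι → F0 Y}
    (hu : P.IsTensor C r₁ u) (hv : P.IsTensor tr0 r₂ fun i (_ : Unit) => v i) :
    P.IsTensor C r₃ fun i k x => m (u i k x) (v i x) where
  smooth i k := hm.bil.contDiffOn (hu.smooth i k) (hv.smooth i ())
  compat i j k x hx := by
    have h1 := hv.compat i j () x hx
    simp only [tr0, one_smul, Finset.univ_unique, Finset.sum_singleton] at h1
    simp only [h1, hu.compat i j k x hx, hm.bil.sum_left, hm.bil.smul_left, hm.gr]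

theorem IsTensor.w11 (hm : IsInv r₁ r₁' r₂ r₂' r₃ r₃' m) (h₃ : IsRep r₃ r₃')
    {u : ι → F1 X} {v : ι → F1 Y} (hu : P.IsTensor P.tr1 r₁ u) (hv : P.IsTensor P.tr1 r₂ v) :
    P.IsTensor P.tr2 r₃ fun i => w11 m (u i) (v i) where
  smooth i k := (hm.bil.contDiffOn (hu.smooth i _) (hv.smooth i _)).sub
    (hm.bil.contDiffOn (hu.smooth i _) (hv.smooth i _))
  compat i j k x hx := by
    obtain ⟨f1, f2, f3, f4, f5, f6⟩ := fin3_facts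
    obtain ⟨f, hf⟩ := h₃.lin (P.gc j i x)
    simp only [QeGR.w11, hu.compat i j _ x hx, hv.compat i j _ x hx, Fin.sum_univ_three,
      hm.bil.add_left, hm.bil.add_right, hm.bil.smul_left, hm.bil.smul_right, hm.gr, hf, map_sub,
      tr1, tr2, f1, f2, f3, f4, f5, f6]
    module

/-- The pairing of forms of complementary degrees is a `3`-form. -/
theorem w12_compat {C C' : ι → ι → E3 → Fin 3 → Fin 3 → ℝ}
    (hC : ∀ i j x l l', ∑ k, C i j x l k * C' i j x l' k =
      if l = l' then (jac (P.change i j) x).det else 0)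
    {p : X → Y → ℝ} (hm : IsInv r₁ r₁' r₂ r₂' (fun _ t => t) (fun _ _ => 0) p)
    {u : ι → F1 X} {v : ι → F2 Y} (hu : P.IsTensor C r₁ u) (hv : P.IsTensor C' r₂ v)
    {i j : ι} {x : E3} (hx : x ∈ P.overlap i j) :
    w12 p (u j) (v j) x = (jac (P.change i j) x).det * w12 p (u i) (v i) (P.change i j x) := by
  simp only [w12, hu.compat i j _ x hx, hv.compat i j _ x hx, hm.bil.sum_left,
    hm.bil.sum_right, hm.bil.smul_left, hm.bil.smul_right, hm.gr, smul_eq_mul]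
  have h (l l' : Fin 3) := hC i j x l l'
  simp only [Fin.sum_univ_three] at h ⊢
  have h00 := h 0 0
  have h01 := h 0 1
  have h02 := h 0 2
  have h10 := h 1 0
  have h11 := h 1 1
  have h12 := h 1 2
  have h20 := h 2 0
  have h21 := h 2 1
  have h22 := h 2 2
  simp at h00 h01 h02 h10 h11 h12 h20 h21 h22
  set y := P.change i j x
  linear_combination p (u i 0 y) (v i 0 y) * h00 + p (u i 0 y) (v i 1 y) * h01 +
    p (u i 0 y) (v i 2 y) * h02 + p (u i 1 y) (v i 0 y) * h10 + p (u i 1 y) (v i 1 y) * h11 +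
    p (u i 1 y) (v i 2 y) * h12 + p (u i 2 y) (v i 0 y) * h20 + p (u i 2 y) (v i 1 y) * h21 +
    p (u i 2 y) (v i 2 y) * h22

end Products

/-! ### Covariant derivatives -/

/-- Connections, without any requirement outside the domains of the coordinates. -/
structure IsConn (A : ι → F1 so31) : Prop where
  smooth : ∀ i k, ContDiffOn ℝ ∞ (A i k) (P.chart i).target
  compat : ∀ i j k, ∀ x ∈ P.overlap i j,
    A j k x = ∑ l, P.tr1 i j x l k • Ad (P.gc j i x) (A i l (P.change i j x)) -
      mc k (fun y => P.gc j i y) x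

variable {P}

theorem IsConnection.conn {A : ι → F1 so31} (hA : P.IsConnection A) : P.IsConn A where
  smooth := hA.smooth
  compat i j k x hx := by
    apply so31_ext
    rw [hA.compat i j k x hx, ← coe_mc (P.differentiableAt_gc hx) k]
    rfl

theorem IsConn.diff {A : ι → F1 so31} (hA : P.IsConn A) (i : ι) (k : Fin 3) {x : E3}
    (hx : x ∈ (P.chart i).target) : DifferentiableAt ℝ (A i k) x :=
  differentiableAt_of_contDiffOn (P.chart i).open_target (hA.smooth i k) hx

section Covariant

variable {X : Type*} [NormedAddCommGroup X] [NormedSpace ℝ X] {r : SO31 → X → X}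
  {r' : so31 → X → X} {A : ι → F1 so31}

/-- Naturality of the covariant derivative under changes of charts and of trivialisations: the
inhomogeneous term of the connection cancels the derivative of the transition function. -/
theorem IsConn.covariant [IsManifold (𝓡 3) ∞ N] (hA : P.IsConn A) (hr : IsRep r r') {i j : ι}
    {v : E3 → X} (hv : ContDiffOn ℝ ∞ v (P.chart i).target) {x : E3} (hx : x ∈ P.overlap i j)
    (k : Fin 3) :
    pd k (fun y => r (P.gc j i y) (v (P.change i j y))) x +
        r' (A j k x) (r (P.gc j i x) (v (P.change i j x))) =
      ∑ n, P.tr1 i j x n k • r (P.gc j i x) (pd n v (P.change i j x) +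
        r' (A i n (P.change i j x)) (v (P.change i j x))) := by
  have hv' := differentiableAt_of_contDiffOn (P.chart i).open_target hv (P.change_mem_target hx)
  obtain ⟨f, hf⟩ := hr.lin (P.gc j i x)
  have h1 := hr.pd (fun y => P.gc j i y) (fun y => v (P.change i j y)) x k
    (P.differentiableAt_gc hx) (hv'.comp x (P.differentiableAt_change hx))
  rw [pd_comp hv' (P.differentiableAt_change hx)] at h1
  rw [h1, hA.compat i j k x hx, hr.bil.sub_left, hr.bil.sum_left]
  simp only [hr.bil.smul_left, hr.conj]
  simp only [hf, map_sum, map_smul, map_add, smul_add, Finset.sum_add_distrib, tr1]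
  abel

theorem IsTensor.dA0 [IsManifold (𝓡 3) ∞ N] (hA : P.IsConn A) (hr : IsRep r r') {u : ι → F0 X}
    (hu : P.IsTensor tr0 r fun i (_ : Unit) => u i) :
    P.IsTensor P.tr1 r fun i => dA0 r' (A i) (u i) where
  smooth i k := (contDiffOn_pd (P.chart i).open_target (hu.smooth i ()) k).add
    (hr.bil.contDiffOn (hA.smooth i k) (hu.smooth i ()))
  compat i j k x hx := by
    have h1 : ∀ y ∈ P.overlap i j, u j y = r (P.gc j i y) (u i (P.change i j y)) := fun y hy => by
      simpa [tr0] using hu.compat i j () y hy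
    have h2 := hA.covariant hr (hu.smooth i ()) hx k
    rw [QeGR.dA0, pd_congr_on (P.isOpen_overlap i j) h1 hx, h1 x hx, h2]
    rfl

theorem IsTensor.dA1 [IsManifold (𝓡 3) ∞ N] (hA : P.IsConn A) (hr : IsRep r r') {u : ι → F1 X}
    (hu : P.IsTensor P.tr1 r u) : P.IsTensor P.tr2 r fun i => dA1 r' (A i) (u i) where
  smooth i k := ((contDiffOn_pd (P.chart i).open_target (hu.smooth i _) _).sub
    (contDiffOn_pd (P.chart i).open_target (hu.smooth i _) _)).add
    ((hr.bil.contDiffOn (hA.smooth i _) (hu.smooth i _)).sub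
    (hr.bil.contDiffOn (hA.smooth i _) (hu.smooth i _)))
  compat i j k x hx := by
    have hs (l) : ContDiffOn ℝ ∞ (fun y => r (P.gc j i y) (u i l (P.change i j y)))
        (P.overlap i j) :=
      hr.smooth _ _ _ (P.contDiffOn_gc i j) ((hu.smooth i l).comp (P.contDiffOn_change i j)
        fun y hy => P.change_mem_target hy)
    have hd (l) := differentiableAt_of_contDiffOn (P.isOpen_overlap i j) (hs l) hx
    have hJ (l m) := differentiableAt_of_contDiffOn (P.isOpen_overlap i j)
      (P.isCocycle_tr1.smooth i j l m) hx
    -- the full covariant derivative, which fails to be tensorial by second derivatives of the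
    -- change of coordinates
    have hD (a b : Fin 3) : pd a (u j b) x + r' (A j a x) (u j b x) =
        ∑ l, pd a (fun y => P.tr1 i j y l b) x • r (P.gc j i x) (u i l (P.change i j x)) +
        ∑ l, P.tr1 i j x l b • ∑ n, P.tr1 i j x n a • r (P.gc j i x) (pd n (u i l) (P.change i j x)
          + r' (A i n (P.change i j x)) (u i l (P.change i j x))) := by
      rw [pd_congr_on (P.isOpen_overlap i j) (fun y hy => hu.compat i j b y hy) hx,
        pd_sum _ fun l _ => isBil_smul.differentiableAt (hJ l b) (hd l), hu.compat i j b x hx,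
        hr.bil.sum_right, ← Finset.sum_add_distrib, ← Finset.sum_add_distrib]
      refine Finset.sum_congr rfl fun l _ => ?_
      rw [isBil_smul.pd (hJ l b) (hd l), ← hA.covariant hr (hu.smooth i l) hx a,
        hr.bil.smul_right, smul_add, add_assoc]
    have hsymm (l a b : Fin 3) : pd a (fun y => P.tr1 i j y l b) x =
        pd b (fun y => P.tr1 i j y l a) x :=
      pd_comm (P.isOpen_overlap i j) (P.contDiffOn_change_apply i j l) hx a b
    have hdA : QeGR.dA1 r' (A j) (u j) k x =
        (pd (k + 1) (u j (k + 2)) x + r' (A j (k + 1) x) (u j (k + 2) x)) -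
        (pd (k + 2) (u j (k + 1)) x + r' (A j (k + 2) x) (u j (k + 1) x)) := by
      simp only [QeGR.dA1, QeGR.w11]; abel
    obtain ⟨f, hf⟩ := hr.lin (P.gc j i x)
    obtain ⟨f1, f2, f3, f4, f5, f6⟩ := fin3_facts
    rw [hdA, hD, hD]
    simp only [hsymm _ (k + 1) (k + 2), QeGR.dA1, QeGR.w11, tr2, Fin.sum_univ_three,
      f1, f2, f3, f4, f5, f6, hf, map_add, map_sub]
    simp only [tr1]
    module

end Covariant

end Bundle

namespace Bundle

variable {ι : Type*} [Fintype ι] {N : Type*} [TopologicalSpace N] [ChartedSpace E3 N]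
  (P : Bundle ι N)

/-! ### Extension by zero -/

section Extension

variable {κ : Type*} [Fintype κ] {X : Type*} [NormedAddCommGroup X] [NormedSpace ℝ X]

open Classical in
/-- The section which in the `i`-th chart has the components `a` and which vanishes outside the
domain of that chart. -/
def extend (C : ι → ι → E3 → κ → κ → ℝ) (r : SO31 → X → X) (i : ι) (a : κ → E3 → X) (j : ι) (k : κ)
    (x : E3) : X :=
  if x ∈ P.overlap i j then ∑ l, C i j x l k • r (P.gc j i x) (a l (P.change i j x)) else 0

variable {P} {C : ι → ι → E3 → κ → κ → ℝ} {r : SO31 → X → X} {r' : so31 → X → X}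

theorem extend_of_mem {i j : ι} {x : E3} (hx : x ∈ P.overlap i j) (a : κ → E3 → X) (k : κ) :
    P.extend C r i a j k x = ∑ l, C i j x l k • r (P.gc j i x) (a l (P.change i j x)) := if_pos hx

theorem extend_of_notMem {i j : ι} {x : E3} (hx : x ∉ P.overlap i j) (a : κ → E3 → X) (k : κ) :
    P.extend C r i a j k x = 0 := if_neg hx

theorem _root_.QeGR.IsRep.eq_self (hr : IsRep r r') {L : SO31} (hL : L.1 = 1) (x : X) :
    r L x = x := by
  obtain ⟨y, rfl⟩ := hr.surj L x
  exact hr.mul L L L (by rw [hL, mul_one]) y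

theorem extend_self (hC : P.IsCocycle C) (hr : IsRep r r') {i : ι} {x : E3}
    (hx : x ∈ (P.chart i).target) (a : κ → E3 → X) (k : κ) : P.extend C r i a i k x = a k x := by
  classical
  rw [extend_of_mem (by rwa [P.overlap_self]), P.change_self hx]
  simp only [hr.eq_self (P.gc_self hx)]
  have h : ∀ l, C i i x l k = if l = k then 1 else 0 := fun l => by
    have := hC.self i x hx (Pi.single l 1) k
    simpa [Pi.single_apply, eq_comm] using this
  simp [h]

/-- Extension by zero is smooth because the support of `a` is compact and `N` is Hausdorff, so that
the support is closed in `N`. -/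
theorem isTensor_extend [IsManifold (𝓡 3) ∞ N] [T2Space N] (hC : P.IsCocycle C) (hr : IsRep r r')
    {i : ι} {a : κ → E3 → X} (ha : ∀ k, ContDiff ℝ ∞ (a k)) (hc : ∀ k, HasCompactSupport (a k))
    (hs : ∀ k, tsupport (a k) ⊆ (P.chart i).target) : P.IsTensor C r (P.extend C r i a) where
  smooth j k := by
    have h0 : ContDiffOn ℝ ∞ (P.extend C r i a j k) (P.overlap i j) := by
      refine ContDiffOn.congr ?_ fun x hx => extend_of_mem hx a k
      refine ContDiffOn.sum fun l _ => (hC.smooth i j l k).smul (hr.smooth _ _ _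
        (P.contDiffOn_gc i j) ((ha l).comp_contDiffOn (P.contDiffOn_change i j)))
    intro x hx
    by_cases hxo : x ∈ P.overlap i j
    · exact (h0.contDiffAt ((P.isOpen_overlap i j).mem_nhds hxo)).contDiffWithinAt
    -- outside the overlap the extension vanishes near `x`, as the support is closed in `N`
    set K : Set N := ⋃ l, (P.chart i).symm '' tsupport (a l) with hK
    have hKc : IsClosed K := by
      refine isClosed_iUnion_of_finite fun l => (IsCompact.image_of_continuousOn (hc l) ?_).isClosed
      exact (P.chart i).continuousOn_symm.mono (hs l)
    have hKi : K ⊆ (P.chart i).source := by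
      refine iUnion_subset fun l => ?_
      rintro _ ⟨y, hy, rfl⟩
      exact (P.chart i).map_target (hs l hy)
    have hxK : (P.chart j).symm x ∈ Kᶜ := fun h => hxo (P.mem_overlap.2 ⟨hx, hKi h⟩)
    have hcont := (P.chart j).continuousAt_symm hx
    have h1 : ∀ᶠ y in 𝓝 x, P.extend C r i a j k y = 0 := by
      filter_upwards [hcont (hKc.isOpen_compl.mem_nhds hxK)] with y hyK
      by_cases hyo : y ∈ P.overlap i j
      · rw [extend_of_mem hyo]
        refine Finset.sum_eq_zero fun l _ => ?_
        have : a l (P.change i j y) = 0 := by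
          refine image_eq_zero_of_notMem_tsupport fun h => hyK ?_
          exact mem_iUnion.2 ⟨l, _, h, P.symm_change hyo⟩
        obtain ⟨f, hf⟩ := hr.lin (P.gc j i y)
        rw [this, hf, map_zero, smul_zero]
      · exact extend_of_notMem hyo a k
    exact (contDiffAt_const.congr_of_eventuallyEq h1).contDiffWithinAt
  compat j m k x hx := by
    have hxs := (P.mem_overlap.1 hx).2
    by_cases hxo : x ∈ P.overlap i m
    · have hy : P.change j m x ∈ P.overlap i j := P.change_mem hx (P.mem_overlap.1 hxo).2
      rw [extend_of_mem hxo]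
      have h1 (l) : r (P.gc m j x) (P.extend C r i a j l (P.change j m x)) =
          ∑ n, C i j (P.change j m x) n l • r (P.gc m i x) (a n (P.change i m x)) := by
        obtain ⟨f, hf⟩ := hr.lin (P.gc m j x)
        rw [extend_of_mem hy, hf, map_sum]
        refine Finset.sum_congr rfl fun n _ => ?_
        rw [map_smul, ← hf, hr.mul _ _ _ (P.gc_mul hx hxo), P.change_change hx]
      simp only [h1, hC.comp i j m x hx hxo, Finset.sum_smul, Finset.smul_sum, mul_smul]
      exact Finset.sum_comm
    · have hy : P.change j m x ∉ P.overlap i j := fun h => hxo (P.mem_overlap.2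
        ⟨P.overlap_subset j m hx, by rw [← P.symm_change hx]; exact (P.mem_overlap.1 h).2⟩)
      obtain ⟨f, hf⟩ := hr.lin (P.gc m j x)
      rw [extend_of_notMem hxo]
      simp [extend_of_notMem hy, hf]

end Extension

/-! ### The partition of unity in local coordinates -/

/-- The `i`-th function of the partition of unity in the coordinates of the `j`-th chart. -/
def pc (i j : ι) (x : E3) : ℝ := P.pou i ((P.chart j).symm x)

theorem contDiffOn_pc [IsManifold (𝓡 3) ∞ N] (i j : ι) :
    ContDiffOn ℝ ∞ (P.pc i j) (P.chart j).target :=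
  contMDiffOn_iff_contDiffOn.1
    ((P.pou i).contMDiff.comp_contMDiffOn (contMDiffOn_symm_of_mem_maximalAtlas (P.chart_mem j)))

theorem sum_pc (j : ι) (x : E3) : ∑ i, P.pc i j x = 1 := by
  rw [← finsum_eq_sum_of_fintype]
  exact P.pou.sum_eq_one (mem_univ _)

theorem pc_change {i j m : ι} {x : E3} (hx : x ∈ P.overlap i j) :
    P.pc m i (P.change i j x) = P.pc m j x := by
  rw [pc, P.symm_change hx]; rfl

/-- The support of the `i`-th function of the partition of unity lies in the `i`-th domain. -/
theorem pc_eventually_zero {i j : ι} {x : E3} (hx : x ∈ (P.chart j).target)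
    (hxo : x ∉ P.overlap i j) : ∀ᶠ y in 𝓝 x, P.pc i j y = 0 := by
  have h1 : (P.chart j).symm x ∈ (tsupport (P.pou i))ᶜ := fun h =>
    hxo (P.mem_overlap.2 ⟨hx, P.pou_subordinate i h⟩)
  filter_upwards [((P.chart j).continuousAt_symm hx)
    ((isClosed_tsupport _).isOpen_compl.mem_nhds h1)] with y hy
  exact image_eq_zero_of_notMem_tsupport (f := P.pou i) hy

theorem pc_eq_zero {i j : ι} {x : E3} (hx : x ∈ (P.chart j).target)
    (hxo : x ∉ P.overlap i j) : P.pc i j x = 0 := (P.pc_eventually_zero hx hxo).self_of_nhds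

/-- The compact support of the `i`-th function of the partition of unity, in the `i`-th chart. -/
def pouSupport (i : ι) : Set E3 := P.chart i '' tsupport (P.pou i)

theorem isCompact_pouSupport [CompactSpace N] (i : ι) : IsCompact (P.pouSupport i) :=
  (isClosed_tsupport _).isCompact.image_of_continuousOn
    ((P.chart i).continuousOn.mono (P.pou_subordinate i))

theorem pouSupport_subset (i : ι) : P.pouSupport i ⊆ (P.chart i).target := by
  rintro _ ⟨p, hp, rfl⟩
  exact (P.chart i).map_source (P.pou_subordinate i hp)

theorem pc_eq_zero_of_notMem {i : ι} {x : E3} (hx : x ∈ (P.chart i).target)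
    (h : x ∉ P.pouSupport i) : P.pc i i x = 0 :=
  image_eq_zero_of_notMem_tsupport (f := P.pou i) fun h' =>
    h ⟨_, h', (P.chart i).right_inv hx⟩

end Bundle

namespace Bundle

variable {ι : Type*} [Fintype ι] {N : Type*} [TopologicalSpace N] [ChartedSpace E3 N]
  (P : Bundle ι N)

/-! ### Integration and Stokes' theorem -/

theorem integral_congr {w w' : ι → F3 ℝ} (h : ∀ i, ∀ x ∈ (P.chart i).target, w i x = w' i x) :
    P.integral w = P.integral w' :=
  Finset.sum_congr rfl fun i _ => setIntegral_congr_fun (P.chart i).open_target.measurableSet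
    fun x hx => by simp only [h i x hx]

/-- A density that is continuous and vanishes outside a compact subset of the chart is
integrable. -/
theorem integrableOn_of_compact {i : ι} {f : E3 → ℝ} {K : Set E3} (hK : IsCompact K)
    (hKt : K ⊆ (P.chart i).target) (hf : ContinuousOn f (P.chart i).target)
    (h0 : ∀ x ∈ (P.chart i).target, x ∉ K → f x = 0) : IntegrableOn f (P.chart i).target :=
  ((hf.mono hKt).integrableOn_compact hK).of_forall_sdiff_eq_zero
    (P.chart i).open_target.measurableSet fun x hx => h0 x hx.1 hx.2

theorem integrableOn_pou [CompactSpace N] [IsManifold (𝓡 3) ∞ N] {i : ι} {f : E3 → ℝ}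
    (hf : ContinuousOn f (P.chart i).target) :
    IntegrableOn (fun x => P.pou i ((P.chart i).symm x) * f x) (P.chart i).target :=
  P.integrableOn_of_compact (P.isCompact_pouSupport i) (P.pouSupport_subset i)
    ((P.contDiffOn_pc i i).continuousOn.mul hf) fun x hx hxK => by
      rw [show P.pou i ((P.chart i).symm x) = 0 from P.pc_eq_zero_of_notMem hx hxK, zero_mul]

theorem integral_add [CompactSpace N] [IsManifold (𝓡 3) ∞ N] {w w' : ι → F3 ℝ}
    (hw : ∀ i, ContinuousOn (w i) (P.chart i).target)
    (hw' : ∀ i, ContinuousOn (w' i) (P.chart i).target) :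
    P.integral (fun i x => w i x + w' i x) = P.integral w + P.integral w' := by
  simp only [integral, mul_add]
  rw [← Finset.sum_add_distrib]
  exact Finset.sum_congr rfl fun i _ =>
    MeasureTheory.integral_add (P.integrableOn_pou (hw i)) (P.integrableOn_pou (hw' i))

theorem integral_const_mul (c : ℝ) (w : ι → F3 ℝ) :
    P.integral (fun i x => c * w i x) = c * P.integral w := by
  simp only [integral, Finset.mul_sum, ← MeasureTheory.integral_const_mul]
  refine Finset.sum_congr rfl fun i _ => ?_
  congr 1
  funext x
  ring

theorem integral_neg (w : ι → F3 ℝ) : P.integral (fun i x => -w i x) = -P.integral w := by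
  have h := P.integral_const_mul (-1) w
  simpa using h

theorem integral_sub [CompactSpace N] [IsManifold (𝓡 3) ∞ N] {w w' : ι → F3 ℝ}
    (hw : ∀ i, ContinuousOn (w i) (P.chart i).target)
    (hw' : ∀ i, ContinuousOn (w' i) (P.chart i).target) :
    P.integral (fun i x => w i x - w' i x) = P.integral w - P.integral w' := by
  have h := P.integral_add hw (w' := fun i x => -w' i x) fun i => (hw' i).neg
  rw [integral_neg] at h
  simpa only [sub_eq_add_neg] using h

theorem integral_zero : P.integral (fun _ _ => 0) = 0 := by simp [integral]

theorem integral_sum [CompactSpace N] [IsManifold (𝓡 3) ∞ N] {κ : Type*} (s : Finset κ)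
    {w : κ → ι → F3 ℝ} (hw : ∀ k i, ContinuousOn (w k i) (P.chart i).target) :
    P.integral (fun i x => ∑ k ∈ s, w k i x) = ∑ k ∈ s, P.integral (w k) := by
  classical
  induction s using Finset.induction_on with
  | empty => simp [integral_zero]
  | insert a s ha ih =>
    simp only [Finset.sum_insert ha, ← ih]
    exact P.integral_add (hw a) fun i => continuousOn_finsetSum _ fun k _ => hw k i

theorem det_fderiv_change [IsManifold (𝓡 3) ∞ N] {i j : ι} {x : E3} (hx : x ∈ P.overlap i j) :
    (fderiv ℝ (P.change i j) x).det = (jac (P.change i j) x).det := by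
  rw [ContinuousLinearMap.det, ← LinearMap.det_toMatrix (EuclideanSpace.basisFun (Fin 3) ℝ).toBasis]
  congr 1
  ext l k
  rw [LinearMap.toMatrix_apply]
  simp only [OrthonormalBasis.coe_toBasis, EuclideanSpace.basisFun_apply]
  exact (pd_clm (EuclideanSpace.proj l : E3 →L[ℝ] ℝ) (P.differentiableAt_change hx) k).symm

theorem image_change (i j : ι) : P.change i j '' P.overlap i j = P.overlap j i := by
  ext y
  constructor
  · rintro ⟨x, hx, rfl⟩
    exact P.change_mem_overlap hx
  · intro hy
    exact ⟨P.change j i y, P.change_mem_overlap hy, by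
      rw [P.change_change hy, P.change_self (P.overlap_subset j i hy)]⟩

/-- Change of variables between two charts. -/
theorem setIntegral_change [IsManifold (𝓡 3) ∞ N] (i j : ι) (f : E3 → ℝ) :
    ∫ y in P.overlap j i, f y =
      ∫ x in P.overlap i j, (jac (P.change i j) x).det * f (P.change i j x) := by
  rw [← P.image_change i j, integral_image_eq_integral_abs_det_fderiv_smul volume
    (P.isOpen_overlap i j).measurableSet
    (fun x hx => (P.differentiableAt_change hx).hasFDerivAt.hasFDerivWithinAt)]
  · refine setIntegral_congr_fun (P.isOpen_overlap i j).measurableSet fun x hx => ?_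
    have h : 0 < (jac (P.change i j) x).det := P.oriented i j x hx
    simp only [smul_eq_mul]
    rw [P.det_fderiv_change hx, abs_of_pos h]
  · intro x hx x' hx' h
    have := congrArg (P.change j i) h
    rwa [P.change_change hx, P.change_change hx', P.change_self (P.overlap_subset i j hx),
      P.change_self (P.overlap_subset i j hx')] at this

/-- The integral of a `3`-form supported in the domain of one chart is computed in that chart. -/
theorem integral_eq_of_support [CompactSpace N] [IsManifold (𝓡 3) ∞ N] {w : ι → F3 ℝ} {i : ι}
    {K : Set E3} (hK : IsCompact K) (hKt : K ⊆ (P.chart i).target)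
    (hc : ContinuousOn (w i) (P.chart i).target)
    (h0 : ∀ x ∈ (P.chart i).target, x ∉ K → w i x = 0)
    (hw : ∀ j, ∀ x ∈ P.overlap i j, w j x = (jac (P.change i j) x).det * w i (P.change i j x))
    (hw0 : ∀ j, ∀ x ∈ (P.chart j).target, x ∉ P.overlap i j → w j x = 0) :
    P.integral w = ∫ x in (P.chart i).target, w i x := by
  have h1 (j : ι) : ∫ x in (P.chart j).target, P.pou j ((P.chart j).symm x) * w j x =
      ∫ x in (P.chart i).target, P.pc j i x * w i x := by
    calc ∫ x in (P.chart j).target, P.pou j ((P.chart j).symm x) * w j x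
        = ∫ x in P.overlap i j, P.pou j ((P.chart j).symm x) * w j x := by
          refine setIntegral_eq_of_subset_of_forall_sdiff_eq_zero
            (P.chart j).open_target.measurableSet (P.overlap_subset i j) fun x hx => ?_
          rw [hw0 j x hx.1 hx.2, mul_zero]
      _ = ∫ x in P.overlap i j, (jac (P.change i j) x).det *
            (P.pc j i (P.change i j x) * w i (P.change i j x)) := by
          refine setIntegral_congr_fun (P.isOpen_overlap i j).measurableSet fun x hx => ?_
          simp only [hw j x hx]
          rw [P.pc_change hx, pc]
          ring
      _ = ∫ x in P.overlap j i, P.pc j i x * w i x :=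
          (P.setIntegral_change i j fun x => P.pc j i x * w i x).symm
      _ = ∫ x in (P.chart i).target, P.pc j i x * w i x := by
          refine (setIntegral_eq_of_subset_of_forall_sdiff_eq_zero
            (P.chart i).open_target.measurableSet (P.overlap_subset j i) fun x hx => ?_).symm
          rw [P.pc_eq_zero hx.1 hx.2, zero_mul]
  rw [integral, Finset.sum_congr rfl fun j _ => h1 j, ← integral_finsetSum]
  · simp only [← Finset.sum_mul, P.sum_pc, one_mul]
  · intro j _
    exact P.integrableOn_of_compact hK hKt ((P.contDiffOn_pc j i).continuousOn.mul hc)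
      fun x hx hxK => by rw [h0 x hx hxK, mul_zero]

/-- The integral of a derivative of a compactly supported function vanishes. -/
theorem integral_pd_eq_zero {i : ι} {f : E3 → ℝ} {K : Set E3} (hK : IsCompact K)
    (hKt : K ⊆ (P.chart i).target) (hf : ContDiffOn ℝ ∞ f (P.chart i).target)
    (h0 : ∀ x ∈ (P.chart i).target, x ∉ K → f x = 0) (k : Fin 3) :
    ∫ x in (P.chart i).target, pd k f x = 0 := by
  set g : E3 → ℝ := (P.chart i).target.indicator f with hg
  have hgK : ∀ x ∉ K, g x = 0 := fun x hx => by
    by_cases hxt : x ∈ (P.chart i).target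
    · rw [hg, indicator_of_mem hxt, h0 x hxt hx]
    · rw [hg, indicator_of_notMem hxt]
  have hgs : HasCompactSupport g := HasCompactSupport.intro hK hgK
  have hgd : ContDiff ℝ ∞ g := by
    rw [contDiff_iff_contDiffAt]
    intro x
    by_cases hxt : x ∈ (P.chart i).target
    · refine (hf.contDiffAt ((P.chart i).open_target.mem_nhds hxt)).congr_of_eventuallyEq ?_
      filter_upwards [(P.chart i).open_target.mem_nhds hxt] with y hy
      exact indicator_of_mem hy f
    · refine (contDiffAt_const (c := (0 : ℝ))).congr_of_eventuallyEq ?_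
      filter_upwards [hK.isClosed.isOpen_compl.mem_nhds fun h => hxt (hKt h)] with y hy
      exact hgK y hy
  have h1 : ∫ x in (P.chart i).target, pd k f x = ∫ x, pd k g x := by
    rw [setIntegral_congr_fun (P.chart i).open_target.measurableSet (g := pd k g)]
    · refine setIntegral_eq_integral_of_forall_compl_eq_zero fun x hx => ?_
      rw [pd_congr (b := fun _ => (0 : ℝ)), pd_const]
      filter_upwards [hK.isClosed.isOpen_compl.mem_nhds fun h => hx (hKt h)] with y hy
      exact hgK y hy
    · intro x hx
      exact pd_congr_on (P.chart i).open_target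
        (fun y hy => (indicator_of_mem hy f).symm) hx k
  rw [h1]
  have hgd' : Continuous fun x => fderiv ℝ g x (EuclideanSpace.single k 1) :=
    (hgd.continuous_fderiv (by simp)).clm_apply continuous_const
  have hint : Integrable fun x => fderiv ℝ g x (EuclideanSpace.single k 1) :=
    hgd'.integrable_of_hasCompactSupport (hgs.fderiv_apply ℝ _)
  have h2 := integral_bilinear_fderiv_right_eq_neg_left_of_integrable (μ := volume)
    (f := fun _ : E3 => (1 : ℝ)) (g := g) (v := EuclideanSpace.single k 1)
    (B := ContinuousLinearMap.mul ℝ ℝ) (by simp) (by simpa using hint)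
    (by simpa using hgd.continuous.integrable_of_hasCompactSupport hgs)
    (fun x _ => differentiableAt_const _) (fun x _ => hgd.differentiable (by simp) x)
  simpa [pd] using h2

theorem isTensor_pd_pc [IsManifold (𝓡 3) ∞ N] (i : ι) :
    P.IsTensor P.tr1 (fun _ (t : ℝ) => t) fun j k => pd k (P.pc i j) where
  smooth j k := contDiffOn_pd (P.chart j).open_target (P.contDiffOn_pc i j) k
  compat m j k x hx := by
    rw [pd_congr_on (P.isOpen_overlap m j) (fun y hy => (P.pc_change hy).symm) hx,
      pd_comp (differentiableAt_of_contDiffOn (P.chart m).open_target (P.contDiffOn_pc i m)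
        (P.change_mem_target hx)) (P.differentiableAt_change hx)]
    rfl

theorem isInv_mul : IsInv (fun _ (t : ℝ) => t) (fun _ _ => (0 : ℝ)) (fun _ (t : ℝ) => t)
    (fun _ _ => (0 : ℝ)) (fun _ (t : ℝ) => t) (fun _ _ => (0 : ℝ)) fun s t : ℝ => s * t where
  bil := ⟨ContinuousLinearMap.mul ℝ ℝ, fun _ _ => rfl⟩
  gr _ _ _ := rfl
  al _ _ _ := by simp

/-- Stokes' theorem on the closed manifold `N`. With the partition of unity `χᵢ`, the forms
`d(χᵢ φ)` have integral zero in the `i`-th chart, and the remaining terms `dχᵢ ∧ φ` are global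
`3`-forms whose sum vanishes. -/
theorem stokes [CompactSpace N] [IsManifold (𝓡 3) ∞ N] {φ : ι → F2 ℝ}
    (hφ : P.IsTensor P.tr2 (fun _ t => t) φ) :
    P.integral (fun i x => ∑ k, pd k (φ i k) x) = 0 := by
  set θ : ι → ι → F3 ℝ := fun i j => w12 (fun s t : ℝ => s * t) (fun k => pd k (P.pc i j)) (φ j)
    with hθ
  have hθc (i j) : ContinuousOn (θ i j) (P.chart j).target :=
    continuousOn_finsetSum _ fun k _ =>
      ((P.isTensor_pd_pc i).smooth j k).continuousOn.mul (hφ.smooth j k).continuousOn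
  have hK (i) := P.isCompact_pouSupport i
  have hz (i) : ∀ x ∈ (P.chart i).target, x ∉ P.pouSupport i →
      ∀ᶠ y in 𝓝 x, P.pc i i y = 0 := fun x hx hxK => by
    filter_upwards [(P.chart i).open_target.mem_nhds hx,
      (hK i).isClosed.isOpen_compl.mem_nhds hxK] with y hy hyK
    exact P.pc_eq_zero_of_notMem hy hyK
  have hdz (i k) : ∀ x ∈ (P.chart i).target, x ∉ P.pouSupport i → pd k (P.pc i i) x = 0 :=
    fun x hx hxK => by
      rw [pd_congr (b := fun _ => (0 : ℝ)) (hz i x hx hxK), pd_const]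
  have h1 (i) : ∫ x in (P.chart i).target,
      P.pou i ((P.chart i).symm x) * ∑ k, pd k (φ i k) x = -P.integral (θ i) := by
    have hs (k) : ContDiffOn ℝ ∞ (fun x => P.pc i i x * φ i k x) (P.chart i).target :=
      (P.contDiffOn_pc i i).mul (hφ.smooth i k)
    have hint (k) : IntegrableOn (pd k fun x => P.pc i i x * φ i k x) (P.chart i).target :=
      P.integrableOn_of_compact (hK i) (P.pouSupport_subset i)
        (contDiffOn_pd (P.chart i).open_target (hs k) k).continuousOn fun x hx hxK => by
          rw [pd_congr (b := fun _ => (0 : ℝ)), pd_const]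
          filter_upwards [hz i x hx hxK] with y hy
          rw [hy, zero_mul]
    have hint' : IntegrableOn (θ i i) (P.chart i).target :=
      P.integrableOn_of_compact (hK i) (P.pouSupport_subset i) (hθc i i) fun x hx hxK =>
        Finset.sum_eq_zero fun k _ => by simp only [hdz i k x hx hxK, zero_mul]
    have hpt : ∀ x ∈ (P.chart i).target, P.pou i ((P.chart i).symm x) * ∑ k, pd k (φ i k) x =
        (∑ k, pd k (fun x => P.pc i i x * φ i k x) x) - θ i i x := fun x hx => by
      simp only [hθ, w12]
      rw [← Finset.sum_sub_distrib, Finset.mul_sum]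
      refine Finset.sum_congr rfl fun k _ => ?_
      rw [isInv_mul.bil.pd (differentiableAt_of_contDiffOn (P.chart i).open_target
        (P.contDiffOn_pc i i) hx) (hφ.diff i k hx)]
      simp [pc]
    rw [setIntegral_congr_fun (P.chart i).open_target.measurableSet hpt,
      MeasureTheory.integral_sub (integrable_finsetSum _ fun k _ => hint k) hint',
      integral_finsetSum _ fun k _ => hint k, Finset.sum_eq_zero, zero_sub, neg_inj]
    · refine (P.integral_eq_of_support (hK i) (P.pouSupport_subset i) (hθc i i) ?_ ?_ ?_).symm
      · exact fun x hx hxK => Finset.sum_eq_zero fun k _ => by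
          simp only [hdz i k x hx hxK, zero_mul]
      · exact fun j x hx => w12_compat P.sum_tr1_mul_tr2 isInv_mul (P.isTensor_pd_pc i) hφ hx
      · intro j x hx hxo
        refine Finset.sum_eq_zero fun k _ => ?_
        change pd k (P.pc i j) x * _ = 0
        rw [pd_congr (b := fun _ => (0 : ℝ)) (P.pc_eventually_zero hx hxo), pd_const, zero_mul]
    · intro k _
      refine P.integral_pd_eq_zero (hK i) (P.pouSupport_subset i) (hs k) (fun x hx hxK => ?_) k
      rw [P.pc_eq_zero_of_notMem hx hxK, zero_mul]
  have h2 : P.integral (fun j x => ∑ i, θ i j x) = 0 := by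
    rw [P.integral_congr (w' := fun _ _ => 0), integral_zero]
    intro j x hx
    simp only [hθ, w12]
    rw [Finset.sum_comm]
    refine Finset.sum_eq_zero fun k _ => ?_
    rw [← Finset.sum_mul, ← pd_sum _ fun i _ => differentiableAt_of_contDiffOn
      (P.chart j).open_target (P.contDiffOn_pc i j) hx]
    simp only [P.sum_pc, pd_const, zero_mul]
  rw [P.integral_sum _ hθc] at h2
  rw [integral, Finset.sum_congr rfl fun i _ => h1 i, Finset.sum_neg_distrib, h2, neg_zero]

end Bundle

/-! ### Calculus of covariant derivatives -/

section Leibniz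

variable {X Y Z : Type*} [NormedAddCommGroup X] [NormedSpace ℝ X] [NormedAddCommGroup Y]
  [NormedSpace ℝ Y] [NormedAddCommGroup Z] [NormedSpace ℝ Z]
  {r₁ : SO31 → X → X} {r₁' : so31 → X → X} {r₂ : SO31 → Y → Y} {r₂' : so31 → Y → Y}
  {r₃ : SO31 → Z → Z} {r₃' : so31 → Z → Z} {m : X → Y → Z} {A : F1 so31} {x : E3}

theorem dA1_congr {r : so31 → X → X} {u v : F1 X} {s : Set E3} (hs : IsOpen s)
    (h : ∀ k, ∀ y ∈ s, u k y = v k y) (hx : x ∈ s) (k : Fin 3) :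
    dA1 r A u k x = dA1 r A v k x := by
  simp only [dA1, w11, h _ x hx]
  rw [pd_congr_on hs (h (k + 2)) hx, pd_congr_on hs (h (k + 1)) hx]

theorem dA2_congr {r : so31 → X → X} {u v : F2 X} {s : Set E3} (hs : IsOpen s)
    (h : ∀ k, ∀ y ∈ s, u k y = v k y) (hx : x ∈ s) : dA2 r A u x = dA2 r A v x := by
  simp only [dA2, w12, h _ x hx]
  rw [Finset.sum_congr rfl fun k _ => pd_congr_on hs (h k) hx k]

theorem dA1_neg {r : so31 → X → X} (hr : IsBil r) (u : F1 X) (k : Fin 3) :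
    dA1 r A (fun k x => -u k x) k x = -dA1 r A u k x := by
  simp only [dA1, w11, pd_neg, hr.neg_right]
  abel

theorem dA2_neg {r : so31 → X → X} (hr : IsBil r) (u : F2 X) :
    dA2 r A (fun k x => -u k x) x = -dA2 r A u x := by
  simp only [dA2, w12, pd_neg, hr.neg_right, Finset.sum_neg_distrib]
  abel

theorem dA1_const_smul {r : so31 → X → X} (hr : IsBil r) (c : ℝ) {u : F1 X}
    (hu : ∀ k, DifferentiableAt ℝ (u k) x) (k : Fin 3) :
    dA1 r A (fun k x => c • u k x) k x = c • dA1 r A u k x := by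
  simp only [dA1, w11, pd_const_smul c (hu _), hr.smul_right]
  module

/-- Covariant derivatives commute with endomorphisms of the representation. -/
theorem dA1_map {r : so31 → X → X} {f : X → X} (f' : X →L[ℝ] X) (hf : ∀ x, f x = f' x)
    (hc : ∀ W v, f (r W v) = r W (f v)) {u : F1 X} (hu : ∀ k, DifferentiableAt ℝ (u k) x)
    (k : Fin 3) : dA1 r A (fun k x => f (u k x)) k x = f (dA1 r A u k x) := by
  simp only [dA1, w11, ← hc]
  simp only [hf, pd_clm f' (hu _), map_add, map_sub]

theorem dA1_w01 (hm : IsInv r₁ r₁' r₂ r₂' r₃ r₃' m) {f : F0 X} {a : F1 Y}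
    (hf : DifferentiableAt ℝ f x) (ha : ∀ k, DifferentiableAt ℝ (a k) x) (k : Fin 3) :
    dA1 r₃' A (w01 m f a) k x =
      w11 m (dA0 r₁' A f) a k x + m (f x) (dA1 r₂' A a k x) := by
  have hp (l b) : pd l (w01 m f a b) x = m (pd l f x) (a b x) + m (f x) (pd l (a b) x) :=
    hm.bil.pd hf (ha b) l
  simp only [dA1, w11, dA0, hp]
  simp only [w01, hm.al, hm.bil.add_left, hm.bil.add_right, hm.bil.sub_right]
  abel

theorem dA2_w01 (hm : IsInv r₁ r₁' r₂ r₂' r₃ r₃' m) {f : F0 X} {b : F2 Y}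
    (hf : DifferentiableAt ℝ f x) (hb : ∀ k, DifferentiableAt ℝ (b k) x) :
    dA2 r₃' A (w01 m f b) x = w12 m (dA0 r₁' A f) b x + m (f x) (dA2 r₂' A b x) := by
  have hp (l) : pd l (w01 m f b l) x = m (pd l f x) (b l x) + m (f x) (pd l (b l) x) :=
    hm.bil.pd hf (hb l) l
  simp only [dA2, w12, dA0, hp]
  simp only [w01, hm.al, hm.bil.add_left, hm.bil.add_right, hm.bil.sum_right,
    Finset.sum_add_distrib]
  abel

theorem dA2_w10 (hm : IsInv r₁ r₁' r₂ r₂' r₃ r₃' m) {b : F2 X} {f : F0 Y}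
    (hb : ∀ k, DifferentiableAt ℝ (b k) x) (hf : DifferentiableAt ℝ f x) :
    dA2 r₃' A (w10 m b f) x = m (dA2 r₁' A b x) (f x) + w12 m b (dA0 r₂' A f) x := by
  have hp (l) : pd l (w10 m b f l) x = m (pd l (b l) x) (f x) + m (b l x) (pd l f x) :=
    hm.bil.pd (hb l) hf l
  simp only [dA2, w12, dA0, hp]
  simp only [w10, hm.al, hm.bil.add_left, hm.bil.add_right, hm.bil.sum_left,
    Finset.sum_add_distrib]
  abel

theorem dA2_w11 (hm : IsInv r₁ r₁' r₂ r₂' r₃ r₃' m) (h₃ : IsBil r₃') {a : F1 X} {b : F1 Y}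
    (ha : ∀ k, DifferentiableAt ℝ (a k) x) (hb : ∀ k, DifferentiableAt ℝ (b k) x) :
    dA2 r₃' A (w11 m a b) x = w12 m (dA1 r₁' A a) b x - w12 m a (dA1 r₂' A b) x := by
  have hp (l) : pd l (w11 m a b l) x = m (pd l (a (l + 1)) x) (b (l + 2) x) +
      m (a (l + 1) x) (pd l (b (l + 2)) x) - (m (pd l (a (l + 2)) x) (b (l + 1) x) +
      m (a (l + 2) x) (pd l (b (l + 1)) x)) := by
    rw [← hm.bil.pd (ha _) (hb _), ← hm.bil.pd (ha _) (hb _)]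
    exact pd_sub (hm.bil.differentiableAt (ha _) (hb _)) (hm.bil.differentiableAt (ha _) (hb _)) l
  obtain ⟨f1, f2, f3, f4, f5, f6⟩ := Bundle.fin3_facts
  simp only [dA2, w12, dA1, hp]
  simp only [w11, hm.al, hm.bil.add_left, hm.bil.add_right, hm.bil.sub_left, hm.bil.sub_right,
    h₃.sub_right, Fin.sum_univ_three, f1, f2, f3, f4, f5, f6]
  abel

theorem curv_eq (A : F1 so31) (k : Fin 3) (x : E3) : curv A k x =
    pd (k + 1) (A (k + 2)) x - pd (k + 2) (A (k + 1)) x + lieB (A (k + 1) x) (A (k + 2) x) := by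
  simp only [curv, w11]
  rw [lieB_skew (A (k + 2) x)]
  module

/-- The square of the covariant derivative is the curvature. -/
theorem dA1_dA0 {s : Set E3} (hs : IsOpen s) (hA : ∀ k, ContDiffOn ℝ ∞ (A k) s) (hx : x ∈ s)
    (hr : IsRep r₁ r₁') {u : F0 X} (hu : ContDiffOn ℝ ∞ u s) (k : Fin 3) :
    dA1 r₁' A (dA0 r₁' A u) k x = r₁' (curv A k x) (u x) := by
  have hA' (k) := differentiableAt_of_contDiffOn hs (hA k) hx
  have hu' := differentiableAt_of_contDiffOn hs hu hx
  have hp (l b) : pd l (dA0 r₁' A u b) x = pd l (pd b u) x +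
      (r₁' (pd l (A b) x) (u x) + r₁' (A b x) (pd l u x)) := by
    rw [← hr.bil.pd (hA' b) hu']
    exact pd_add (differentiableAt_of_contDiffOn hs (contDiffOn_pd hs hu b) hx)
      (hr.bil.differentiableAt (hA' b) hu') l
  rw [curv_eq]
  simp only [dA1, hp, w11, pd_comm hs hu hx (k + 1) (k + 2)]
  simp only [dA0, hr.bil.add_left, hr.bil.add_right, hr.bil.sub_left, hr.bracket]
  abel

theorem dA2_dA1 {s : Set E3} (hs : IsOpen s) (hA : ∀ k, ContDiffOn ℝ ∞ (A k) s) (hx : x ∈ s)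
    (hr : IsRep r₁ r₁') {u : F1 X} (hu : ∀ k, ContDiffOn ℝ ∞ (u k) s) :
    dA2 r₁' A (dA1 r₁' A u) x = w12 r₁' (curv A) u x := by
  have hA' (k) := differentiableAt_of_contDiffOn hs (hA k) hx
  have hu' (k) := differentiableAt_of_contDiffOn hs (hu k) hx
  have hp (l b) : pd l (dA1 r₁' A u b) x = pd l (pd (b + 1) (u (b + 2))) x -
      pd l (pd (b + 2) (u (b + 1))) x +
      (r₁' (pd l (A (b + 1)) x) (u (b + 2) x) + r₁' (A (b + 1) x) (pd l (u (b + 2)) x) -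
      (r₁' (pd l (A (b + 2)) x) (u (b + 1) x) + r₁' (A (b + 2) x) (pd l (u (b + 1)) x))) := by
    have h1 (a c) := hr.bil.differentiableAt (hA' a) (hu' c)
    have h2 (a c) := differentiableAt_of_contDiffOn hs (contDiffOn_pd hs (hu a) c) hx
    rw [← hr.bil.pd (hA' _) (hu' _), ← hr.bil.pd (hA' _) (hu' _), ← pd_sub (h1 _ _) (h1 _ _),
      ← pd_sub (h2 _ _) (h2 _ _)]
    exact pd_add ((h2 _ _).sub (h2 _ _)) ((h1 _ _).sub (h1 _ _)) l
  have hc (a) := pd_comm hs (hu a) hx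
  obtain ⟨f1, f2, f3, f4, f5, f6⟩ := Bundle.fin3_facts
  simp only [dA2, w12, hp, curv_eq, dA1, w11, Fin.sum_univ_three, f1, f2, f3, f4, f5, f6,
    hc _ 1 0, hc _ 2 0, hc _ 2 1]
  simp only [hr.bil.add_left, hr.bil.add_right, hr.bil.sub_left, hr.bil.sub_right, hr.bracket]
  abel

/-- The Bianchi identity. -/
theorem dA2_curv {s : Set E3} (hs : IsOpen s) (hA : ∀ k, ContDiffOn ℝ ∞ (A k) s) (hx : x ∈ s) :
    dA2 lieB A (curv A) x = 0 := by
  have hA' (k) := differentiableAt_of_contDiffOn hs (hA k) hx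
  have hp (l b) : pd l (curv A b) x = pd l (pd (b + 1) (A (b + 2))) x -
      pd l (pd (b + 2) (A (b + 1))) x +
      (lieB (pd l (A (b + 1)) x) (A (b + 2) x) + lieB (A (b + 1) x) (pd l (A (b + 2)) x)) := by
    have h2 (a c) := differentiableAt_of_contDiffOn hs (contDiffOn_pd hs (hA a) c) hx
    rw [← isBil_lieB.pd (hA' _) (hA' _), ← pd_sub (h2 _ _) (h2 _ _),
      show curv A b = _ from funext fun y => curv_eq A b y]
    exact pd_add ((h2 _ _).sub (h2 _ _)) (isBil_lieB.differentiableAt (hA' _) (hA' _)) l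
  have hc (a) := pd_comm hs (hA a) hx
  obtain ⟨f1, f2, f3, f4, f5, f6⟩ := Bundle.fin3_facts
  have hJ := lieB_lieB (A 0 x) (A 1 x) (A 2 x)
  rw [lieB_skew (lieB _ _)] at hJ
  have hJ' : lieB (A 1 x) (lieB (A 2 x) (A 0 x)) = -lieB (A 1 x) (lieB (A 0 x) (A 2 x)) := by
    rw [lieB_skew (A 2 x), isBil_lieB.neg_right]
  simp only [dA2, w12, hp, curv_eq, Fin.sum_univ_three, f1, f2, f3, f4, f5, f6,
    hc _ 1 0, hc _ 2 0, hc _ 2 1]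
  simp only [isBil_lieB.add_right, isBil_lieB.sub_right, hJ', lieB_skew (pd _ _ _)]
  linear_combination (norm := module) (-1 : ℝ) • hJ

end Leibniz

namespace Bundle

variable {ι : Type*} [Fintype ι] {N : Type*} [TopologicalSpace N] [ChartedSpace E3 N]
  {P : Bundle ι N}

/-! ### Sections with prescribed values, curvature, and non-degeneracy of the pairings -/

section

variable {X Y : Type*} [NormedAddCommGroup X] [NormedSpace ℝ X] [NormedAddCommGroup Y]
  [NormedSpace ℝ Y] {r₁ : SO31 → X → X} {r₁' : so31 → X → X} {r₂ : SO31 → Y → Y}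
  {r₂' : so31 → Y → Y}

theorem extend_supp {κ : Type*} [Fintype κ] {C : ι → ι → E3 → κ → κ → ℝ} {r : SO31 → X → X} {i : ι}
    {a : κ → E3 → X} (j : ι) (k : κ) {x : E3} (hx : x ∉ (P.chart j).target) :
    P.extend C r i a j k x = 0 :=
  extend_of_notMem (fun h => hx (P.overlap_subset i j h)) a k

theorem exists_section [IsManifold (𝓡 3) ∞ N] [T2Space N] (hr : IsRep r₁ r₁') {i : ι} {x : E3}
    (hx : x ∈ (P.chart i).target) (v : X) : ∃ u : ι → F0 X, P.IsForm0 r₁ u ∧ u i x = v := by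
  obtain ⟨φ, h1, h2, h3, -, h5⟩ := exists_contDiff_tsupport_subset (n := ⊤)
    ((P.chart i).open_target.mem_nhds hx)
  have hsub : tsupport (fun y => φ y • v) ⊆ tsupport φ :=
    closure_mono fun y hy hy' => hy (by simp [hy'])
  have ht := isTensor_extend (P := P) (i := i) (a := fun (_ : Unit) y => φ y • v) P.isCocycle_tr0 hr
    (fun _ => h3.smul contDiff_const) (fun _ => h2.smul_right) (fun _ => hsub.trans h1)
  refine ⟨_, ht.isForm0 fun j k y hy => extend_supp j k hy, ?_⟩
  rw [extend_self P.isCocycle_tr0 hr hx]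
  simp [h5]

/-- The integrated pairing of forms of complementary degrees is non-degenerate, by the fundamental
lemma of the calculus of variations. The hypothesis `hC` says that the transition matrices `C` and
`C'` multiply to those of `3`-forms. -/
theorem eq_zero_of_integral [CompactSpace N] [IsManifold (𝓡 3) ∞ N] [T2Space N]
    {C C' : ι → ι → E3 → Fin 3 → Fin 3 → ℝ} (hC' : P.IsCocycle C')
    (hC : ∀ i j x l l', ∑ k, C i j x l k * C' i j x l' k =
      if l = l' then (jac (P.change i j) x).det else 0)
    {p : X → Y → ℝ} (hm : IsInv r₁ r₁' r₂ r₂' (fun _ t => t) (fun _ _ => 0) p)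
    (hr : IsRep r₂ r₂') (hp : ∀ x, (∀ y, p x y = 0) → x = 0)
    {u : ι → Fin 3 → E3 → X} (hu : P.IsTensor C r₁ u)
    (h : ∀ v : ι → Fin 3 → E3 → Y, P.IsTensor C' r₂ v →
      (∀ i k, ∀ x ∉ (P.chart i).target, v i k x = 0) →
      P.integral (fun i => w12 p (u i) (v i)) = 0) (i : ι) (k : Fin 3) {x : E3}
    (hx : x ∈ (P.chart i).target) : u i k x = 0 := by
  refine hp _ fun z => ?_
  have hcont : ContinuousOn (fun x => p (u i k x) z) (P.chart i).target :=
    (hm.bil.contDiffOn (hu.smooth i k) contDiffOn_const).continuousOn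
  have ho := (P.chart i).open_target
  have hae := ho.ae_eq_zero_of_integral_contDiff_smul_eq_zero
    (hcont.locallyIntegrableOn ho.measurableSet) (μ := volume) fun g hg hgc hgs => by
      -- the test form with the single component `g z` in the `i`-th chart
      set a : Fin 3 → E3 → Y := fun l x => if l = k then g x • z else 0 with ha
      have hsub (l) : tsupport (a l) ⊆ tsupport g := by
        refine closure_mono fun y hy hy' => hy ?_
        simp only [ha, show g y = 0 from hy', zero_smul, ite_self]
      have hac (l) : HasCompactSupport (a l) :=
        hgc.of_isClosed_subset (isClosed_tsupport _) (hsub l)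
      have has (l) : ContDiff ℝ ∞ (a l) := by
        by_cases hl : l = k
        · simp only [ha, hl, if_true]
          exact hg.smul contDiff_const
        · simp only [ha, hl, if_false]
          exact contDiff_const
      have ht := isTensor_extend hC' hr has hac fun l => (hsub l).trans hgs
      have hw : ∀ x ∈ (P.chart i).target, w12 p (u i) (P.extend C' r₂ i a i) x =
          g x * p (u i k x) z := fun x hx => by
        simp only [w12, extend_self hC' hr hx, ha]
        rw [Finset.sum_eq_single k]
        · rw [if_pos rfl, hm.bil.smul_right, smul_eq_mul]
        · intro l _ hl
          rw [if_neg hl, hm.bil.zero_right]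
        · simp
      have h1 := h _ ht fun j k y hy => extend_supp j k hy
      rw [P.integral_eq_of_support (i := i) (w := fun j => w12 p (u j) (P.extend C' r₂ i a j))
        hgc hgs ((hg.continuous.continuousOn.mul hcont).congr hw)] at h1
      · rw [setIntegral_congr_fun ho.measurableSet hw] at h1
        rw [← h1]
        refine (setIntegral_eq_integral_of_forall_compl_eq_zero fun x hx => ?_).symm
        rw [image_eq_zero_of_notMem_tsupport fun h' => hx (hgs h'), zero_smul]
      · intro x hx hxK
        rw [hw x hx, image_eq_zero_of_notMem_tsupport hxK, zero_mul]
      · exact fun j x hx => w12_compat hC hm hu ht hx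
      · intro j x hx hxo
        refine Finset.sum_eq_zero fun l _ => ?_
        rw [extend_of_notMem hxo, hm.bil.zero_right]
  have h2 := Measure.eqOn_open_of_ae_eq (g := fun _ => (0 : ℝ))
    ((ae_restrict_iff' ho.measurableSet).2 hae) ho hcont continuousOn_const
  exact h2 hx

end

/-- The curvature is tensorial, as it is determined by its action on sections. -/
theorem IsConn.isTensor_curv [IsManifold (𝓡 3) ∞ N] [T2Space N] {A : ι → F1 so31}
    (hA : P.IsConn A) : P.IsTensor P.tr2 Ad fun i => curv (A i) where
  smooth i k := ((contDiffOn_pd (P.chart i).open_target (hA.smooth i _) _).sub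
    (contDiffOn_pd (P.chart i).open_target (hA.smooth i _) _)).add
    (((isBil_lieB.contDiffOn (hA.smooth i _) (hA.smooth i _)).sub
    (isBil_lieB.contDiffOn (hA.smooth i _) (hA.smooth i _))).const_smul _)
  compat i j k x hx := by
    -- the curvature acts on sections of the vector bundle as the square of the covariant derivative
    rw [← sub_eq_zero]
    refine eq_zero_of_act _ fun v => ?_
    obtain ⟨w, rfl⟩ := isRep_actV.surj (P.gc j i x) v
    obtain ⟨ε, hε, rfl⟩ := exists_section (P := P) isRep_actV (P.change_mem_target hx) w
    have h1 := ((hε.tensor.dA0 hA isRep_actV).dA1 hA isRep_actV).compat i j k x hx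
    rw [dA1_dA0 (P.chart j).open_target (hA.smooth j) (P.overlap_subset i j hx) isRep_actV
      (hε.smooth j), hε.compat i j x hx] at h1
    simp only [dA1_dA0 (P.chart i).open_target (hA.smooth i) (P.change_mem_target hx) isRep_actV
      (hε.smooth i)] at h1
    rw [isBil_act.sub_left, h1, isBil_act.sum_left]
    simp only [isBil_act.smul_left, Ad_act, sub_self]

end Bundle

namespace Bundle

/-! ### The maps `id + β T` and `β (id - T)` -/

section Endomorphisms

variable (β : ℝ) (T : so31 ≃ₗ⁅ℝ, so31⁆ so31)

/-- `id + β T` as a linear map. -/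
def idAddL : so31 →ₗ[ℝ] so31 := LinearMap.id + β • (T : so31 →ₗ[ℝ] so31)

/-- `β (id - T)` as a linear map. -/
def defectL : so31 →ₗ[ℝ] so31 := β • (LinearMap.id - (T : so31 →ₗ[ℝ] so31))

theorem idAddL_apply (X : so31) : idAddL β T X = idAdd β T X := rfl
theorem defectL_apply (X : so31) : defectL β T X = defect β T X := rfl

theorem idAddL_lieB (X Y : so31) : idAddL β T (lieB X Y) = lieB X (idAddL β T Y) := by
  have h : T (lieB X Y) = lieB X (T Y) := T.toLieModuleHom.map_lie X Y
  simp only [idAddL_apply, idAdd, h, isBil_lieB.add_right, isBil_lieB.smul_right]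

theorem defectL_lieB (X Y : so31) : defectL β T (lieB X Y) = lieB X (defectL β T Y) := by
  have h : T (lieB X Y) = lieB X (T Y) := T.toLieModuleHom.map_lie X Y
  simp only [defectL_apply, defect, h, isBil_lieB.sub_right, isBil_lieB.smul_right]

theorem idAdd_lieB (X Y : so31) : idAdd β T (lieB X Y) = lieB X (idAdd β T Y) :=
  idAddL_lieB β T X Y

theorem kil_idAdd (X Y : so31) : kil (idAdd β T X) Y = kil X (idAdd β T Y) :=
  commutant_kil (idAddL_lieB β T) X Y

theorem Ad_idAdd (L : SO31) (X : so31) : idAdd β T (Ad L X) = Ad L (idAdd β T X) :=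
  commutant_Ad (idAddL_lieB β T) L X

theorem idAdd_add (X Y : so31) : idAdd β T (X + Y) = idAdd β T X + idAdd β T Y :=
  (idAddL β T).map_add X Y

theorem idAdd_smul (r : ℝ) (X : so31) : idAdd β T (r • X) = r • idAdd β T X :=
  (idAddL β T).map_smul r X

theorem idAdd_neg (X : so31) : idAdd β T (-X) = -idAdd β T X := (idAddL β T).map_neg X

theorem idAdd_sub (X Y : so31) : idAdd β T (X - Y) = idAdd β T X - idAdd β T Y :=
  (idAddL β T).map_sub X Y

theorem defect_eq (X : so31) : defect β T X = (1 + β) • X - idAdd β T X := by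
  simp only [defect, idAdd]
  module

/-- `id + β T` as a continuous linear map. -/
def idAddCLM : so31 →L[ℝ] so31 := toCLM (idAdd β T) (idAdd_add β T) (idAdd_smul β T)

theorem idAddCLM_apply (X : so31) : idAdd β T X = idAddCLM β T X := rfl

end Endomorphisms

variable {ι : Type*} [Fintype ι] {N : Type*} [TopologicalSpace N] [ChartedSpace E3 N]
  {P : Bundle ι N}

/-! ### Integration by parts -/

section

variable [CompactSpace N] [IsManifold (𝓡 3) ∞ N]
  {X Y Z : Type*} [NormedAddCommGroup X] [NormedSpace ℝ X] [NormedAddCommGroup Y]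
  [NormedSpace ℝ Y] [NormedAddCommGroup Z] [NormedSpace ℝ Z]
  {r₁ : SO31 → X → X} {r₁' : so31 → X → X} {r₂ : SO31 → Y → Y} {r₂' : so31 → Y → Y}
  {p : X → Y → ℝ} {A : ι → F1 so31}

theorem dA2_trivial (A : F1 so31) (u : F2 ℝ) (x : E3) :
    dA2 (fun _ _ => (0 : ℝ)) A u x = ∑ k, pd k (u k) x := by simp [dA2, w12]

/-- Integration by parts `∫ p(d_A b, f) = -∫ p(b, d_A f)` for a `2`-form and a `0`-form. -/
theorem integral_dA2_add (A : ι → F1 so31)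
    (hp : IsInv r₁ r₁' r₂ r₂' (fun _ t => t) (fun _ _ => 0) p)
    {b : ι → F2 X} {f : ι → F0 Y} (hb : P.IsTensor P.tr2 r₁ b)
    (hf : P.IsTensor tr0 r₂ fun i (_ : Unit) => f i) :
    P.integral (fun i x => w30 p (dA2 r₁' (A i) (b i)) (f i) x +
      w12 p (b i) (dA0 r₂' (A i) (f i)) x) = 0 := by
  rw [← P.stokes (hb.w10 hp hf)]
  refine P.integral_congr fun i x hx => ?_
  rw [← dA2_trivial (A i)]
  exact (dA2_w10 hp (fun k => hb.diff i k hx) (hf.diff i () hx)).symm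

/-- Integration by parts `∫ p(d_A a, b) = ∫ p(a, d_A b)` for two `1`-forms. -/
theorem integral_dA1_sub (A : ι → F1 so31)
    (hp : IsInv r₁ r₁' r₂ r₂' (fun _ t => t) (fun _ _ => 0) p)
    {a : ι → F1 X} {b : ι → F1 Y} (ha : P.IsTensor P.tr1 r₁ a) (hb : P.IsTensor P.tr1 r₂ b) :
    P.integral (fun i x => w12 p (dA1 r₁' (A i) (a i)) (b i) x -
      w12 p (a i) (dA1 r₂' (A i) (b i)) x) = 0 := by
  rw [← P.stokes (ha.w11 hp isRep_trivial hb)]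
  refine P.integral_congr fun i x hx => ?_
  rw [← dA2_trivial (A i)]
  exact (dA2_w11 hp isRep_trivial.bil (fun k => ha.diff i k hx) (fun k => hb.diff i k hx)).symm

end

/-! ### Smooth families of local components -/

section Smooth

/-- The components of `u` are smooth on the domains of the coordinates. -/
def IsSmooth (P : Bundle ι N) {κ X : Type*} [NormedAddCommGroup X] [NormedSpace ℝ X]
    (u : ι → κ → E3 → X) : Prop := ∀ i k, ContDiffOn ℝ ∞ (u i k) (P.chart i).target

variable {X Y Z : Type*} [NormedAddCommGroup X] [NormedSpace ℝ X] [NormedAddCommGroup Y]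
  [NormedSpace ℝ Y] [NormedAddCommGroup Z] [NormedSpace ℝ Z] {κ : Type*}

theorem IsSmooth.diff {u : ι → κ → E3 → X} (hu : P.IsSmooth u) (i : ι) (k : κ) {x : E3}
    (hx : x ∈ (P.chart i).target) : DifferentiableAt ℝ (u i k) x :=
  differentiableAt_of_contDiffOn (P.chart i).open_target (hu i k) hx

theorem IsSmooth.add {u v : ι → κ → E3 → X} (hu : P.IsSmooth u) (hv : P.IsSmooth v) :
    P.IsSmooth fun i => u i + v i := fun i k => (hu i k).add (hv i k)

theorem IsSmooth.sub {u v : ι → κ → E3 → X} (hu : P.IsSmooth u) (hv : P.IsSmooth v) :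
    P.IsSmooth fun i => u i - v i := fun i k => (hu i k).sub (hv i k)

theorem IsSmooth.smul {u : ι → κ → E3 → X} (c : ℝ) (hu : P.IsSmooth u) :
    P.IsSmooth fun i => c • u i := fun i k => (hu i k).const_smul c

theorem IsSmooth.map {u : ι → κ → E3 → X} (hu : P.IsSmooth u) (f : X →L[ℝ] Y) :
    P.IsSmooth fun i k x => f (u i k x) := fun i k => f.contDiff.comp_contDiffOn (hu i k)

theorem IsSmooth.w11 {m : X → Y → Z} (hm : IsBil m) {u : ι → F1 X} {v : ι → F1 Y}
    (hu : P.IsSmooth u) (hv : P.IsSmooth v) : P.IsSmooth fun i => w11 m (u i) (v i) := fun i _ =>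
  (hm.contDiffOn (hu i _) (hv i _)).sub (hm.contDiffOn (hu i _) (hv i _))

theorem IsSmooth.dA1 {r : so31 → X → X} (hr : IsBil r) {A : ι → F1 so31} {u : ι → F1 X}
    (hA : P.IsSmooth A) (hu : P.IsSmooth u) : P.IsSmooth fun i => dA1 r (A i) (u i) := fun i k =>
  ((contDiffOn_pd (P.chart i).open_target (hu i _) _).sub
    (contDiffOn_pd (P.chart i).open_target (hu i _) _)).add (IsSmooth.w11 hr hA hu i k)

theorem IsSmooth.w12 {m : X → Y → Z} (hm : IsBil m) {u : ι → Fin 3 → E3 → X}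
    {v : ι → Fin 3 → E3 → Y} (hu : P.IsSmooth u) (hv : P.IsSmooth v) :
    P.IsSmooth fun i (_ : Unit) => w12 m (u i) (v i) := fun i _ =>
  ContDiffOn.sum fun k _ => hm.contDiffOn (hu i k) (hv i k)

theorem IsSmooth.w30 {m : X → Y → Z} (hm : IsBil m) {u : ι → F3 X} {v : ι → F0 Y}
    (hu : P.IsSmooth fun i (_ : Unit) => u i) (hv : P.IsSmooth fun i (_ : Unit) => v i) :
    P.IsSmooth fun i (_ : Unit) => w30 m (u i) (v i) := fun i _ =>
  hm.contDiffOn (hu i ()) (hv i ())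

theorem IsSmooth.dA2 {r : so31 → X → X} (hr : IsBil r) {A : ι → F1 so31} {u : ι → F2 X}
    (hA : P.IsSmooth A) (hu : P.IsSmooth u) :
    P.IsSmooth fun i (_ : Unit) => dA2 r (A i) (u i) := fun i _ =>
  (ContDiffOn.sum fun k _ => contDiffOn_pd (P.chart i).open_target (hu i k) k).add
    (IsSmooth.w12 hr hA hu i ())

theorem IsSmooth.continuousOn {w : ι → F3 ℝ} (hw : P.IsSmooth fun i (_ : Unit) => w i) (i : ι) :
    ContinuousOn (w i) (P.chart i).target := (hw i ()).continuousOn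

/-- A functional whose integrand is quadratic along a line, with linear term `w₁`, has first
variation `∫ w₁`. -/
theorem hasDerivAt_integral [CompactSpace N] [IsManifold (𝓡 3) ∞ N] {W : ℝ → ι → F3 ℝ}
    {w₀ w₁ w₂ : ι → F3 ℝ} (h₀ : P.IsSmooth fun i (_ : Unit) => w₀ i)
    (h₁ : P.IsSmooth fun i (_ : Unit) => w₁ i) (h₂ : P.IsSmooth fun i (_ : Unit) => w₂ i)
    (h : ∀ t i, ∀ x ∈ (P.chart i).target, W t i x = w₀ i x + t * w₁ i x + t ^ 2 * w₂ i x) :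
    HasDerivAt (fun t => P.integral (W t)) (P.integral w₁) 0 := by
  have h1 (t : ℝ) : P.integral (W t) =
      P.integral w₀ + t * P.integral w₁ + t ^ 2 * P.integral w₂ := by
    have c₁ : ∀ i, ContinuousOn (fun x => t * w₁ i x) (P.chart i).target :=
      fun i => continuousOn_const.mul (h₁.continuousOn i)
    have c₂ : ∀ i, ContinuousOn (fun x => t ^ 2 * w₂ i x) (P.chart i).target :=
      fun i => continuousOn_const.mul (h₂.continuousOn i)
    rw [← P.integral_const_mul, ← P.integral_const_mul,
      ← P.integral_add (fun i => h₀.continuousOn i) c₁,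
      ← P.integral_add (w := fun i x => w₀ i x + t * w₁ i x)
        (fun i => (h₀.continuousOn i).add (c₁ i)) c₂]
    exact P.integral_congr (h t)
  simp only [h1]
  have h2 := (((hasDerivAt_id (0 : ℝ)).mul_const (P.integral w₁)).const_add
    (P.integral w₀)).fun_add (((hasDerivAt_id (0 : ℝ)).fun_pow 2).mul_const (P.integral w₂))
  simpa using h2

end Smooth

end Bundle

/-! ### Algebra of the invariant pairings -/

theorem kil_wedgeV_left (X : so31) (v w : V) : kil (wedgeV v w) X = -eta (act X v) w := by
  rw [kil_comm, kil_wedgeV]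

theorem eta_act_swap (X : so31) (v w : V) : eta (act X v) w = -eta (act X w) v := by
  rw [eta_act, eta_comm]

theorem eta_act_right (X : so31) (v w : V) : eta v (act X w) = -eta (act X v) w := by
  rw [eta_act, neg_neg]

theorem kil_lieB_swap (X Y Z : so31) : kil (lieB X Y) Z = -kil (lieB Y X) Z := by
  rw [lieB_skew, isBil_kil.neg_left]

theorem kil_lieB_cycle (X Y Z : so31) : kil (lieB X Y) Z = kil (lieB Y Z) X := by
  rw [kil_lieB, kil_comm]

theorem kil_lieB_right (X Y Z : so31) : kil X (lieB Y Z) = kil (lieB X Y) Z := by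
  rw [kil_lieB]

theorem eta_act_act (X Y : so31) (v w : V) :
    eta (act X (act Y v)) w = eta (act Y (act X w)) v := by
  rw [eta_act, eta_act, neg_neg, eta_comm]

/-! ### Expansion of the differential operations along a line -/

section Line

variable {X Y Z : Type*} [NormedAddCommGroup X] [NormedSpace ℝ X] [NormedAddCommGroup Y]
  [NormedSpace ℝ Y] [NormedAddCommGroup Z] [NormedSpace ℝ Z] {m : X → Y → Z}
  {r : so31 → X → X} {x : E3}

theorem w11_line (hm : IsBil m) (a a' : F1 X) (b b' : F1 Y) (t : ℝ) (k : Fin 3) :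
    w11 m (a + t • a') (b + t • b') k x =
      w11 m a b k x + t • (w11 m a b' k x + w11 m a' b k x) + t ^ 2 • w11 m a' b' k x := by
  simp only [w11, Pi.add_apply, Pi.smul_apply, hm.add_left, hm.add_right, hm.smul_left,
    hm.smul_right]
  module

theorem w12_line (hm : IsBil m) (a a' : Fin 3 → E3 → X) (b b' : Fin 3 → E3 → Y) (t : ℝ) :
    w12 m (a + t • a') (b + t • b') x =
      w12 m a b x + t • (w12 m a b' x + w12 m a' b x) + t ^ 2 • w12 m a' b' x := by
  simp only [w12, Pi.add_apply, Pi.smul_apply, hm.add_left, hm.add_right, hm.smul_left,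
    hm.smul_right, Fin.sum_univ_three]
  module

theorem pd_line {u u' : E3 → X} (hu : DifferentiableAt ℝ u x) (hu' : DifferentiableAt ℝ u' x)
    (t : ℝ) (k : Fin 3) : pd k (u + t • u') x = pd k u x + t • pd k u' x := by
  rw [← pd_const_smul t hu']
  exact pd_add hu (hu'.const_smul t) k

theorem dA1_line (hr : IsBil r) (A A' : F1 so31) {u u' : F1 X}
    (hu : ∀ k, DifferentiableAt ℝ (u k) x) (hu' : ∀ k, DifferentiableAt ℝ (u' k) x) (t : ℝ)
    (k : Fin 3) : dA1 r (A + t • A') (u + t • u') k x =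
      dA1 r A u k x + t • (dA1 r A u' k x + w11 r A' u k x) + t ^ 2 • w11 r A' u' k x := by
  have hp (l b) : pd l ((u + t • u') b) x = pd l (u b) x + t • pd l (u' b) x :=
    pd_line (hu b) (hu' b) t l
  simp only [dA1, hp, w11_line hr]
  module

theorem dA2_line (hr : IsBil r) (A A' : F1 so31) {u u' : F2 X}
    (hu : ∀ k, DifferentiableAt ℝ (u k) x) (hu' : ∀ k, DifferentiableAt ℝ (u' k) x) (t : ℝ) :
    dA2 r (A + t • A') (u + t • u') x =
      dA2 r A u x + t • (dA2 r A u' x + w12 r A' u x) + t ^ 2 • w12 r A' u' x := by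
  have hp (l b) : pd l ((u + t • u') b) x = pd l (u b) x + t • pd l (u' b) x :=
    pd_line (hu b) (hu' b) t l
  simp only [dA2, hp, w12_line hr, Finset.sum_add_distrib, ← Finset.smul_sum]
  module

theorem curv_line {A A' : F1 so31} (hA : ∀ k, DifferentiableAt ℝ (A k) x)
    (hA' : ∀ k, DifferentiableAt ℝ (A' k) x) (t : ℝ) (k : Fin 3) :
    curv (A + t • A') k x =
      curv A k x + t • dA1 lieB A A' k x + t ^ 2 • ((1 / 2 : ℝ) • w11 lieB A' A' k x) := by
  have hp (l b) : pd l ((A + t • A') b) x = pd l (A b) x + t • pd l (A' b) x :=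
    pd_line (hA b) (hA' b) t l
  have hs : w11 lieB A' A k x = w11 lieB A A' k x := by
    simp only [w11]
    rw [lieB_skew (A' (k + 1) x), lieB_skew (A' (k + 2) x)]
    abel
  simp only [curv, hp, w11_line isBil_lieB, dA1, hs]
  module

end Line

namespace Bundle

variable {ι : Type*} [Fintype ι] {N : Type*} [TopologicalSpace N] [ChartedSpace E3 N]
  {P : Bundle ι N}

/-! ### First variations of the constraints -/

/-- Configurations with smooth components. -/
structure SmoothConfig (P : Bundle ι N) (Φ : Config ι) : Prop where
  A : P.IsSmooth Φ.A
  e : P.IsSmooth Φ.e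
  S : P.IsSmooth Φ.S
  B : P.IsSmooth Φ.B
  τ : P.IsSmooth Φ.τ
  c : P.IsSmooth Φ.c

theorem smoothConfig_of_mem_phaseSpace {Φ : Config ι} (h : Φ ∈ P.phaseSpace) :
    P.SmoothConfig Φ :=
  ⟨h.1.smooth, h.2.1.smooth, h.2.2.1.smooth, h.2.2.2.1.smooth, h.2.2.2.2.1.smooth,
    h.2.2.2.2.2.smooth⟩

theorem smoothConfig_of_mem_tangentSpace {Y : Config ι} (h : Y ∈ P.tangentSpace) :
    P.SmoothConfig Y :=
  ⟨h.1.smooth, h.2.1.smooth, h.2.2.1.smooth, h.2.2.2.1.smooth, h.2.2.2.2.1.smooth,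
    h.2.2.2.2.2.smooth⟩

section Variations

variable (β : ℝ) (T : so31 ≃ₗ⁅ℝ, so31⁆ so31)

/-- The integrand of the first variation of `H_θ` at `Φ` in the direction `Y`. -/
def varH (θ : ι → F0 so31) (Φ Y : Config ι) (i : ι) : F3 ℝ := w30 kil
  ((dA2 lieB (Φ.A i) (Y.B i) + w12 lieB (Y.A i) (Φ.B i)) -
    (w12 wedgeV (Φ.e i) (Y.τ i) + w12 wedgeV (Y.e i) (Φ.τ i)) -
    (w12 lieB (Φ.c i) (Y.S i) + w12 lieB (Y.c i) (Φ.S i))) (θ i)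

/-- The integrand of the first variation of `I_ε` at `Φ` in the direction `Y`. -/
def varI (ε : ι → F0 V) (Φ Y : Config ι) (i : ι) : F3 ℝ :=
  w30 eta (dA2 act (Φ.A i) (Y.τ i) + w12 act (Y.A i) (Φ.τ i)) (ε i) +
    (w12 kil (Φ.c i) (w10 wedgeV (Y.e i) (ε i)) + w12 kil (Y.c i) (w10 wedgeV (Φ.e i) (ε i)))

/-- The integrand of the first variation of `K_α` at `Φ` in the direction `Y`. -/
def varK (α : ι → F1 so31) (Φ Y : Config ι) (i : ι) : F3 ℝ := w12 kil
  ((fun k x => idAdd β T (Y.B i k x)) + (dA1 lieB (Φ.A i) (Y.S i) + w11 lieB (Y.A i) (Φ.S i)) -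
    w11 wedgeV (Φ.e i) (Y.e i)) (α i)

/-- The integrand of the first variation of `L_ρ` at `Φ` in the direction `Y`. -/
def varL (ρ : ι → F1 V) (Φ Y : Config ι) (i : ι) : F3 ℝ := w12 eta
  ((dA1 act (Φ.A i) (Y.e i) + w11 act (Y.A i) (Φ.e i)) + (1 + β) • Y.τ i) (ρ i)

/-- The integrand of the first variation of `M_ζ` at `Φ` in the direction `Y`. -/
def varM (ζ : ι → F1 so31) (Φ Y : Config ι) (i : ι) : F3 ℝ := w12 kil
  (dA1 lieB (Φ.A i) (Y.A i) + fun k x => idAdd β T (Y.c i k x)) (ζ i)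

theorem isSmooth_idAdd {κ : Type*} {u : ι → κ → E3 → so31} (hu : P.IsSmooth u) :
    P.IsSmooth fun i k x => idAdd β T (u i k x) := hu.map (idAddCLM β T)

theorem IsSmooth.add_form3 {X : Type*} [NormedAddCommGroup X] [NormedSpace ℝ X] {u v : ι → F3 X}
    (hu : P.IsSmooth fun i (_ : Unit) => u i) (hv : P.IsSmooth fun i (_ : Unit) => v i) :
    P.IsSmooth fun i (_ : Unit) => u i + v i := hu.add hv

theorem IsSmooth.sub_form3 {X : Type*} [NormedAddCommGroup X] [NormedSpace ℝ X] {u v : ι → F3 X}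
    (hu : P.IsSmooth fun i (_ : Unit) => u i) (hv : P.IsSmooth fun i (_ : Unit) => v i) :
    P.IsSmooth fun i (_ : Unit) => u i - v i := hu.sub hv

variable [CompactSpace N] [IsManifold (𝓡 3) ∞ N] {Φ Y : Config ι}

theorem hasDerivAt_H {θ : ι → F0 so31} (hθ : P.IsForm0 Ad θ) (hΦ : P.SmoothConfig Φ)
    (hY : P.SmoothConfig Y) :
    HasDerivAt (fun t => P.H θ (Φ.line Y t)) (P.integral (varH θ Φ Y)) 0 := by
  have hθ' : P.IsSmooth fun i (_ : Unit) => θ i := hθ.tensor.smooth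
  refine hasDerivAt_integral (w₂ := fun i => w30 kil (w12 lieB (Y.A i) (Y.B i) -
      w12 wedgeV (Y.e i) (Y.τ i) - w12 lieB (Y.c i) (Y.S i)) (θ i))
    (.w30 isBil_kil (((IsSmooth.dA2 isBil_lieB hΦ.A hΦ.B).sub_form3 (.w12 isBil_wedgeV
      hΦ.e hΦ.τ)).sub_form3
      (.w12 isBil_lieB hΦ.c hΦ.S)) hθ')
    (.w30 isBil_kil ((((IsSmooth.dA2 isBil_lieB hΦ.A hY.B).add_form3 (.w12 isBil_lieB
      hY.A hΦ.B)).sub_form3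
      ((IsSmooth.w12 isBil_wedgeV hΦ.e hY.τ).add_form3 (.w12 isBil_wedgeV hY.e hΦ.τ))).sub_form3
      ((IsSmooth.w12 isBil_lieB hΦ.c hY.S).add_form3 (.w12 isBil_lieB hY.c hΦ.S))) hθ')
    (.w30 isBil_kil (((IsSmooth.w12 isBil_lieB hY.A hY.B).sub_form3 (.w12 isBil_wedgeV
      hY.e hY.τ)).sub_form3
      (.w12 isBil_lieB hY.c hY.S)) hθ') fun t i x hx => ?_
  simp only [varH, Config.line, Pi.add_apply, Pi.smul_apply, w30, Pi.sub_apply,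
    dA2_line isBil_lieB _ _ (fun k => hΦ.B.diff i k hx) (fun k => hY.B.diff i k hx),
    w12_line isBil_wedgeV, w12_line isBil_lieB, isBil_kil.add_left, isBil_kil.sub_left,
    isBil_kil.smul_left, smul_eq_mul]
  ring

theorem hasDerivAt_I {ε : ι → F0 V} (hε : P.IsForm0 actV ε) (hΦ : P.SmoothConfig Φ)
    (hY : P.SmoothConfig Y) :
    HasDerivAt (fun t => P.I ε (Φ.line Y t)) (P.integral (varI ε Φ Y)) 0 := by
  have hε' : P.IsSmooth fun i (_ : Unit) => ε i := hε.tensor.smooth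
  have hw {u : ι → F1 V} (hu : P.IsSmooth u) : P.IsSmooth fun i => w10 wedgeV (u i) (ε i) :=
    fun i k => isBil_wedgeV.contDiffOn (hu i k) (hε' i ())
  refine hasDerivAt_integral (w₂ := fun i => w30 eta (w12 act (Y.A i) (Y.τ i)) (ε i) +
      w12 kil (Y.c i) (w10 wedgeV (Y.e i) (ε i)))
    ((IsSmooth.w30 isBil_eta (.dA2 isBil_act hΦ.A hΦ.τ) hε').add_form3
      (.w12 isBil_kil hΦ.c (hw hΦ.e)))
    ((IsSmooth.w30 isBil_eta ((IsSmooth.dA2 isBil_act hΦ.A hY.τ).add_form3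
      (.w12 isBil_act hY.A hΦ.τ)) hε').add_form3 ((IsSmooth.w12 isBil_kil hΦ.c (hw hY.e)).add_form3
      (.w12 isBil_kil hY.c (hw hΦ.e))))
    ((IsSmooth.w30 isBil_eta (.w12 isBil_act hY.A hY.τ) hε').add_form3
      (.w12 isBil_kil hY.c (hw hY.e)))
    fun t i x hx => ?_
  have h1 : w10 wedgeV (Φ.e i + t • Y.e i) (ε i) =
      w10 wedgeV (Φ.e i) (ε i) + t • w10 wedgeV (Y.e i) (ε i) := by
    funext k y
    simp only [w10, Pi.add_apply, Pi.smul_apply, isBil_wedgeV.add_left, isBil_wedgeV.smul_left]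
  simp only [varI, Config.line, Pi.add_apply, Pi.smul_apply, w30, h1,
    dA2_line isBil_act _ _ (fun k => hΦ.τ.diff i k hx) (fun k => hY.τ.diff i k hx),
    w12_line isBil_kil, isBil_eta.add_left, isBil_eta.smul_left, smul_eq_mul]
  ring

theorem hasDerivAt_K {α : ι → F1 so31} (hα : P.IsForm1 Ad α) (hΦ : P.SmoothConfig Φ)
    (hY : P.SmoothConfig Y) :
    HasDerivAt (fun t => P.K β T α (Φ.line Y t)) (P.integral (varK β T α Φ Y)) 0 := by
  refine hasDerivAt_integral (w₂ := fun i => w12 kil (w11 lieB (Y.A i) (Y.S i) -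
      (1 / 2 : ℝ) • w11 wedgeV (Y.e i) (Y.e i)) (α i))
    (.w12 isBil_kil (((isSmooth_idAdd β T hΦ.B).add (.dA1 isBil_lieB hΦ.A hΦ.S)).sub
      (.smul (1 / 2 : ℝ) (.w11 isBil_wedgeV hΦ.e hΦ.e))) hα.smooth)
    (.w12 isBil_kil (((isSmooth_idAdd β T hY.B).add ((IsSmooth.dA1 isBil_lieB hΦ.A hY.S).add
      (.w11 isBil_lieB hY.A hΦ.S))).sub (.w11 isBil_wedgeV hΦ.e hY.e)) hα.smooth)
    (.w12 isBil_kil ((IsSmooth.w11 isBil_lieB hY.A hY.S).sub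
      (.smul (1 / 2 : ℝ) (.w11 isBil_wedgeV hY.e hY.e))) hα.smooth) fun t i x hx => ?_
  have hs (k) : w11 wedgeV (Y.e i) (Φ.e i) k x = w11 wedgeV (Φ.e i) (Y.e i) k x := by
    simp only [w11]
    rw [wedgeV_skew (Y.e i (k + 1) x), wedgeV_skew (Y.e i (k + 2) x)]
    abel
  simp only [varK, w12, Config.line, Pi.add_apply, Pi.smul_apply, Pi.sub_apply, idAdd_add,
    idAdd_smul,
    dA1_line isBil_lieB _ _ (fun k => hΦ.S.diff i k hx) (fun k => hY.S.diff i k hx),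
    w11_line isBil_wedgeV, hs, isBil_kil.add_left, isBil_kil.sub_left, isBil_kil.smul_left,
    smul_eq_mul, Fin.sum_univ_three]
  ring

theorem hasDerivAt_L {ρ : ι → F1 V} (hρ : P.IsForm1 actV ρ) (hΦ : P.SmoothConfig Φ)
    (hY : P.SmoothConfig Y) :
    HasDerivAt (fun t => P.L β ρ (Φ.line Y t)) (P.integral (varL β ρ Φ Y)) 0 := by
  refine hasDerivAt_integral (w₂ := fun i => w12 eta (w11 act (Y.A i) (Y.e i)) (ρ i))
    (.w12 isBil_eta ((IsSmooth.dA1 isBil_act hΦ.A hΦ.e).add (.smul (1 + β) hΦ.τ)) hρ.smooth)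
    (.w12 isBil_eta (((IsSmooth.dA1 isBil_act hΦ.A hY.e).add
      (.w11 isBil_act hY.A hΦ.e)).add (.smul (1 + β) hY.τ)) hρ.smooth)
    (.w12 isBil_eta (IsSmooth.w11 isBil_act hY.A hY.e) hρ.smooth) fun t i x hx => ?_
  simp only [varL, w12, Config.line, Pi.add_apply, Pi.smul_apply,
    dA1_line isBil_act _ _ (fun k => hΦ.e.diff i k hx) (fun k => hY.e.diff i k hx),
    isBil_eta.add_left, isBil_eta.smul_left, smul_eq_mul, Fin.sum_univ_three]
  ring

theorem hasDerivAt_M {ζ : ι → F1 so31} (hζ : P.IsForm1 Ad ζ) (hΦ : P.SmoothConfig Φ)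
    (hY : P.SmoothConfig Y) :
    HasDerivAt (fun t => P.M β T ζ (Φ.line Y t)) (P.integral (varM β T ζ Φ Y)) 0 := by
  have hcurv : P.IsSmooth fun i => curv (Φ.A i) := fun i k =>
    ((contDiffOn_pd (P.chart i).open_target (hΦ.A i _) _).sub
      (contDiffOn_pd (P.chart i).open_target (hΦ.A i _) _)).add
      (IsSmooth.smul (1 / 2 : ℝ) (IsSmooth.w11 isBil_lieB hΦ.A hΦ.A) i k)
  refine hasDerivAt_integral (w₂ := fun i => w12 kil
      ((1 / 2 : ℝ) • w11 lieB (Y.A i) (Y.A i)) (ζ i))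
    (.w12 isBil_kil (hcurv.add (isSmooth_idAdd β T hΦ.c)) hζ.smooth)
    (.w12 isBil_kil ((IsSmooth.dA1 isBil_lieB hΦ.A hY.A).add (isSmooth_idAdd β T hY.c)) hζ.smooth)
    (.w12 isBil_kil (.smul (1 / 2 : ℝ) (IsSmooth.w11 isBil_lieB hY.A hY.A)) hζ.smooth)
    fun t i x hx => ?_
  simp only [varM, w12, Config.line, Pi.add_apply, Pi.smul_apply, idAdd_add, idAdd_smul,
    curv_line (fun k => hΦ.A.diff i k hx) (fun k => hY.A.diff i k hx),
    isBil_kil.add_left, isBil_kil.smul_left, smul_eq_mul, Fin.sum_univ_three]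
  ring

end Variations

end Bundle

namespace Bundle

variable {ι : Type*} [Fintype ι] {N : Type*} [TopologicalSpace N] [ChartedSpace E3 N]

/-! ### Hamiltonian vector fields of the constraints -/

section Vectors

variable (P : Bundle ι N) (β : ℝ) (T : so31 ≃ₗ⁅ℝ, so31⁆ so31)

/-- The Hamiltonian vector field of `H_θ`: the infinitesimal gauge transformation by `θ`. -/
def vecH (θ : ι → F0 so31) (Φ : Config ι) : Config ι where
  A := P.cut fun i k x => -dA0 lieB (Φ.A i) (θ i) k x
  e := P.cut fun i => w01 act (θ i) (Φ.e i)
  S := P.cut fun i => w01 lieB (θ i) (Φ.S i)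
  B := P.cut fun i => w01 lieB (θ i) (Φ.B i)
  τ := P.cut fun i => w01 act (θ i) (Φ.τ i)
  c := P.cut fun i => w01 lieB (θ i) (Φ.c i)

/-- The Hamiltonian vector field of `I_ε`. -/
def vecI (ε : ι → F0 V) (Φ : Config ι) : Config ι where
  A := 0
  e := P.cut fun i k x => -dA0 act (Φ.A i) (ε i) k x
  S := P.cut fun i => w10 wedgeV (Φ.e i) (ε i)
  B := P.cut fun i => w10 wedgeV (Φ.τ i) (ε i)
  τ := P.cut fun i k x => -w10 act (Φ.c i) (ε i) k x
  c := 0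

/-- The Hamiltonian vector field of `K_α`. -/
def vecK (α : ι → F1 so31) (Φ : Config ι) : Config ι where
  A := P.cut fun i k x => idAdd β T (α i k x)
  e := 0
  S := 0
  B := P.cut fun i k x => -w11 lieB (Φ.S i) (α i) k x
  τ := P.cut fun i k x => -w11 act (α i) (Φ.e i) k x
  c := P.cut fun i k x => -dA1 lieB (Φ.A i) (α i) k x

/-- The Hamiltonian vector field of `L_ρ`. -/
def vecL (ρ : ι → F1 V) (Φ : Config ι) : Config ι where
  A := 0
  e := P.cut fun i k x => (1 + β) • ρ i k x
  S := 0
  B := P.cut fun i => w11 wedgeV (Φ.e i) (ρ i)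
  τ := P.cut fun i k x => -dA1 act (Φ.A i) (ρ i) k x
  c := 0

/-- The Hamiltonian vector field of `M_ζ`. -/
def vecM (ζ : ι → F1 so31) (Φ : Config ι) : Config ι where
  A := 0
  e := 0
  S := P.cut fun i k x => idAdd β T (ζ i k x)
  B := P.cut fun i k x => -dA1 lieB (Φ.A i) (ζ i) k x
  τ := 0
  c := 0

end Vectors

variable {P : Bundle ι N} {β : ℝ} {T : so31 ≃ₗ⁅ℝ, so31⁆ so31}

section Tangent

variable {X : Type*} [NormedAddCommGroup X] [NormedSpace ℝ X] {r : SO31 → X → X}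
  {r' : so31 → X → X}

theorem isForm1_zero (hr : IsRep r r') : P.IsForm1 r 0 where
  smooth _ _ := contDiffOn_const
  supp _ _ _ _ := rfl
  compat i j k x hx := by
    obtain ⟨f, hf⟩ := hr.lin (P.gc j i x)
    simp [hf]

theorem isForm2_zero (hr : IsRep r r') : P.IsForm2 r 0 where
  smooth _ _ := contDiffOn_const
  supp _ _ _ _ := rfl
  compat i j k x hx := by
    obtain ⟨f, hf⟩ := hr.lin (P.gc j i x)
    simp [hf]

theorem IsTensor.idAdd {κ : Type*} [Fintype κ] {C : ι → ι → E3 → κ → κ → ℝ}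
    {u : ι → κ → E3 → so31} (hu : P.IsTensor C Ad u) (β : ℝ) (T : so31 ≃ₗ⁅ℝ, so31⁆ so31) :
    P.IsTensor C Ad fun i k x => idAdd β T (u i k x) :=
  hu.map (idAddCLM β T) (idAddCLM_apply β T) (Ad_idAdd β T)

variable [IsManifold (𝓡 3) ∞ N] {Φ : Config ι}

theorem vecH_mem {θ : ι → F0 so31} (hθ : P.IsForm0 Ad θ) (hΦ : Φ ∈ P.phaseSpace) :
    P.vecH θ Φ ∈ P.tangentSpace := by
  obtain ⟨hA, he, hS, hB, hτ, hc⟩ := hΦ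
  exact ⟨((hθ.tensor.dA0 hA.conn isRep_Ad).neg isRep_Ad).isForm1,
    (hθ.tensor.w01 isInv_act he.tensor).isForm1, (hθ.tensor.w01 isInv_lieB hS.tensor).isForm1,
    (hθ.tensor.w01 isInv_lieB hB.tensor).isForm2, (hθ.tensor.w01 isInv_act hτ.tensor).isForm2,
    (hθ.tensor.w01 isInv_lieB hc.tensor).isForm2⟩

theorem vecI_mem {ε : ι → F0 V} (hε : P.IsForm0 actV ε) (hΦ : Φ ∈ P.phaseSpace) :
    P.vecI ε Φ ∈ P.tangentSpace := by
  obtain ⟨hA, he, hS, hB, hτ, hc⟩ := hΦ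
  exact ⟨isForm1_zero isRep_Ad, ((hε.tensor.dA0 hA.conn isRep_actV).neg isRep_actV).isForm1,
    (he.tensor.w10 isInv_wedgeV hε.tensor).isForm1, (hτ.tensor.w10 isInv_wedgeV hε.tensor).isForm2,
    ((hc.tensor.w10 isInv_act hε.tensor).neg isRep_actV).isForm2, isForm2_zero isRep_Ad⟩

theorem vecK_mem {α : ι → F1 so31} (hα : P.IsForm1 Ad α) (hΦ : Φ ∈ P.phaseSpace) :
    P.vecK β T α Φ ∈ P.tangentSpace := by
  obtain ⟨hA, he, hS, hB, hτ, hc⟩ := hΦ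
  exact ⟨(hα.tensor.idAdd β T).isForm1, isForm1_zero isRep_actV, isForm1_zero isRep_Ad,
    ((hS.tensor.w11 isInv_lieB isRep_Ad hα.tensor).neg isRep_Ad).isForm2,
    ((hα.tensor.w11 isInv_act isRep_actV he.tensor).neg isRep_actV).isForm2,
    ((hα.tensor.dA1 hA.conn isRep_Ad).neg isRep_Ad).isForm2⟩

theorem vecL_mem {ρ : ι → F1 V} (hρ : P.IsForm1 actV ρ) (hΦ : Φ ∈ P.phaseSpace) :
    P.vecL β ρ Φ ∈ P.tangentSpace := by
  obtain ⟨hA, he, hS, hB, hτ, hc⟩ := hΦ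
  exact ⟨isForm1_zero isRep_Ad, (hρ.tensor.const_smul isRep_actV (1 + β)).isForm1,
    isForm1_zero isRep_Ad, (he.tensor.w11 isInv_wedgeV isRep_Ad hρ.tensor).isForm2,
    ((hρ.tensor.dA1 hA.conn isRep_actV).neg isRep_actV).isForm2, isForm2_zero isRep_Ad⟩

theorem vecM_mem {ζ : ι → F1 so31} (hζ : P.IsForm1 Ad ζ) (hΦ : Φ ∈ P.phaseSpace) :
    P.vecM β T ζ Φ ∈ P.tangentSpace :=
  ⟨isForm1_zero isRep_Ad, isForm1_zero isRep_actV, (hζ.tensor.idAdd β T).isForm1,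
    ((hζ.tensor.dA1 hΦ.1.conn isRep_Ad).neg isRep_Ad).isForm2, isForm2_zero isRep_actV,
    isForm2_zero isRep_Ad⟩

end Tangent

/-- The integrand of the symplectic form. -/
def sympForm (X Y : Config ι) (i : ι) (x : E3) : ℝ :=
  (w12 kil (X.B i) (Y.A i) x - w12 kil (Y.B i) (X.A i) x) +
    (w12 eta (X.τ i) (Y.e i) x - w12 eta (Y.τ i) (X.e i) x) +
    (w12 kil (X.c i) (Y.S i) x - w12 kil (Y.c i) (X.S i) x)

theorem symp_eq (X Y : Config ι) : P.symp X Y = P.integral (sympForm X Y) := rfl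

theorem isSmooth_sympForm {X Y : Config ι} (hX : P.SmoothConfig X) (hY : P.SmoothConfig Y) :
    P.IsSmooth fun i (_ : Unit) => sympForm X Y i :=
  (((IsSmooth.w12 isBil_kil hX.B hY.A).sub (.w12 isBil_kil hY.B hX.A)).add
    ((IsSmooth.w12 isBil_eta hX.τ hY.e).sub (.w12 isBil_eta hY.τ hX.e))).add
    ((IsSmooth.w12 isBil_kil hX.c hY.S).sub (.w12 isBil_kil hY.c hX.S))

section Hamiltonian

variable [CompactSpace N] [IsManifold (𝓡 3) ∞ N] {Φ : Config ι}

/-- A functional has Hamiltonian vector `X` if its first variation is `-ϖ(X, ·)` up to exact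
terms. -/
theorem isHamiltonianAt_of_variation {f : Config ι → ℝ} {X : Config ι} (hX : X ∈ P.tangentSpace)
    (v d : Config ι → ι → F3 ℝ)
    (hf : ∀ Y ∈ P.tangentSpace, HasDerivAt (fun t => f (Φ.line Y t)) (P.integral (v Y)) 0)
    (hd : ∀ Y ∈ P.tangentSpace, P.IsSmooth fun i (_ : Unit) => d Y i)
    (hd₀ : ∀ Y ∈ P.tangentSpace, P.integral (d Y) = 0)
    (h : ∀ Y ∈ P.tangentSpace, ∀ i, ∀ x ∈ (P.chart i).target,
      v Y i x = -sympForm X Y i x + d Y i x) : P.IsHamiltonianAt f Φ X := by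
  refine ⟨hX, fun Y hY => ?_⟩
  have hs := isSmooth_sympForm (smoothConfig_of_mem_tangentSpace hX)
    (smoothConfig_of_mem_tangentSpace hY)
  have h1 : P.integral (v Y) = -P.symp X Y := by
    rw [P.integral_congr (h Y hY), P.integral_add (w := fun i x => -sympForm X Y i x)
      (fun i => (hs.continuousOn i).neg) (hd Y hY).continuousOn, hd₀ Y hY, add_zero,
      P.integral_neg, symp_eq]
  exact h1 ▸ hf Y hY

theorem isHamiltonianAt_H {θ : ι → F0 so31} (hθ : P.IsForm0 Ad θ) (hΦ : Φ ∈ P.phaseSpace) :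
    P.IsHamiltonianAt (P.H θ) Φ (P.vecH θ Φ) := by
  have hs := smoothConfig_of_mem_phaseSpace hΦ
  refine isHamiltonianAt_of_variation (vecH_mem hθ hΦ) (varH θ Φ)
    (fun Y i x => w30 kil (dA2 lieB (Φ.A i) (Y.B i)) (θ i) x +
      w12 kil (Y.B i) (dA0 lieB (Φ.A i) (θ i)) x)
    (fun Y hY => hasDerivAt_H hθ hs (smoothConfig_of_mem_tangentSpace hY)) (fun Y hY => ?_)
    (fun Y hY => integral_dA2_add Φ.A isInv_kil hY.2.2.2.1.tensor hθ.tensor)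
    fun Y hY i x hx => ?_
  · have hY' := smoothConfig_of_mem_tangentSpace hY
    exact (IsSmooth.w30 isBil_kil (.dA2 isBil_lieB hs.A hY'.B) hθ.tensor.smooth).add_form3
      (.w12 isBil_kil hY'.B (hθ.tensor.dA0 hΦ.1.conn isRep_Ad).smooth)
  · simp only [varH, sympForm, vecH, w12, w30, P.cut_apply _ hx, Pi.add_apply, Pi.sub_apply, w01]
    simp only [Fin.sum_univ_three, isBil_kil.add_left, isBil_kil.sub_left, isBil_kil.neg_right,
      kil_wedgeV_left, kil_lieB_right, eta_act_right]
    grind [eta_act_swap, kil_lieB_swap, kil_lieB_cycle, eta_comm]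

theorem isHamiltonianAt_I {ε : ι → F0 V} (hε : P.IsForm0 actV ε) (hΦ : Φ ∈ P.phaseSpace) :
    P.IsHamiltonianAt (P.I ε) Φ (P.vecI ε Φ) := by
  have hs := smoothConfig_of_mem_phaseSpace hΦ
  refine isHamiltonianAt_of_variation (vecI_mem hε hΦ) (varI ε Φ)
    (fun Y i x => w30 eta (dA2 act (Φ.A i) (Y.τ i)) (ε i) x +
      w12 eta (Y.τ i) (dA0 act (Φ.A i) (ε i)) x)
    (fun Y hY => hasDerivAt_I hε hs (smoothConfig_of_mem_tangentSpace hY)) (fun Y hY => ?_)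
    (fun Y hY => integral_dA2_add Φ.A isInv_eta hY.2.2.2.2.1.tensor hε.tensor)
    fun Y hY i x hx => ?_
  · have hY' := smoothConfig_of_mem_tangentSpace hY
    exact (IsSmooth.w30 isBil_eta (.dA2 isBil_act hs.A hY'.τ) hε.tensor.smooth).add_form3
      (.w12 isBil_eta hY'.τ (hε.tensor.dA0 hΦ.1.conn isRep_actV).smooth)
  · simp only [varI, sympForm, vecI, w12, w30, P.cut_apply _ hx, Pi.add_apply, Pi.zero_apply, w10,
      isBil_kil.zero_left, isBil_kil.zero_right]
    simp only [Fin.sum_univ_three, isBil_eta.add_left, isBil_eta.neg_right, isBil_eta.neg_left,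
      kil_wedgeV_left, kil_wedgeV]
    grind [eta_act_swap, eta_comm]

theorem isHamiltonianAt_K {α : ι → F1 so31} (hα : P.IsForm1 Ad α) (hΦ : Φ ∈ P.phaseSpace) :
    P.IsHamiltonianAt (P.K β T α) Φ (P.vecK β T α Φ) := by
  have hs := smoothConfig_of_mem_phaseSpace hΦ
  refine isHamiltonianAt_of_variation (vecK_mem hα hΦ) (varK β T α Φ)
    (fun Y i x => w12 kil (dA1 lieB (Φ.A i) (Y.S i)) (α i) x -
      w12 kil (Y.S i) (dA1 lieB (Φ.A i) (α i)) x)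
    (fun Y hY => hasDerivAt_K β T hα hs (smoothConfig_of_mem_tangentSpace hY)) (fun Y hY => ?_)
    (fun Y hY => integral_dA1_sub Φ.A isInv_kil hY.2.2.1.tensor hα.tensor)
    fun Y hY i x hx => ?_
  · have hY' := smoothConfig_of_mem_tangentSpace hY
    exact (IsSmooth.w12 isBil_kil (.dA1 isBil_lieB hs.A hY'.S) hα.smooth).sub_form3
      (.w12 isBil_kil hY'.S (.dA1 isBil_lieB hs.A hα.smooth))
  · obtain ⟨f1, f2, f3, f4, f5, f6⟩ := fin3_facts
    simp only [varK, sympForm, vecK, w12, w11, P.cut_apply _ hx, Pi.add_apply, Pi.sub_apply,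
      Pi.zero_apply, isBil_kil.zero_right, isBil_eta.zero_right]
    simp only [Fin.sum_univ_three, f1, f2, f3, f4, f5, f6, isBil_kil.add_left, isBil_kil.sub_left,
      isBil_kil.neg_left, isBil_eta.neg_left, isBil_eta.sub_left, kil_wedgeV_left, kil_idAdd]
    grind [eta_act_swap, kil_lieB_swap, kil_lieB_cycle, eta_comm, kil_comm]

theorem isHamiltonianAt_L {ρ : ι → F1 V} (hρ : P.IsForm1 actV ρ) (hΦ : Φ ∈ P.phaseSpace) :
    P.IsHamiltonianAt (P.L β ρ) Φ (P.vecL β ρ Φ) := by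
  have hs := smoothConfig_of_mem_phaseSpace hΦ
  refine isHamiltonianAt_of_variation (vecL_mem hρ hΦ) (varL β ρ Φ)
    (fun Y i x => w12 eta (dA1 act (Φ.A i) (Y.e i)) (ρ i) x -
      w12 eta (Y.e i) (dA1 act (Φ.A i) (ρ i)) x)
    (fun Y hY => hasDerivAt_L β hρ hs (smoothConfig_of_mem_tangentSpace hY)) (fun Y hY => ?_)
    (fun Y hY => integral_dA1_sub Φ.A isInv_eta hY.2.1.tensor hρ.tensor)
    fun Y hY i x hx => ?_
  · have hY' := smoothConfig_of_mem_tangentSpace hY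
    exact (IsSmooth.w12 isBil_eta (.dA1 isBil_act hs.A hY'.e) hρ.smooth).sub_form3
      (.w12 isBil_eta hY'.e (.dA1 isBil_act hs.A hρ.smooth))
  · obtain ⟨f1, f2, f3, f4, f5, f6⟩ := fin3_facts
    simp only [varL, sympForm, vecL, w12, w11, P.cut_apply _ hx, Pi.add_apply, Pi.smul_apply,
      Pi.zero_apply, isBil_kil.zero_left, isBil_kil.zero_right]
    simp only [Fin.sum_univ_three, f1, f2, f3, f4, f5, f6, isBil_eta.add_left, isBil_eta.sub_left,
      isBil_eta.neg_left, isBil_eta.smul_left, isBil_eta.smul_right, isBil_kil.sub_left,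
      kil_wedgeV_left, smul_eq_mul]
    grind [eta_act_swap, eta_comm]

theorem isHamiltonianAt_M {ζ : ι → F1 so31} (hζ : P.IsForm1 Ad ζ) (hΦ : Φ ∈ P.phaseSpace) :
    P.IsHamiltonianAt (P.M β T ζ) Φ (P.vecM β T ζ Φ) := by
  have hs := smoothConfig_of_mem_phaseSpace hΦ
  refine isHamiltonianAt_of_variation (vecM_mem hζ hΦ) (varM β T ζ Φ)
    (fun Y i x => w12 kil (dA1 lieB (Φ.A i) (Y.A i)) (ζ i) x -
      w12 kil (Y.A i) (dA1 lieB (Φ.A i) (ζ i)) x)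
    (fun Y hY => hasDerivAt_M β T hζ hs (smoothConfig_of_mem_tangentSpace hY)) (fun Y hY => ?_)
    (fun Y hY => integral_dA1_sub Φ.A isInv_kil hY.1.tensor hζ.tensor)
    fun Y hY i x hx => ?_
  · have hY' := smoothConfig_of_mem_tangentSpace hY
    exact (IsSmooth.w12 isBil_kil (.dA1 isBil_lieB hs.A hY'.A) hζ.smooth).sub_form3
      (.w12 isBil_kil hY'.A (.dA1 isBil_lieB hs.A hζ.smooth))
  · simp only [varM, sympForm, vecM, w12, P.cut_apply _ hx, Pi.add_apply, Pi.zero_apply,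
      isBil_kil.zero_left, isBil_kil.zero_right, isBil_eta.zero_left, isBil_eta.zero_right]
    simp only [Fin.sum_univ_three, isBil_kil.add_left, isBil_kil.neg_left, kil_idAdd]
    grind [kil_comm]

end Hamiltonian

end Bundle

namespace Bundle

variable {ι : Type*} [Fintype ι] {N : Type*} [TopologicalSpace N] [ChartedSpace E3 N]
  {P : Bundle ι N}

/-! ### Uniqueness of Hamiltonian vectors and the Poisson bracket -/

section

variable {κ : Type*} [Fintype κ] {C : ι → ι → E3 → κ → κ → ℝ} {X : Type*} [NormedAddCommGroup X]
  [NormedSpace ℝ X] {r : SO31 → X → X} {r' : so31 → X → X} {u v : ι → κ → E3 → X}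

theorem IsTensor.add (hr : IsRep r r') (hu : P.IsTensor C r u) (hv : P.IsTensor C r v) :
    P.IsTensor C r fun i k x => u i k x + v i k x where
  smooth i k := (hu.smooth i k).add (hv.smooth i k)
  compat i j k x hx := by
    obtain ⟨f, hf⟩ := hr.lin (P.gc j i x)
    simp only [hu.compat i j k x hx, hv.compat i j k x hx, hf, map_add, smul_add,
      Finset.sum_add_distrib]

theorem IsTensor.sub (hr : IsRep r r') (hu : P.IsTensor C r u) (hv : P.IsTensor C r v) :
    P.IsTensor C r fun i k x => u i k x - v i k x :=
  (hu.add hr (hv.neg hr)).congr fun _ _ _ _ => sub_eq_add_neg _ _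

end

theorem w12_kil_comm (a b : Fin 3 → E3 → so31) : w12 kil a b = w12 kil b a :=
  funext fun _ => Finset.sum_congr rfl fun _ _ => kil_comm _ _

theorem w12_eta_comm (a b : Fin 3 → E3 → V) : w12 eta a b = w12 eta b a :=
  funext fun _ => Finset.sum_congr rfl fun _ _ => eta_comm _ _

theorem sympForm_antisymm {ι : Type*} (X Y : Config ι) (i : ι) (x : E3) :
    sympForm X Y i x = -sympForm Y X i x := by
  simp only [sympForm]
  ring

theorem symp_antisymm (X Y : Config ι) : P.symp X Y = -P.symp Y X := by
  rw [symp_eq, symp_eq, ← P.integral_neg]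
  exact P.integral_congr fun i x _ => sympForm_antisymm X Y i x

theorem sum_tr2_mul_tr1 (P : Bundle ι N) (i j : ι) (x : E3) (l l' : Fin 3) :
    ∑ k, P.tr2 i j x l k * P.tr1 i j x l' k =
      if l = l' then (jac (P.change i j) x).det else 0 := by
  simp only [mul_comm (P.tr2 i j x l _), P.sum_tr1_mul_tr2, eq_comm (a := l)]

theorem isForm1_of_tensor {X : Type*} [NormedAddCommGroup X] [NormedSpace ℝ X]
    {r : SO31 → X → X} {v : ι → F1 X} (hv : P.IsTensor P.tr1 r v)
    (hs : ∀ i k, ∀ x ∉ (P.chart i).target, v i k x = 0) : P.IsForm1 r v :=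
  ⟨hv.smooth, hs, hv.compat⟩

theorem isForm2_of_tensor {X : Type*} [NormedAddCommGroup X] [NormedSpace ℝ X]
    {r : SO31 → X → X} {v : ι → F2 X} (hv : P.IsTensor P.tr2 r v)
    (hs : ∀ i k, ∀ x ∉ (P.chart i).target, v i k x = 0) : P.IsForm2 r v :=
  ⟨hv.smooth, hs, hv.compat⟩

variable [CompactSpace N] [IsManifold (𝓡 3) ∞ N]

section

variable {X Y : Type*} [NormedAddCommGroup X] [NormedSpace ℝ X] [NormedAddCommGroup Y]
  [NormedSpace ℝ Y] {r₁ : SO31 → X → X} {r₁' : so31 → X → X} {r₂ : SO31 → Y → Y}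
  {r₂' : so31 → Y → Y} {p : X → Y → ℝ}

/-- Forms are determined by their integrated pairings with the forms of complementary degree. -/
theorem eq_of_integral_eq [T2Space N] {C C' : ι → ι → E3 → Fin 3 → Fin 3 → ℝ}
    (hC' : P.IsCocycle C')
    (hC : ∀ i j x l l', ∑ k, C i j x l k * C' i j x l' k =
      if l = l' then (jac (P.change i j) x).det else 0)
    (hm : IsInv r₁ r₁' r₂ r₂' (fun _ t => t) (fun _ _ => 0) p) (h₁ : IsRep r₁ r₁')
    (h₂ : IsRep r₂ r₂') (hp : ∀ x, (∀ y, p x y = 0) → x = 0)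
    {u u' : ι → Fin 3 → E3 → X} (hu : P.IsTensor C r₁ u) (hu' : P.IsTensor C r₁ u')
    (hs : ∀ i k, ∀ x ∉ (P.chart i).target, u i k x = 0)
    (hs' : ∀ i k, ∀ x ∉ (P.chart i).target, u' i k x = 0)
    (h : ∀ v : ι → Fin 3 → E3 → Y, P.IsTensor C' r₂ v →
      (∀ i k, ∀ x ∉ (P.chart i).target, v i k x = 0) →
      P.integral (fun i => w12 p (u i) (v i)) = P.integral (fun i => w12 p (u' i) (v i))) :
    u = u' := by
  funext i k x
  by_cases hx : x ∈ (P.chart i).target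
  · refine sub_eq_zero.1 (eq_zero_of_integral hC' hC hm h₂ hp (hu.sub h₁ hu')
      (fun v hv hvs => ?_) i k hx)
    have h1 := P.integral_sub (w := fun i => w12 p (u i) (v i)) (w' := fun i => w12 p (u' i) (v i))
      (IsSmooth.w12 hm.bil hu.smooth hv.smooth).continuousOn
      (IsSmooth.w12 hm.bil hu'.smooth hv.smooth).continuousOn
    rw [h v hv hvs, sub_self] at h1
    rw [← h1]
    refine P.integral_congr fun i x _ => ?_
    simp only [w12, hm.bil.sub_left, Finset.sum_sub_distrib]
  · rw [hs i k x hx, hs' i k x hx]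

end

/-- The symplectic form is non-degenerate: each component of a tangent vector is recovered by
pairing with tangent vectors that have only the conjugate component. -/
theorem eq_of_symp_eq [T2Space N] {X X' : Config ι} (hX : X ∈ P.tangentSpace)
    (hX' : X' ∈ P.tangentSpace) (h : ∀ Y ∈ P.tangentSpace, P.symp X Y = P.symp X' Y) :
    X = X' := by
  obtain ⟨hA, he, hS, hB, hτ, hc⟩ := hX
  obtain ⟨hA', he', hS', hB', hτ', hc'⟩ := hX'
  have z1 : P.IsForm1 Ad 0 := isForm1_zero isRep_Ad
  have z2 : P.IsForm2 Ad 0 := isForm2_zero isRep_Ad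
  have z3 : P.IsForm1 actV 0 := isForm1_zero isRep_actV
  have z4 : P.IsForm2 actV 0 := isForm2_zero isRep_actV
  ext1
  · refine eq_of_integral_eq P.isCocycle_tr2 P.sum_tr1_mul_tr2 isInv_kil isRep_Ad isRep_Ad
      eq_zero_of_kil hA.tensor hA'.tensor hA.supp hA'.supp fun v hv hs => ?_
    have h1 := h ⟨0, 0, 0, v, 0, 0⟩ ⟨z1, z3, z1, isForm2_of_tensor hv hs, z4, z2⟩
    simp only [w12_kil_comm (X.A _), w12_kil_comm (X'.A _)]
    simp [symp, w12, isBil_kil.zero_left, isBil_kil.zero_right, isBil_eta.zero_left,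
      isBil_eta.zero_right, P.integral_neg] at h1
    exact h1
  · refine eq_of_integral_eq P.isCocycle_tr2 P.sum_tr1_mul_tr2 isInv_eta isRep_actV isRep_actV
      eq_zero_of_eta he.tensor he'.tensor he.supp he'.supp fun v hv hs => ?_
    have h1 := h ⟨0, 0, 0, 0, v, 0⟩ ⟨z1, z3, z1, z2, isForm2_of_tensor hv hs, z2⟩
    simp only [w12_eta_comm (X.e _), w12_eta_comm (X'.e _)]
    simp [symp, w12, isBil_kil.zero_left, isBil_kil.zero_right, isBil_eta.zero_right,
      P.integral_neg] at h1
    exact h1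
  · refine eq_of_integral_eq P.isCocycle_tr2 P.sum_tr1_mul_tr2 isInv_kil isRep_Ad isRep_Ad
      eq_zero_of_kil hS.tensor hS'.tensor hS.supp hS'.supp fun v hv hs => ?_
    have h1 := h ⟨0, 0, 0, 0, 0, v⟩ ⟨z1, z3, z1, z2, z4, isForm2_of_tensor hv hs⟩
    simp only [w12_kil_comm (X.S _), w12_kil_comm (X'.S _)]
    simp [symp, w12, isBil_kil.zero_left, isBil_kil.zero_right, isBil_eta.zero_left,
      isBil_eta.zero_right, P.integral_neg] at h1
    exact h1
  · refine eq_of_integral_eq P.isCocycle_tr1 P.sum_tr2_mul_tr1 isInv_kil isRep_Ad isRep_Ad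
      eq_zero_of_kil hB.tensor hB'.tensor hB.supp hB'.supp fun v hv hs => ?_
    have h1 := h ⟨v, 0, 0, 0, 0, 0⟩ ⟨isForm1_of_tensor hv hs, z3, z1, z2, z4, z2⟩
    simp [symp, w12, isBil_kil.zero_left, isBil_kil.zero_right, isBil_eta.zero_left,
      isBil_eta.zero_right] at h1
    exact h1
  · refine eq_of_integral_eq P.isCocycle_tr1 P.sum_tr2_mul_tr1 isInv_eta isRep_actV isRep_actV
      eq_zero_of_eta hτ.tensor hτ'.tensor hτ.supp hτ'.supp fun v hv hs => ?_
    have h1 := h ⟨0, v, 0, 0, 0, 0⟩ ⟨z1, isForm1_of_tensor hv hs, z1, z2, z4, z2⟩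
    simp [symp, w12, isBil_kil.zero_left, isBil_kil.zero_right, isBil_eta.zero_left] at h1
    exact h1
  · refine eq_of_integral_eq P.isCocycle_tr1 P.sum_tr2_mul_tr1 isInv_kil isRep_Ad isRep_Ad
      eq_zero_of_kil hc.tensor hc'.tensor hc.supp hc'.supp fun v hv hs => ?_
    have h1 := h ⟨0, 0, v, 0, 0, 0⟩ ⟨z1, z3, isForm1_of_tensor hv hs, z2, z4, z2⟩
    simp [symp, w12, isBil_kil.zero_left, isBil_kil.zero_right, isBil_eta.zero_left,
      isBil_eta.zero_right] at h1
    exact h1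

section

variable [T2Space N] {f g : Config ι → ℝ} {Φ X : Config ι}

theorem IsHamiltonianAt.unique {X' : Config ι} (hX : P.IsHamiltonianAt f Φ X)
    (hX' : P.IsHamiltonianAt f Φ X') : X = X' :=
  eq_of_symp_eq hX.1 hX'.1 fun Y hY => neg_injective ((hX.2 Y hY).unique (hX'.2 Y hY))

theorem IsHamiltonianAt.hamiltonianVector_eq (hX : P.IsHamiltonianAt f Φ X) :
    P.hamiltonianVector f Φ = X := by
  have h : ∃ X, P.IsHamiltonianAt f Φ X := ⟨X, hX⟩
  rw [hamiltonianVector, dif_pos h]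
  exact h.choose_spec.unique hX

theorem IsHamiltonianAt.poisson_eq (hX : P.IsHamiltonianAt f Φ X) {w : ι → F3 ℝ}
    (hg : HasDerivAt (fun t => g (Φ.line X t)) (P.integral w) 0) :
    P.poisson f g Φ = P.integral w := by
  rw [poisson, hX.hamiltonianVector_eq]
  exact hg.deriv

theorem IsHamiltonianAt.poisson_antisymm {X' : Config ι} (hX : P.IsHamiltonianAt f Φ X)
    (hX' : P.IsHamiltonianAt g Φ X') : P.poisson f g Φ = -P.poisson g f Φ := by
  rw [poisson, poisson, hX.hamiltonianVector_eq, hX'.hamiltonianVector_eq,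
    (hX.2 X' hX'.1).deriv, (hX'.2 X hX.1).deriv, symp_antisymm]

end

end Bundle

section

variable {X : Type*} [NormedAddCommGroup X] [NormedSpace ℝ X] {r : so31 → X → X} {A : F1 so31}
  {x : E3}

theorem dA1_zero (hr : IsBil r) (A : F1 so31) (k : Fin 3) (x : E3) : dA1 r A 0 k x = 0 := by
  have h (l) : pd l (0 : E3 → X) x = 0 := pd_const _ _ _
  simp [dA1, w11, hr.zero_right, h]

theorem dA2_zero (hr : IsBil r) (A : F1 so31) (x : E3) : dA2 r A 0 x = 0 := by
  have h (l) : pd l (0 : E3 → X) x = 0 := pd_const _ _ _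
  simp [dA2, w12, hr.zero_right, h]

theorem dA2_map {f : X → X} (f' : X →L[ℝ] X) (hf : ∀ x, f x = f' x)
    (hc : ∀ W v, f (r W v) = r W (f v)) {u : F2 X} (hu : ∀ k, DifferentiableAt ℝ (u k) x) :
    dA2 r A (fun k x => f (u k x)) x = f (dA2 r A u x) := by
  simp only [dA2, w12, ← hc]
  simp only [hf, pd_clm f' (hu _), map_add, map_sum]

theorem dA2_add (hr : IsBil r) {u v : F2 X} (hu : ∀ k, DifferentiableAt ℝ (u k) x)
    (hv : ∀ k, DifferentiableAt ℝ (v k) x) :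
    dA2 r A (fun k x => u k x + v k x) x = dA2 r A u x + dA2 r A v x := by
  have hp (l) : pd l (fun y => u l y + v l y) x = pd l (u l) x + pd l (v l) x :=
    pd_add (hu l) (hv l) l
  simp only [dA2, w12, hp, hr.add_right, Finset.sum_add_distrib]
  abel

end

namespace Bundle

variable {ι : Type*} [Fintype ι] {N : Type*} [TopologicalSpace N] [ChartedSpace E3 N]
  {P : Bundle ι N} {β : ℝ} {T : so31 ≃ₗ⁅ℝ, so31⁆ so31}

/-! ### The Poisson brackets -/

section Cut

variable {X : Type*} [NormedAddCommGroup X] [NormedSpace ℝ X] {r : so31 → X → X} {A : F1 so31}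
  {i : ι} {x : E3}

theorem dA1_cut {u : ι → F1 X} (hx : x ∈ (P.chart i).target) {k : Fin 3} :
    dA1 r A (P.cut u i) k x = dA1 r A (u i) k x :=
  dA1_congr (P.chart i).open_target (fun k _ hy => P.cut_apply u hy k) hx k

theorem dA2_cut {u : ι → F2 X} (hx : x ∈ (P.chart i).target) :
    dA2 r A (P.cut u i) x = dA2 r A (u i) x :=
  dA2_congr (P.chart i).open_target (fun k _ hy => P.cut_apply u hy k) hx

end Cut

theorem integral_eq_zero {w : ι → F3 ℝ} (h : ∀ i, ∀ x ∈ (P.chart i).target, w i x = 0) :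
    P.integral w = 0 := (P.integral_congr h).trans P.integral_zero

section Brackets

variable [CompactSpace N] [IsManifold (𝓡 3) ∞ N] [T2Space N] {Φ : Config ι}
  {θ θ' : ι → F0 so31} {ε ε' : ι → F0 V} {α α' : ι → F1 so31} {ρ ρ' : ι → F1 V}
  {ζ ζ' : ι → F1 so31}

theorem poisson_varH {f : Config ι → ℝ} {X : Config ι} (hX : P.IsHamiltonianAt f Φ X)
    (hΦ : Φ ∈ P.phaseSpace) (hθ : P.IsForm0 Ad θ) :
    P.poisson f (P.H θ) Φ = P.integral (varH θ Φ X) :=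
  hX.poisson_eq (hasDerivAt_H hθ (smoothConfig_of_mem_phaseSpace hΦ)
    (smoothConfig_of_mem_tangentSpace hX.1))

theorem poisson_varI {f : Config ι → ℝ} {X : Config ι} (hX : P.IsHamiltonianAt f Φ X)
    (hΦ : Φ ∈ P.phaseSpace) (hε : P.IsForm0 actV ε) :
    P.poisson f (P.I ε) Φ = P.integral (varI ε Φ X) :=
  hX.poisson_eq (hasDerivAt_I hε (smoothConfig_of_mem_phaseSpace hΦ)
    (smoothConfig_of_mem_tangentSpace hX.1))

theorem poisson_varK {f : Config ι → ℝ} {X : Config ι} (hX : P.IsHamiltonianAt f Φ X)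
    (hΦ : Φ ∈ P.phaseSpace) (hα : P.IsForm1 Ad α) :
    P.poisson f (P.K β T α) Φ = P.integral (varK β T α Φ X) :=
  hX.poisson_eq (hasDerivAt_K β T hα (smoothConfig_of_mem_phaseSpace hΦ)
    (smoothConfig_of_mem_tangentSpace hX.1))

theorem poisson_varL {f : Config ι → ℝ} {X : Config ι} (hX : P.IsHamiltonianAt f Φ X)
    (hΦ : Φ ∈ P.phaseSpace) (hρ : P.IsForm1 actV ρ) :
    P.poisson f (P.L β ρ) Φ = P.integral (varL β ρ Φ X) :=
  hX.poisson_eq (hasDerivAt_L β hρ (smoothConfig_of_mem_phaseSpace hΦ)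
    (smoothConfig_of_mem_tangentSpace hX.1))

theorem poisson_varM {f : Config ι → ℝ} {X : Config ι} (hX : P.IsHamiltonianAt f Φ X)
    (hΦ : Φ ∈ P.phaseSpace) (hζ : P.IsForm1 Ad ζ) :
    P.poisson f (P.M β T ζ) Φ = P.integral (varM β T ζ Φ X) :=
  hX.poisson_eq (hasDerivAt_M β T hζ (smoothConfig_of_mem_phaseSpace hΦ)
    (smoothConfig_of_mem_tangentSpace hX.1))

/-! In each bracket the covariant derivative of the Hamiltonian vector, unless it is zero, is
computed by the Leibniz rule or as a curvature term (`h1`). The integrands then agree at every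
point, by the invariance of the pairings. -/

theorem poisson_K_K (hΦ : Φ ∈ P.phaseSpace) (hα : P.IsForm1 Ad α) (hα' : P.IsForm1 Ad α') :
    P.poisson (P.K β T α) (P.K β T α') Φ = 0 := by
  rw [poisson_varK (isHamiltonianAt_K hα hΦ) hΦ hα']
  refine integral_eq_zero fun i x hx => ?_
  obtain ⟨f1, f2, f3, f4, f5, f6⟩ := fin3_facts
  simp only [varK, vecK, w12, w11, P.cut_apply _ hx, Pi.add_apply, Pi.sub_apply, Pi.zero_apply,
    dA1_zero isBil_lieB, isBil_wedgeV.zero_right]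
  simp only [idAdd_neg, idAdd_sub, idAdd_lieB, Fin.sum_univ_three, f1, f2, f3, f4, f5, f6,
    isBil_kil.add_left, isBil_kil.sub_left, isBil_kil.neg_left, isBil_kil.zero_left]
  grind [kil_lieB_swap]

theorem poisson_K_L (hΦ : Φ ∈ P.phaseSpace) (hα : P.IsForm1 Ad α) (hρ : P.IsForm1 actV ρ) :
    P.poisson (P.K β T α) (P.L β ρ) Φ = P.integral (fun i => w12 kil
      (fun k x => defect β T (α i k x)) (w11 wedgeV (Φ.e i) (ρ i))) := by
  rw [poisson_varL (isHamiltonianAt_K hα hΦ) hΦ hρ]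
  refine P.integral_congr fun i x hx => ?_
  obtain ⟨f1, f2, f3, f4, f5, f6⟩ := fin3_facts
  simp only [varL, vecK, w12, w11, P.cut_apply _ hx, Pi.add_apply, Pi.smul_apply, Pi.zero_apply,
    dA1_zero isBil_act, Fin.sum_univ_three, f1, f2, f3, f4, f5, f6, defect_eq]
  simp only [isBil_kil.sub_right, isBil_kil.sub_left, isBil_kil.smul_left, kil_wedgeV,
    isBil_eta.add_left, isBil_eta.sub_left, isBil_eta.neg_left, isBil_eta.smul_left,
    isBil_eta.zero_left, smul_eq_mul]
  ring

theorem poisson_K_M (hΦ : Φ ∈ P.phaseSpace) (hα : P.IsForm1 Ad α) (hζ : P.IsForm1 Ad ζ) :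
    P.poisson (P.K β T α) (P.M β T ζ) Φ = 0 := by
  rw [poisson_varM (isHamiltonianAt_K hα hΦ) hΦ hζ]
  refine integral_eq_zero fun i x hx => ?_
  have h1 (k) : dA1 lieB (Φ.A i) ((P.vecK β T α Φ).A i) k x =
      idAdd β T (dA1 lieB (Φ.A i) (α i) k x) := by
    simp only [vecK, dA1_cut hx]
    exact (dA1_map (idAddCLM β T) (idAddCLM_apply β T) (idAdd_lieB β T)
      fun k => hα.tensor.diff i k hx) k
  simp only [varM, w12, Pi.add_apply, h1]
  simp [vecK, P.cut_apply _ hx, idAdd_neg, isBil_kil.zero_left]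

theorem poisson_H_K (hΦ : Φ ∈ P.phaseSpace) (hθ : P.IsForm0 Ad θ) (hα : P.IsForm1 Ad α) :
    P.poisson (P.H θ) (P.K β T α) Φ = -P.K β T (fun i => w01 lieB (θ i) (α i)) Φ := by
  rw [poisson_varK (isHamiltonianAt_H hθ hΦ) hΦ hα, K, ← P.integral_neg]
  refine P.integral_congr fun i x hx => ?_
  have h1 (k) : dA1 lieB (Φ.A i) ((P.vecH θ Φ).S i) k x =
      w11 lieB (dA0 lieB (Φ.A i) (θ i)) (Φ.S i) k x +
        lieB (θ i x) (dA1 lieB (Φ.A i) (Φ.S i) k x) := by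
    simp only [vecH, dA1_cut hx]
    exact (dA1_w01 isInv_lieB (hθ.tensor.diff i () hx) fun k => hΦ.2.2.1.tensor.diff i k hx) k
  obtain ⟨f1, f2, f3, f4, f5, f6⟩ := fin3_facts
  simp only [varK, w12, Pi.add_apply, Pi.sub_apply, Pi.smul_apply, h1]
  simp only [vecH, P.cut_apply _ hx, idAdd_lieB, w01, w11, Fin.sum_univ_three, f1, f2, f3, f4,
    f5, f6, isBil_kil.add_left, isBil_kil.sub_left, isBil_kil.smul_left,
    isBil_lieB.neg_left, isBil_kil.neg_left, kil_wedgeV_left, lieB_act, isBil_eta.sub_left,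
    eta_act_right, smul_eq_mul]
  grind [kil_lieB_swap, kil_lieB, eta_act_act]

theorem poisson_K_I (hΦ : Φ ∈ P.phaseSpace) (hα : P.IsForm1 Ad α) (hε : P.IsForm0 actV ε) :
    P.poisson (P.K β T α) (P.I ε) Φ = -P.L β (fun i => w10 act (α i) (ε i)) Φ +
      P.integral (fun i => w12 kil (fun k x => defect β T (α i k x))
        (w10 wedgeV (Φ.τ i) (ε i))) := by
  have hs := smoothConfig_of_mem_phaseSpace hΦ
  rw [poisson_varI (isHamiltonianAt_K hα hΦ) hΦ hε, L, ← P.integral_neg, ← P.integral_add]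
  · refine P.integral_congr fun i x hx => ?_
    have h1 : dA2 act (Φ.A i) ((P.vecK β T α Φ).τ i) x =
        -(w12 act (dA1 lieB (Φ.A i) (α i)) (Φ.e i) x -
          w12 act (α i) (dA1 act (Φ.A i) (Φ.e i)) x) := by
      simp only [vecK, dA2_cut hx]
      exact (dA2_neg isBil_act _).trans (congrArg Neg.neg
        (dA2_w11 isInv_act isBil_act (fun k => hα.tensor.diff i k hx) (fun k => hs.e.diff i k hx)))
    obtain ⟨f1, f2, f3, f4, f5, f6⟩ := fin3_facts
    simp only [varI, w12, w30, Pi.add_apply, Pi.smul_apply, h1]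
    simp only [vecK, P.cut_apply _ hx, w10, Fin.sum_univ_three, defect_eq, isBil_kil.sub_left,
      isBil_kil.smul_left, isBil_kil.neg_left, kil_wedgeV, Pi.zero_apply, isBil_wedgeV.zero_left,
      isBil_kil.zero_right, isBil_eta.add_left, isBil_eta.sub_left,
      isBil_eta.neg_left, isBil_eta.smul_left, eta_act_right, smul_eq_mul]
    ring
  · exact fun i => (IsSmooth.continuousOn (IsSmooth.w12 isBil_eta
      ((IsSmooth.dA1 isBil_act hs.A hs.e).add (.smul (1 + β) hs.τ))
      (hα.tensor.w10 isInv_act hε.tensor).smooth) i).neg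
  · refine (IsSmooth.w12 isBil_kil (u := fun i k x => defect β T (α i k x)) ?_
      (hΦ.2.2.2.2.1.tensor.w10 isInv_wedgeV hε.tensor).smooth).continuousOn
    simp only [defect_eq]
    exact (hα.tensor.const_smul isRep_Ad _).sub isRep_Ad (hα.tensor.idAdd β T) |>.smooth

theorem poisson_L_L (hΦ : Φ ∈ P.phaseSpace) (hρ : P.IsForm1 actV ρ) (hρ' : P.IsForm1 actV ρ') :
    P.poisson (P.L β ρ) (P.L β ρ') Φ = 0 := by
  rw [poisson_varL (isHamiltonianAt_L hρ hΦ) hΦ hρ']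
  refine integral_eq_zero fun i x hx => ?_
  have h1 (k) : dA1 act (Φ.A i) ((P.vecL β ρ Φ).e i) k x =
      (1 + β) • dA1 act (Φ.A i) (ρ i) k x := by
    simp only [vecL, dA1_cut hx]
    exact (dA1_const_smul isBil_act _ fun k => hρ.tensor.diff i k hx) k
  simp only [varL, w12, Pi.add_apply, Pi.smul_apply, h1]
  simp [vecL, P.cut_apply _ hx, w11, isBil_act.zero_left, isBil_eta.zero_left]

theorem poisson_L_M (hΦ : Φ ∈ P.phaseSpace) (hρ : P.IsForm1 actV ρ) (hζ : P.IsForm1 Ad ζ) :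
    P.poisson (P.L β ρ) (P.M β T ζ) Φ = 0 := by
  rw [poisson_varM (isHamiltonianAt_L hρ hΦ) hΦ hζ]
  refine integral_eq_zero fun i x hx => ?_
  simp [varM, vecL, w12, dA1_zero isBil_lieB, idAdd, isBil_kil.zero_left]

theorem poisson_H_L (hΦ : Φ ∈ P.phaseSpace) (hθ : P.IsForm0 Ad θ) (hρ : P.IsForm1 actV ρ) :
    P.poisson (P.H θ) (P.L β ρ) Φ = -P.L β (fun i => w01 act (θ i) (ρ i)) Φ := by
  rw [poisson_varL (isHamiltonianAt_H hθ hΦ) hΦ hρ, L, ← P.integral_neg]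
  refine P.integral_congr fun i x hx => ?_
  have h1 (k) : dA1 act (Φ.A i) ((P.vecH θ Φ).e i) k x =
      w11 act (dA0 lieB (Φ.A i) (θ i)) (Φ.e i) k x +
        act (θ i x) (dA1 act (Φ.A i) (Φ.e i) k x) := by
    simp only [vecH, dA1_cut hx]
    exact (dA1_w01 isInv_act (hθ.tensor.diff i () hx) fun k => hΦ.2.1.tensor.diff i k hx) k
  simp only [varL, w12, Pi.add_apply, Pi.smul_apply, h1]
  simp only [vecH, P.cut_apply _ hx, w01, w11, Fin.sum_univ_three, isBil_eta.add_left,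
    isBil_eta.sub_left, isBil_eta.smul_left, isBil_act.neg_left, isBil_eta.neg_left,
    eta_act_right, smul_eq_mul]
  ring

theorem poisson_L_I (hΦ : Φ ∈ P.phaseSpace) (hρ : P.IsForm1 actV ρ) (hε : P.IsForm0 actV ε) :
    P.poisson (P.L β ρ) (P.I ε) Φ = P.M β T (fun i => w10 wedgeV (ρ i) (ε i)) Φ +
      P.integral (fun i => w12 kil (fun k x => defect β T (Φ.c i k x))
        (w10 wedgeV (ρ i) (ε i))) := by
  have hw := (hρ.tensor.w10 isInv_wedgeV hε.tensor).smooth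
  have hc := hΦ.2.2.2.2.2.tensor
  rw [poisson_varI (isHamiltonianAt_L hρ hΦ) hΦ hε, M, ← P.integral_add]
  · refine P.integral_congr fun i x hx => ?_
    have h1 : dA2 act (Φ.A i) ((P.vecL β ρ Φ).τ i) x = -w12 act (curv (Φ.A i)) (ρ i) x := by
      simp only [vecL, dA2_cut hx]
      exact (dA2_neg isBil_act _).trans (congrArg Neg.neg
        (dA2_dA1 (P.chart i).open_target (hΦ.1.smooth i) hx isRep_actV (hρ.smooth i)))
    simp only [varI, w12, w30, Pi.add_apply, h1]
    simp only [vecL, P.cut_apply _ hx, w10, Fin.sum_univ_three, defect_eq, isBil_kil.add_left,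
      isBil_kil.sub_left, isBil_kil.smul_left, kil_wedgeV, Pi.zero_apply, isBil_act.zero_left,
      isBil_kil.zero_left, isBil_eta.add_left, isBil_eta.zero_left, isBil_act.smul_right,
      isBil_eta.neg_left, isBil_eta.smul_left, smul_eq_mul]
    ring
  · exact (IsSmooth.w12 isBil_kil (IsSmooth.add (P := P) hΦ.1.conn.isTensor_curv.smooth
      (isSmooth_idAdd β T hc.smooth)) hw).continuousOn
  · refine (IsSmooth.w12 isBil_kil (u := fun i k x => defect β T (Φ.c i k x)) ?_ hw).continuousOn
    simp only [defect_eq]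
    exact (hc.const_smul isRep_Ad _).sub isRep_Ad (hc.idAdd β T) |>.smooth

theorem poisson_M_M (hΦ : Φ ∈ P.phaseSpace) (hζ : P.IsForm1 Ad ζ) (hζ' : P.IsForm1 Ad ζ') :
    P.poisson (P.M β T ζ) (P.M β T ζ') Φ = 0 := by
  rw [poisson_varM (isHamiltonianAt_M hζ hΦ) hΦ hζ']
  refine integral_eq_zero fun i x hx => ?_
  simp [varM, vecM, w12, dA1_zero isBil_lieB, idAdd, isBil_kil.zero_left]

theorem poisson_H_M (hΦ : Φ ∈ P.phaseSpace) (hθ : P.IsForm0 Ad θ) (hζ : P.IsForm1 Ad ζ) :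
    P.poisson (P.H θ) (P.M β T ζ) Φ = -P.M β T (fun i => w01 lieB (θ i) (ζ i)) Φ := by
  rw [poisson_varM (isHamiltonianAt_H hθ hΦ) hΦ hζ, M, ← P.integral_neg]
  refine P.integral_congr fun i x hx => ?_
  have h1 (k) : dA1 lieB (Φ.A i) ((P.vecH θ Φ).A i) k x = -lieB (curv (Φ.A i) k x) (θ i x) := by
    simp only [vecH, dA1_cut hx]
    exact (dA1_neg isBil_lieB _ _).trans (congrArg Neg.neg
      (dA1_dA0 (P.chart i).open_target (hΦ.1.smooth i) hx isRep_Ad (hθ.smooth i) k))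
  simp only [varM, w12, Pi.add_apply, h1]
  simp only [vecH, P.cut_apply _ hx, w01, Fin.sum_univ_three, isBil_kil.add_left,
    isBil_kil.neg_left, idAdd_lieB, kil_lieB_right]
  grind [kil_lieB_swap]

theorem poisson_M_I (hΦ : Φ ∈ P.phaseSpace) (hζ : P.IsForm1 Ad ζ) (hε : P.IsForm0 actV ε) :
    P.poisson (P.M β T ζ) (P.I ε) Φ = 0 := by
  rw [poisson_varI (isHamiltonianAt_M hζ hΦ) hΦ hε]
  refine integral_eq_zero fun i x hx => ?_
  simp [varI, vecM, w12, w30, w10, dA2_zero isBil_act, isBil_act.zero_left, isBil_kil.zero_left,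
    isBil_eta.zero_left, isBil_wedgeV.zero_left, isBil_kil.zero_right]

theorem poisson_H_H (hΦ : Φ ∈ P.phaseSpace) (hθ : P.IsForm0 Ad θ) (hθ' : P.IsForm0 Ad θ') :
    P.poisson (P.H θ) (P.H θ') Φ = -P.H (fun i => w00 lieB (θ i) (θ' i)) Φ := by
  rw [poisson_varH (isHamiltonianAt_H hθ hΦ) hΦ hθ', H, ← P.integral_neg]
  refine P.integral_congr fun i x hx => ?_
  have h1 : dA2 lieB (Φ.A i) ((P.vecH θ Φ).B i) x =
      w12 lieB (dA0 lieB (Φ.A i) (θ i)) (Φ.B i) x +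
        lieB (θ i x) (dA2 lieB (Φ.A i) (Φ.B i) x) := by
    simp only [vecH, dA2_cut hx]
    exact dA2_w01 isInv_lieB (hθ.tensor.diff i () hx) fun k => hΦ.2.2.2.1.tensor.diff i k hx
  simp only [varH, w12, w30, Pi.add_apply, Pi.sub_apply, h1]
  have h2 (v w : V) : wedgeV v (act (θ i x) w) =
      lieB (θ i x) (wedgeV v w) - wedgeV (act (θ i x) v) w := by rw [lieB_wedgeV]; abel
  have h3 (Z W : so31) : lieB Z (lieB (θ i x) W) =
      lieB (θ i x) (lieB Z W) - lieB (lieB (θ i x) Z) W := by rw [lieB_lieB (θ i x)]; abel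
  have h4 (Z : so31) : kil (lieB (θ i x) Z) (θ' i x) = -kil Z (lieB (θ i x) (θ' i x)) := by
    rw [kil_lieB_swap, kil_lieB]
  simp only [vecH, P.cut_apply _ hx, w01, w00, Fin.sum_univ_three, h2, h3, isBil_kil.add_left,
    isBil_kil.sub_left, isBil_kil.neg_left, isBil_lieB.neg_left, h4]
  ring

theorem poisson_H_I (hΦ : Φ ∈ P.phaseSpace) (hθ : P.IsForm0 Ad θ) (hε : P.IsForm0 actV ε) :
    P.poisson (P.H θ) (P.I ε) Φ = -P.I (fun i => w00 act (θ i) (ε i)) Φ := by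
  rw [poisson_varI (isHamiltonianAt_H hθ hΦ) hΦ hε, I, ← P.integral_neg]
  refine P.integral_congr fun i x hx => ?_
  have h1 : dA2 act (Φ.A i) ((P.vecH θ Φ).τ i) x =
      w12 act (dA0 lieB (Φ.A i) (θ i)) (Φ.τ i) x +
        act (θ i x) (dA2 act (Φ.A i) (Φ.τ i) x) := by
    simp only [vecH, dA2_cut hx]
    exact dA2_w01 isInv_act (hθ.tensor.diff i () hx) fun k => hΦ.2.2.2.2.1.tensor.diff i k hx
  simp only [varI, w12, w30, Pi.add_apply, h1]
  simp only [vecH, P.cut_apply _ hx, w01, w10, w00, Fin.sum_univ_three, isBil_act.neg_left,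
    isBil_eta.add_left, isBil_eta.neg_left, kil_wedgeV, lieB_act, isBil_eta.sub_left,
    eta_act_right]
  ring

theorem poisson_I_I (hΦ : Φ ∈ P.phaseSpace) (hε : P.IsForm0 actV ε) (hε' : P.IsForm0 actV ε') :
    P.poisson (P.I ε) (P.I ε') Φ = P.J (fun i => w00 wedgeV (ε i) (ε' i)) Φ := by
  rw [poisson_varI (isHamiltonianAt_I hε hΦ) hΦ hε', J]
  refine P.integral_congr fun i x hx => ?_
  have h1 : dA2 act (Φ.A i) ((P.vecI ε Φ).τ i) x =
      -(act (dA2 lieB (Φ.A i) (Φ.c i) x) (ε i x) +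
        w12 act (Φ.c i) (dA0 act (Φ.A i) (ε i)) x) := by
    simp only [vecI, dA2_cut hx]
    exact (dA2_neg isBil_act _).trans (congrArg Neg.neg
      (dA2_w10 isInv_act (fun k => hΦ.2.2.2.2.2.tensor.diff i k hx) (hε.tensor.diff i () hx)))
  simp only [varI, w12, w30, Pi.add_apply, h1]
  simp only [vecI, P.cut_apply _ hx, w10, w00, Fin.sum_univ_three, Pi.zero_apply,
    isBil_act.zero_left, isBil_kil.zero_left, isBil_wedgeV.neg_left, isBil_kil.neg_right,
    isBil_eta.add_left, isBil_eta.neg_left, isBil_eta.zero_left, kil_wedgeV]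
  ring

/-- The functional `J_σ` is one of the constraints `M`: as `d_A F_A = 0`, the form `d_A c` is
`(id + β T)⁻¹ d_A (F_A + (id + β T) c)`, and the derivative is moved to `σ` by parts. -/
theorem J_eq_M (hΦ : Φ ∈ P.phaseSpace) {R : so31 →ₗ[ℝ] so31}
    (hR : ∀ X, idAdd β T (R X) = X) (hRc : ∀ X Y, R (lieB X Y) = lieB X (R Y))
    {σ : ι → F0 so31} (hσ : P.IsForm0 Ad σ) :
    P.J σ Φ = P.M β T (fun i => -dA0 lieB (Φ.A i) (fun x => R (σ i x))) Φ := by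
  set R' : so31 →L[ℝ] so31 := toCLM R R.map_add R.map_smul with hR'
  have hRσ := hσ.tensor.map (f := R) R' (fun _ => rfl) (commutant_Ad hRc)
  have hc := hΦ.2.2.2.2.2.tensor
  have hF := hΦ.1.conn.isTensor_curv
  have hb := hF.add isRep_Ad (hc.idAdd β T)
  have h := integral_dA2_add Φ.A isInv_kil hb hRσ
  have hs : P.IsSmooth fun i (_ : Unit) => w12 kil (fun k x => curv (Φ.A i) k x +
      idAdd β T (Φ.c i k x)) (dA0 lieB (Φ.A i) fun x => R (σ i x)) :=
    .w12 isBil_kil hb.smooth (hRσ.dA0 hΦ.1.conn isRep_Ad).smooth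
  have hs' : P.IsSmooth fun i (_ : Unit) => w30 kil (dA2 lieB (Φ.A i) fun k x =>
      curv (Φ.A i) k x + idAdd β T (Φ.c i k x)) (fun x => R (σ i x)) :=
    .w30 isBil_kil (.dA2 isBil_lieB hΦ.1.smooth hb.smooth) hRσ.smooth
  rw [P.integral_add hs'.continuousOn hs.continuousOn] at h
  rw [M, J, ← sub_eq_zero, ← h, sub_eq_add_neg, ← P.integral_neg]
  congr 1
  · refine P.integral_congr fun i x hx => ?_
    rw [w30, w30, dA2_add isBil_lieB (fun k => hF.diff i k hx)
      (fun k => (hc.idAdd β T).diff i k hx),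
      dA2_curv (P.chart i).open_target (hΦ.1.smooth i) hx, dA2_map (idAddCLM β T)
      (idAddCLM_apply β T) (idAdd_lieB β T) fun k => hc.diff i k hx, zero_add, kil_idAdd, hR]
  · refine P.integral_congr fun i x hx => ?_
    simp [w12, isBil_kil.neg_right]

end Brackets

end Bundle

namespace Bundle

variable {ι : Type*} [Fintype ι] {N : Type*} [TopologicalSpace N] [ChartedSpace E3 N]
  {P : Bundle ι N} {β : ℝ} {T : so31 ≃ₗ⁅ℝ, so31⁆ so31}

theorem M_cut (ζ : ι → F1 so31) (Φ : Config ι) : P.M β T (P.cut ζ) Φ = P.M β T ζ Φ :=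
  P.integral_congr fun i x hx => by simp only [w12, P.cut_apply ζ hx]

section

variable [CompactSpace N] [IsManifold (𝓡 3) ∞ N] {Φ : Config ι}

theorem exists_isHamiltonianAt {f : Config ι → ℝ} (hf : f ∈ P.constraints β T)
    (hΦ : Φ ∈ P.phaseSpace) : ∃ X, P.IsHamiltonianAt f Φ X := by
  rcases hf with ⟨θ, h, rfl⟩ | ⟨ε, h, rfl⟩ | ⟨α, h, rfl⟩ | ⟨ρ, h, rfl⟩ | ⟨ζ, h, rfl⟩
  exacts [⟨_, isHamiltonianAt_H h hΦ⟩, ⟨_, isHamiltonianAt_I h hΦ⟩, ⟨_, isHamiltonianAt_K h hΦ⟩,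
    ⟨_, isHamiltonianAt_L h hΦ⟩, ⟨_, isHamiltonianAt_M h hΦ⟩]

variable [T2Space N] {θ : ι → F0 so31} {α ζ : ι → F1 so31} {ρ : ι → F1 V}

theorem poisson_K_H (hΦ : Φ ∈ P.phaseSpace) (hα : P.IsForm1 Ad α) (hθ : P.IsForm0 Ad θ) :
    P.poisson (P.K β T α) (P.H θ) Φ = P.K β T (fun i => w01 lieB (θ i) (α i)) Φ := by
  rw [(isHamiltonianAt_K hα hΦ).poisson_antisymm (isHamiltonianAt_H hθ hΦ), poisson_H_K hΦ hθ hα,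
    neg_neg]

theorem poisson_L_H (hΦ : Φ ∈ P.phaseSpace) (hρ : P.IsForm1 actV ρ) (hθ : P.IsForm0 Ad θ) :
    P.poisson (P.L β ρ) (P.H θ) Φ = P.L β (fun i => w01 act (θ i) (ρ i)) Φ := by
  rw [(isHamiltonianAt_L hρ hΦ).poisson_antisymm (isHamiltonianAt_H hθ hΦ), poisson_H_L hΦ hθ hρ,
    neg_neg]

theorem poisson_M_H (hΦ : Φ ∈ P.phaseSpace) (hζ : P.IsForm1 Ad ζ) (hθ : P.IsForm0 Ad θ) :
    P.poisson (P.M β T ζ) (P.H θ) Φ = P.M β T (fun i => w01 lieB (θ i) (ζ i)) Φ := by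
  rw [(isHamiltonianAt_M hζ hΦ).poisson_antisymm (isHamiltonianAt_H hθ hΦ), poisson_H_M hΦ hθ hζ,
    neg_neg]

/-! ### The constraints are first class in the topological sector -/

/-- Without the defect terms every bracket of two constraints is zero or again a constraint. For
`{I, I}` the smearing form depends on the connection, which is harmless because the constraints
vanish for all smearing forms. -/
theorem firstClass_of_topologicalSector {R : so31 →ₗ[ℝ] so31} (hR : ∀ X, idAdd β T (R X) = X)
    (hRc : ∀ X Y, R (lieB X Y) = lieB X (R Y)) (hT : TopologicalSector β T) :
    P.FirstClass β T := by
  have hd (X) : defect β T X = 0 := by rw [defect, smul_sub, hT, sub_self]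
  have symm {f f' : Config ι → ℝ} (hf : f ∈ P.constraints β T) (hf' : f' ∈ P.constraints β T)
      {Φ : Config ι} (hΦ : Φ ∈ P.constraintSurface β T) (h : P.poisson f f' Φ = 0) :
      P.poisson f' f Φ = 0 := by
    obtain ⟨X, hX⟩ := exists_isHamiltonianAt hf hΦ.1
    obtain ⟨X', hX'⟩ := exists_isHamiltonianAt hf' hΦ.1
    rw [hX'.poisson_antisymm hX, h, neg_zero]
  have mH {θ} (h : P.IsForm0 Ad θ) : P.H θ ∈ P.constraints β T := .inl ⟨θ, h, rfl⟩
  have mI {ε} (h : P.IsForm0 actV ε) : P.I ε ∈ P.constraints β T := .inr (.inl ⟨ε, h, rfl⟩)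
  have mK {α} (h : P.IsForm1 Ad α) : P.K β T α ∈ P.constraints β T :=
    .inr (.inr (.inl ⟨α, h, rfl⟩))
  have mL {ρ} (h : P.IsForm1 actV ρ) : P.L β ρ ∈ P.constraints β T :=
    .inr (.inr (.inr (.inl ⟨ρ, h, rfl⟩)))
  have mM {ζ} (h : P.IsForm1 Ad ζ) : P.M β T ζ ∈ P.constraints β T :=
    .inr (.inr (.inr (.inr ⟨ζ, h, rfl⟩)))
  have hKL {α ρ Φ} (hΦ : Φ ∈ P.constraintSurface β T) (hα : P.IsForm1 Ad α)
      (hρ : P.IsForm1 actV ρ) : P.poisson (P.K β T α) (P.L β ρ) Φ = 0 := by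
    rw [poisson_K_L hΦ.1 hα hρ]
    exact integral_eq_zero fun i x _ => by simp [w12, hd, isBil_kil.zero_left]
  have hKH {α θ Φ} (hΦ : Φ ∈ P.constraintSurface β T) (hα : P.IsForm1 Ad α)
      (hθ : P.IsForm0 Ad θ) : P.poisson (P.K β T α) (P.H θ) Φ = 0 := by
    rw [poisson_K_H hΦ.1 hα hθ]
    exact hΦ.2 _ (mK (isForm1_of_tensor (hθ.tensor.w01 isInv_lieB hα.tensor) fun i k x hx => by
      rw [w01, hα.supp i k x hx, isBil_lieB.zero_right]))
  have hKI {α ε Φ} (hΦ : Φ ∈ P.constraintSurface β T) (hα : P.IsForm1 Ad α)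
      (hε : P.IsForm0 actV ε) : P.poisson (P.K β T α) (P.I ε) Φ = 0 := by
    rw [poisson_K_I hΦ.1 hα hε, integral_eq_zero, add_zero, neg_eq_zero]
    · exact hΦ.2 _ (mL (isForm1_of_tensor (hα.tensor.w10 isInv_act hε.tensor) fun i k x hx => by
        rw [w10, hα.supp i k x hx, isBil_act.zero_left]))
    · exact fun i x _ => by simp [w12, hd, isBil_kil.zero_left]
  have hLH {ρ θ Φ} (hΦ : Φ ∈ P.constraintSurface β T) (hρ : P.IsForm1 actV ρ)
      (hθ : P.IsForm0 Ad θ) : P.poisson (P.L β ρ) (P.H θ) Φ = 0 := by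
    rw [poisson_L_H hΦ.1 hρ hθ]
    exact hΦ.2 _ (mL (isForm1_of_tensor (hθ.tensor.w01 isInv_act hρ.tensor) fun i k x hx => by
      rw [w01, hρ.supp i k x hx, isBil_act.zero_right]))
  have hLI {ρ ε Φ} (hΦ : Φ ∈ P.constraintSurface β T) (hρ : P.IsForm1 actV ρ)
      (hε : P.IsForm0 actV ε) : P.poisson (P.L β ρ) (P.I ε) Φ = 0 := by
    rw [poisson_L_I (T := T) hΦ.1 hρ hε, integral_eq_zero, add_zero]
    · exact hΦ.2 _ (mM (isForm1_of_tensor (hρ.tensor.w10 isInv_wedgeV hε.tensor)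
        fun i k x hx => by rw [w10, hρ.supp i k x hx, isBil_wedgeV.zero_left]))
    · exact fun i x _ => by simp [w12, hd, isBil_kil.zero_left]
  have hMH {ζ θ Φ} (hΦ : Φ ∈ P.constraintSurface β T) (hζ : P.IsForm1 Ad ζ)
      (hθ : P.IsForm0 Ad θ) : P.poisson (P.M β T ζ) (P.H θ) Φ = 0 := by
    rw [poisson_M_H hΦ.1 hζ hθ]
    exact hΦ.2 _ (mM (isForm1_of_tensor (hθ.tensor.w01 isInv_lieB hζ.tensor) fun i k x hx => by
      rw [w01, hζ.supp i k x hx, isBil_lieB.zero_right]))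
  have hHH {θ θ' Φ} (hΦ : Φ ∈ P.constraintSurface β T) (hθ : P.IsForm0 Ad θ)
      (hθ' : P.IsForm0 Ad θ') : P.poisson (P.H θ) (P.H θ') Φ = 0 := by
    rw [poisson_H_H hΦ.1 hθ hθ', neg_eq_zero]
    exact hΦ.2 _ (mH ((hθ.tensor.w00 isInv_lieB hθ'.tensor).isForm0 fun i _ x hx => by
      simp only [w00, hθ.supp i x hx, isBil_lieB.zero_left]))
  have hHI {θ ε Φ} (hΦ : Φ ∈ P.constraintSurface β T) (hθ : P.IsForm0 Ad θ)
      (hε : P.IsForm0 actV ε) : P.poisson (P.H θ) (P.I ε) Φ = 0 := by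
    rw [poisson_H_I hΦ.1 hθ hε, neg_eq_zero]
    exact hΦ.2 _ (mI ((hθ.tensor.w00 isInv_act hε.tensor).isForm0 fun i _ x hx => by
      simp only [w00, hθ.supp i x hx, isBil_act.zero_left]))
  have hII {ε ε' Φ} (hΦ : Φ ∈ P.constraintSurface β T) (hε : P.IsForm0 actV ε)
      (hε' : P.IsForm0 actV ε') : P.poisson (P.I ε) (P.I ε') Φ = 0 := by
    have hw := hε.tensor.w00 isInv_wedgeV hε'.tensor
    have hR' := hw.map (f := R) (toCLM R R.map_add R.map_smul) (fun _ => rfl) (commutant_Ad hRc)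
    rw [poisson_I_I hΦ.1 hε hε', J_eq_M (β := β) (T := T) hΦ.1 hR hRc
      (hw.isForm0 fun i _ x hx => by
        simp only [w00, hε.supp i x hx, isBil_wedgeV.zero_left]), ← M_cut]
    exact hΦ.2 _ (mM ((hR'.dA0 hΦ.1.1.conn isRep_Ad).neg isRep_Ad).isForm1)
  rintro f (⟨θ, h, rfl⟩ | ⟨ε, h, rfl⟩ | ⟨α, h, rfl⟩ | ⟨ρ, h, rfl⟩ | ⟨ζ, h, rfl⟩) f'
    (⟨θ', h', rfl⟩ | ⟨ε', h', rfl⟩ | ⟨α', h', rfl⟩ | ⟨ρ', h', rfl⟩ | ⟨ζ', h', rfl⟩) Φ hΦ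
  · exact hHH hΦ h h'
  · exact hHI hΦ h h'
  · exact symm (mK h') (mH h) hΦ (hKH hΦ h' h)
  · exact symm (mL h') (mH h) hΦ (hLH hΦ h' h)
  · exact symm (mM h') (mH h) hΦ (hMH hΦ h' h)
  · exact symm (mH h') (mI h) hΦ (hHI hΦ h' h)
  · exact hII hΦ h h'
  · exact symm (mK h') (mI h) hΦ (hKI hΦ h' h)
  · exact symm (mL h') (mI h) hΦ (hLI hΦ h' h)
  · exact symm (mM h') (mI h) hΦ (poisson_M_I hΦ.1 h' h)
  · exact hKH hΦ h h'
  · exact hKI hΦ h h'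
  · exact poisson_K_K hΦ.1 h h'
  · exact hKL hΦ h h'
  · exact poisson_K_M hΦ.1 h h'
  · exact hLH hΦ h h'
  · exact hLI hΦ h h'
  · exact symm (mK h') (mL h) hΦ (hKL hΦ h' h)
  · exact poisson_L_L hΦ.1 h h'
  · exact poisson_L_M hΦ.1 h h'
  · exact hMH hΦ h h'
  · exact poisson_M_I hΦ.1 h h'
  · exact symm (mK h') (mM h) hΦ (poisson_K_M hΦ.1 h' h)
  · exact symm (mL h') (mM h) hΦ (poisson_L_M hΦ.1 h' h)
  · exact poisson_M_M hΦ.1 h h'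

end

end Bundle

/-- The Maurer-Cartan form of a product of group-valued functions. -/
theorem mc_mul {g a b : E3 → SO31} {x : E3} {s : Set E3} (hs : IsOpen s) (hx : x ∈ s)
    (h : ∀ y ∈ s, (g y).1 = (a y).1 * (b y).1) (ha : DifferentiableAt ℝ (fun y => (a y).1) x)
    (hb : DifferentiableAt ℝ (fun y => (b y).1) x) (k : Fin 3) :
    mc k g x = mc k a x + Ad (a x) (mc k b x) := by
  have hg : DifferentiableAt ℝ (fun y => (g y).1) x :=
    (isBil_matMul.differentiableAt ha hb).congr_of_eventuallyEq
      (Filter.eventuallyEq_of_mem (hs.mem_nhds hx) h)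
  apply so31_ext
  change (mc k g x).1 = (mc k a x).1 + (a x).1 * (mc k b x).1 * (a x).1⁻¹
  rw [coe_mc hg, coe_mc ha, coe_mc hb, pd_congr_on hs h hx, isBil_matMul.pd ha hb, h x hx,
    Matrix.mul_inv_rev]
  have e : (b x).1 * ((b x).1⁻¹ * (a x).1⁻¹) = (a x).1⁻¹ := by
    rw [← mul_assoc, SO31.mul_inv, one_mul]
  rw [add_mul, mul_assoc _ (b x).1, e]
  simp only [mul_assoc]

/-- The Maurer-Cartan form is natural under changes of coordinates. -/
theorem mc_comp {h : E3 → SO31} {ψ : E3 → E3} {x : E3}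
    (hh : DifferentiableAt ℝ (fun y => (h y).1) (ψ x)) (hψ : DifferentiableAt ℝ ψ x) (k : Fin 3) :
    mc k (fun y => h (ψ y)) x = ∑ l, jac ψ x l k • mc l h (ψ x) := by
  simp only [mc, ← map_smul, ← map_sum]
  rw [pd_comp hh hψ, Finset.sum_mul]
  simp only [Matrix.smul_mul]

theorem contDiffOn_mc {g : E3 → SO31} {s : Set E3} (hs : IsOpen s)
    (hg : ContDiffOn ℝ ∞ (fun y => (g y).1) s) (k : Fin 3) : ContDiffOn ℝ ∞ (mc k g) s := by
  have h : mc k g = fun x => projCLM (pd k (fun y => (g y).1) x * adjM (g x).1) := by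
    funext x
    rw [adjM_SO31]
    rfl
  rw [h]
  exact projCLM.contDiff.comp_contDiffOn (isBil_matMul.contDiffOn (contDiffOn_pd hs hg k)
    (adjM.contDiff.comp_contDiffOn hg))

namespace Bundle

variable {ι : Type*} [Fintype ι] {N : Type*} [TopologicalSpace N] [ChartedSpace E3 N]
  {P : Bundle ι N}

/-! ### Existence of connections -/

/-- The average, with weights given by the partition of unity, of the connections that are flat
with respect to the individual trivialisations. -/
def averageConn (P : Bundle ι N) (j : ι) (k : Fin 3) (x : E3) : so31 :=
  -∑ m, P.pc m j x • mc k (fun y => P.gc j m y) x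

/-- Each flat connection transforms with the same inhomogeneous term, and the weights sum to one. -/
theorem isConn_averageConn [IsManifold (𝓡 3) ∞ N] : P.IsConn P.averageConn where
  smooth j k := by
    refine (ContDiffOn.sum fun m _ => fun x hx => ?_).neg
    by_cases hxo : x ∈ P.overlap m j
    · exact (((P.contDiffOn_pc m j).mono (P.overlap_subset m j)).smul
        (contDiffOn_mc (P.isOpen_overlap m j) (P.contDiffOn_gc m j) k)).contDiffAt
        ((P.isOpen_overlap m j).mem_nhds hxo) |>.contDiffWithinAt
    · refine ContDiffAt.contDiffWithinAt (contDiffAt_const (c := 0) |>.congr_of_eventuallyEq ?_)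
      filter_upwards [P.pc_eventually_zero hx hxo] with y hy
      rw [hy, zero_smul]
  compat i j k x hx := by
    have hxj := P.overlap_subset i j hx
    have h (m : ι) : P.pc m j x • mc k (fun y => P.gc j m y) x =
        P.pc m j x • mc k (fun y => P.gc j i y) x + ∑ l, P.tr1 i j x l k •
          Ad (P.gc j i x) (P.pc m i (P.change i j x) •
            mc l (fun y => P.gc i m y) (P.change i j x)) := by
      rw [P.pc_change hx]
      by_cases hm : x ∈ P.overlap m j
      · have hm' := P.change_mem hx (P.mem_overlap.1 hm).2
        have hd := P.differentiableAt_gc hm'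
        have hφ := P.differentiableAt_change hx
        rw [mc_mul (b := fun y => P.gc i m (P.change i j y))
          ((P.isOpen_overlap i j).inter (P.isOpen_overlap m j)) ⟨hx, hm⟩
          (fun y hy => (P.gc_mul hy.1 hy.2).symm) (P.differentiableAt_gc hx) (hd.comp x hφ),
          mc_comp (h := fun y => P.gc i m y) hd hφ]
        obtain ⟨f, hf⟩ := isRep_Ad.lin (P.gc j i x)
        simp only [hf, map_sum, map_smul, smul_add, Finset.smul_sum, tr1]
        congr 1
        exact Finset.sum_congr rfl fun l _ => smul_comm _ _ _
      · obtain ⟨f, hf⟩ := isRep_Ad.lin (P.gc j i x)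
        simp [P.pc_eq_zero hxj hm, hf]
    obtain ⟨f, hf⟩ := isRep_Ad.lin (P.gc j i x)
    simp only [averageConn, h, Finset.sum_add_distrib, ← Finset.sum_smul, P.sum_pc, one_smul,
      neg_add, hf, map_neg, map_sum, smul_neg, Finset.sum_neg_distrib, Finset.smul_sum]
    rw [Finset.sum_comm, sub_eq_add_neg, add_comm]

theorem IsConn.isConnection_cut {A : ι → F1 so31} (hA : P.IsConn A) :
    P.IsConnection (P.cut A) where
  smooth i k := (hA.smooth i k).congr fun x hx => P.cut_apply A hx k
  supp i k x hx := P.cut_apply_of_notMem A hx k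
  compat i j k x hx := by
    rw [P.cut_apply A (P.overlap_subset i j hx), hA.compat i j k x hx,
      ← coe_mc (P.differentiableAt_gc hx) k]
    simp only [P.cut_apply A (P.change_mem_target hx)]
    rfl

theorem exists_isConnection [IsManifold (𝓡 3) ∞ N] (P : Bundle ι N) :
    ∃ A, P.IsConnection A := ⟨_, isConn_averageConn.isConnection_cut⟩

end Bundle

namespace Bundle

variable {ι : Type*} [Fintype ι] {N : Type*} [TopologicalSpace N] [ChartedSpace E3 N]
  {P : Bundle ι N} {β : ℝ} {T : so31 ≃ₗ⁅ℝ, so31⁆ so31}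

/-! ### The topological sector is necessary -/

theorem IsConnection.add {A a : ι → F1 so31} (hA : P.IsConnection A) (ha : P.IsForm1 Ad a) :
    P.IsConnection (A + a) where
  smooth i k := (hA.smooth i k).add (ha.smooth i k)
  supp i k x hx := by
    change A i k x + a i k x = 0
    rw [hA.supp i k x hx, ha.supp i k x hx, add_zero]
  compat i j k x hx := by
    change (A j k x).1 + (a j k x).1 = (∑ l, jac (P.change i j) x l k •
      Ad (P.gc j i x) (A i l (P.change i j x) + a i l (P.change i j x)) : so31).1 - _
    rw [hA.compat i j k x hx, ha.compat i j k x hx]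
    simp only [Ad_add, smul_add, Finset.sum_add_distrib]
    rw [sub_add_eq_add_sub]
    rfl

/-- There are connections with non-zero curvature: if the curvature of a connection vanishes at `x`,
the connection is modified by a cut-off of the form `(y₁ - x₁) Z dy₂`, which vanishes at `x` and
whose exterior derivative at `x` does not. -/
theorem exists_curv_ne_zero [IsManifold (𝓡 3) ∞ N] [T2Space N] [Nonempty N] (P : Bundle ι N)
    {Z : so31} (hZ : Z ≠ 0) : ∃ A, P.IsConnection A ∧
      ∃ i k, ∃ x ∈ (P.chart i).target, curv (A i) k x ≠ 0 := by
  obtain ⟨A, hA⟩ := P.exists_isConnection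
  obtain ⟨p⟩ := ‹Nonempty N›
  obtain ⟨i, hi⟩ := P.cover p
  set x := P.chart i p
  have hx : x ∈ (P.chart i).target := (P.chart i).map_source hi
  by_cases h0 : curv (A i) 0 x = 0
  swap
  · exact ⟨A, hA, i, 0, x, hx, h0⟩
  obtain ⟨φ, h1, h2, h3, -, h5⟩ := exists_contDiff_tsupport_subset (n := ⊤)
    ((P.chart i).open_target.mem_nhds hx)
  set q : E3 → ℝ := fun y => y 1 - x 1 with hq
  have hqs : ContDiff ℝ ∞ q :=
    (EuclideanSpace.proj (1 : Fin 3) : E3 →L[ℝ] ℝ).contDiff.sub contDiff_const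
  set a₀ : F1 so31 := fun l y => if l = 2 then (φ y * q y) • Z else 0 with ha₀
  have hsub (l) : tsupport (a₀ l) ⊆ tsupport φ := by
    refine closure_mono fun y hy hy' => hy ?_
    simp only [ha₀, show φ y = 0 from hy', zero_mul, zero_smul, ite_self]
  have hs (l) : ContDiff ℝ ∞ (a₀ l) := by
    by_cases hl : l = 2
    · simp only [ha₀, hl, if_true]
      exact (h3.mul hqs).smul contDiff_const
    · simp only [ha₀, hl, if_false]
      exact contDiff_const
  set a := P.extend P.tr1 Ad i a₀
  have ha : P.IsForm1 Ad a := isForm1_of_tensor (isTensor_extend P.isCocycle_tr1 isRep_Ad hs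
    (fun l => h2.of_isClosed_subset (isClosed_tsupport _) (hsub l)) fun l => (hsub l).trans h1)
    fun j k y hy => extend_supp j k hy
  have hai (l) : ∀ y ∈ (P.chart i).target, a i l y = a₀ l y := fun y hy =>
    extend_self P.isCocycle_tr1 isRep_Ad hy a₀ l
  have hax (l) : a i l x = 0 := by simp [hai l x hx, ha₀, hq]
  have hd1 : pd 1 (a i 2) x = Z := by
    rw [pd_congr_on (P.chart i).open_target (hai 2) hx]
    have hφ : DifferentiableAt ℝ φ x := h3.differentiable (by simp) x
    have hq' : DifferentiableAt ℝ q x := hqs.differentiable (by simp) x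
    have e1 : pd 1 q x = 1 := by
      simp only [pd, hq]
      rw [fderiv_sub_const]
      change fderiv ℝ (EuclideanSpace.proj (1 : Fin 3) : E3 →L[ℝ] ℝ) x _ = 1
      rw [ContinuousLinearMap.fderiv]
      simp
    have e2 : pd 1 (fun y => (φ y * q y) • Z) x = pd 1 (fun y => φ y * q y) x • Z := by
      rw [isBil_smul.pd (hφ.fun_mul hq') (differentiableAt_const Z), pd_const]
      simp
    have e3 : pd 1 (fun y => φ y * q y) x = 1 := by
      have := isBil_smul.pd hφ hq' 1
      simp only [smul_eq_mul] at this
      rw [this, e1, h5]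
      simp [hq]
    simp only [ha₀, if_true]
    rw [e2, e3, one_smul]
  have hd2 : pd 2 (a i 1) x = 0 := by
    rw [pd_congr_on (P.chart i).open_target (hai 1) hx]
    simp only [ha₀, show (1 : Fin 3) ≠ 2 by decide, if_false]
    exact pd_const _ _ _
  refine ⟨A + a, hA.add ha, i, 0, x, hx, ?_⟩
  have h6 := curv_line (fun k => hA.conn.diff i k hx) (fun k => ha.tensor.diff i k hx) 1 0
  rw [one_smul] at h6
  change curv (A i + a i) 0 x ≠ 0
  rw [h6, h0]
  simp only [dA1, w11, hax, isBil_lieB.zero_left, isBil_lieB.zero_right]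
  simpa [hd1, hd2] using hZ

/-- With a connection of non-zero curvature `F`, the configuration `e = S = B = τ = 0`,
`c = -(id + β T)⁻¹ F` lies on the constraint surface, and the defect term in `{L_ρ, I_ε}` does not
vanish there unless `β (id - T) = 0`. -/
theorem topologicalSector_of_firstClass [CompactSpace N] [IsManifold (𝓡 3) ∞ N] [T2Space N]
    [Nonempty N] {R : so31 →ₗ[ℝ] so31} (hR : ∀ X, idAdd β T (R X) = X)
    (hRc : ∀ X Y, R (lieB X Y) = lieB X (R Y)) (h : P.FirstClass β T) :
    TopologicalSector β T := by
  by_contra hT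
  obtain ⟨X, hX⟩ := not_forall.1 hT
  have hX' : defectL β T X ≠ 0 := fun h0 => hX (by
    rw [defectL_apply, defect, smul_sub, sub_eq_zero] at h0
    exact h0.symm)
  obtain ⟨D, hD, -, -⟩ := commutant_inverse (defectL_lieB β T) ⟨X, hX'⟩
  obtain ⟨A, hA, i, k, x, hx, hF⟩ := P.exists_curv_ne_zero hX'
  have hRF := (hA.conn.isTensor_curv.map (f := R) (toCLM R R.map_add R.map_smul) (fun _ => rfl)
    (commutant_Ad hRc)).neg isRep_Ad
  set c := P.cut fun i k x => -R (curv (A i) k x) with hc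
  have hcF : P.IsForm2 Ad c := hRF.isForm2
  set Φ : Config ι := ⟨A, 0, 0, 0, 0, c⟩ with hΦ
  have hmem : Φ ∈ P.phaseSpace := ⟨hA, isForm1_zero isRep_actV, isForm1_zero isRep_Ad,
    isForm2_zero isRep_Ad, isForm2_zero isRep_actV, hcF⟩
  have hM (ζ : ι → F1 so31) : P.M β T ζ Φ = 0 := integral_eq_zero fun i x hx => by
    simp [w12, hΦ, hc, P.cut_apply _ hx, idAdd_neg, hR, isBil_kil.zero_left]
  have hsurf : Φ ∈ P.constraintSurface β T := by
    refine ⟨hmem, ?_⟩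
    rintro f (⟨θ, h, rfl⟩ | ⟨ε, h, rfl⟩ | ⟨α, h, rfl⟩ | ⟨ρ, h, rfl⟩ | ⟨ζ, h, rfl⟩)
    · exact integral_eq_zero fun i x hx => by
        simp [hΦ, w30, w12, dA2_zero isBil_lieB, isBil_lieB.zero_right, isBil_wedgeV.zero_left,
          isBil_kil.zero_left]
    · exact integral_eq_zero fun i x hx => by
        simp [hΦ, w30, w12, w10, dA2_zero isBil_act, isBil_wedgeV.zero_left, isBil_eta.zero_left,
          isBil_kil.zero_right]
    · exact integral_eq_zero fun i x hx => by
        simp [hΦ, w12, w11, dA1_zero isBil_lieB, isBil_wedgeV.zero_left, isBil_kil.zero_left,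
          idAdd]
    · exact integral_eq_zero fun i x hx => by
        simp [hΦ, w12, dA1_zero isBil_act, isBil_eta.zero_left]
    · exact hM ζ
  have hdef : P.IsTensor P.tr2 Ad fun i k x => defect β T (c i k x) := by
    simp only [defect_eq]
    exact (hcF.tensor.const_smul isRep_Ad _).sub isRep_Ad (hcF.tensor.idAdd β T)
  have key (ε : ι → F0 V) (hε : P.IsForm0 actV ε) :
      act (defect β T (c i k x)) (ε i x) = 0 := by
    refine eq_zero_of_integral P.isCocycle_tr1 P.sum_tr2_mul_tr1 isInv_eta isRep_actV
      eq_zero_of_eta (hdef.w10 isInv_act hε.tensor) (fun ρ hρ hs => ?_) i k hx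
    have hρ' := isForm1_of_tensor hρ hs
    have h1 := h (P.L β ρ) (.inr (.inr (.inr (.inl ⟨ρ, hρ', rfl⟩)))) (P.I ε)
      (.inr (.inl ⟨ε, hε, rfl⟩)) Φ hsurf
    rw [poisson_L_I (T := T) hmem hρ' hε, hM, zero_add] at h1
    rw [← h1]
    refine P.integral_congr fun i x _ => Finset.sum_congr rfl fun k _ => ?_
    rw [w10, kil_wedgeV, eta_act_swap]
  have h0 : defect β T (c i k x) = 0 := eq_zero_of_act _ fun v => by
    obtain ⟨ε, hε, rfl⟩ := exists_section (P := P) isRep_actV hx v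
    exact key ε hε
  have h1 : c i k x = 0 := by rw [← hD (c i k x), defectL_apply, h0, map_zero]
  rw [hc, P.cut_apply _ hx, neg_eq_zero] at h1
  have h2 := hR (curv (A i) k x)
  rw [h1] at h2
  exact hF (by rw [← h2]; simp [idAdd])

end Bundle

end QeGR

end

theorem mainTheorem8 {ι : Type*} [Fintype ι]
    {N : Type*} [TopologicalSpace N] [T2Space N] [CompactSpace N] [Nonempty N]
    [ChartedSpace QeGR.E3 N] [IsManifold (𝓡 3) ∞ N] (P : QeGR.Bundle ι N)
    (β : ℝ) (T : QeGR.so31 ≃ₗ⁅ℝ, QeGR.so31⁆ QeGR.so31) (hinv : QeGR.InvertibilitySector β T) :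
    -- every constraint functional has a unique Hamiltonian vector field
    (∀ f ∈ P.constraints β T, ∀ Φ ∈ P.phaseSpace, ∃! X, P.IsHamiltonianAt f Φ X) ∧
    -- `id + β T` has an inverse `R`, and the Poisson brackets are as follows
    (∃ R : QeGR.so31 → QeGR.so31,
      (∀ X, R (QeGR.Bundle.idAdd β T X) = X) ∧ (∀ X, QeGR.Bundle.idAdd β T (R X) = X) ∧
      ∀ Φ ∈ P.phaseSpace,
      ∀ θ θ', P.IsForm0 QeGR.Ad θ → P.IsForm0 QeGR.Ad θ' →
      ∀ ε ε', P.IsForm0 QeGR.actV ε → P.IsForm0 QeGR.actV ε' →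
      ∀ α α', P.IsForm1 QeGR.Ad α → P.IsForm1 QeGR.Ad α' →
      ∀ ρ ρ', P.IsForm1 QeGR.actV ρ → P.IsForm1 QeGR.actV ρ' →
      ∀ ζ ζ', P.IsForm1 QeGR.Ad ζ → P.IsForm1 QeGR.Ad ζ' →
        P.poisson (P.K β T α) (P.K β T α') Φ = 0 ∧
        P.poisson (P.K β T α) (P.L β ρ) Φ =
          P.integral (fun i => QeGR.w12 QeGR.kil
            (fun k x => QeGR.Bundle.defect β T (α i k x))
            (QeGR.w11 QeGR.wedgeV (Φ.e i) (ρ i))) ∧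
        P.poisson (P.K β T α) (P.M β T ζ) Φ = 0 ∧
        P.poisson (P.K β T α) (P.H θ) Φ =
          P.K β T (fun i => QeGR.w01 QeGR.lieB (θ i) (α i)) Φ ∧
        P.poisson (P.K β T α) (P.I ε) Φ =
          -P.L β (fun i => QeGR.w10 QeGR.act (α i) (ε i)) Φ +
          P.integral (fun i => QeGR.w12 QeGR.kil
            (fun k x => QeGR.Bundle.defect β T (α i k x))
            (QeGR.w10 QeGR.wedgeV (Φ.τ i) (ε i))) ∧
        P.poisson (P.L β ρ) (P.L β ρ') Φ = 0 ∧
        P.poisson (P.L β ρ) (P.M β T ζ) Φ = 0 ∧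
        P.poisson (P.L β ρ) (P.H θ) Φ =
          P.L β (fun i => QeGR.w01 QeGR.act (θ i) (ρ i)) Φ ∧
        P.poisson (P.L β ρ) (P.I ε) Φ =
          P.M β T (fun i => QeGR.w10 QeGR.wedgeV (ρ i) (ε i)) Φ +
          P.integral (fun i => QeGR.w12 QeGR.kil
            (fun k x => QeGR.Bundle.defect β T (Φ.c i k x))
            (QeGR.w10 QeGR.wedgeV (ρ i) (ε i))) ∧
        P.poisson (P.M β T ζ) (P.M β T ζ') Φ = 0 ∧
        P.poisson (P.M β T ζ) (P.H θ) Φ =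
          P.M β T (fun i => QeGR.w01 QeGR.lieB (θ i) (ζ i)) Φ ∧
        P.poisson (P.M β T ζ) (P.I ε) Φ = 0 ∧
        P.poisson (P.H θ) (P.H θ') Φ =
          -P.H (fun i => QeGR.w00 QeGR.lieB (θ i) (θ' i)) Φ ∧
        P.poisson (P.H θ) (P.I ε) Φ =
          -P.I (fun i => QeGR.w00 QeGR.act (θ i) (ε i)) Φ ∧
        P.poisson (P.I ε) (P.I ε') Φ =
          P.J (fun i => QeGR.w00 QeGR.wedgeV (ε i) (ε' i)) Φ ∧
        P.J (fun i => QeGR.w00 QeGR.wedgeV (ε i) (ε' i)) Φ =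
          P.M β T (fun i => -QeGR.dA0 QeGR.lieB (Φ.A i)
            (fun x => R (QeGR.wedgeV (ε i x) (ε' i x)))) Φ) ∧
    -- the constraint set is first class exactly in the topological sector
    (P.FirstClass β T ↔ QeGR.TopologicalSector β T) := by
  obtain ⟨X₀, hX₀⟩ := not_forall.1 hinv
  obtain ⟨R, hR₁, hR₂, hRc⟩ := QeGR.commutant_inverse (QeGR.Bundle.idAddL_lieB β T)
    ⟨X₀, fun h => hX₀ (eq_neg_of_add_eq_zero_right h)⟩
  refine ⟨fun f hf Φ hΦ => ?_, ⟨R, hR₁, hR₂, fun Φ hΦ θ θ' hθ hθ' ε ε' hε hε' α α' hα hα' ρ ρ' hρ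
    hρ' ζ ζ' hζ hζ' => ⟨?_, ?_, ?_, ?_, ?_, ?_, ?_, ?_, ?_, ?_, ?_, ?_, ?_, ?_, ?_, ?_⟩⟩, ?_⟩
  · obtain ⟨X, hX⟩ := QeGR.Bundle.exists_isHamiltonianAt hf hΦ
    exact ⟨X, hX, fun X' hX' => hX'.unique hX⟩
  · exact QeGR.Bundle.poisson_K_K hΦ hα hα'
  · exact QeGR.Bundle.poisson_K_L hΦ hα hρ
  · exact QeGR.Bundle.poisson_K_M hΦ hα hζ
  · exact QeGR.Bundle.poisson_K_H hΦ hα hθ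
  · exact QeGR.Bundle.poisson_K_I hΦ hα hε
  · exact QeGR.Bundle.poisson_L_L hΦ hρ hρ'
  · exact QeGR.Bundle.poisson_L_M hΦ hρ hζ
  · exact QeGR.Bundle.poisson_L_H hΦ hρ hθ
  · exact QeGR.Bundle.poisson_L_I hΦ hρ hε
  · exact QeGR.Bundle.poisson_M_M hΦ hζ hζ'
  · exact QeGR.Bundle.poisson_M_H hΦ hζ hθ
  · exact QeGR.Bundle.poisson_M_I hΦ hζ hε
  · exact QeGR.Bundle.poisson_H_H hΦ hθ hθ'
  · exact QeGR.Bundle.poisson_H_I hΦ hθ hε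
  · exact QeGR.Bundle.poisson_I_I hΦ hε hε'
  · exact QeGR.Bundle.J_eq_M hΦ hR₂ hRc
      ((hε.tensor.w00 QeGR.isInv_wedgeV hε'.tensor).isForm0 fun i _ x hx => by
        simp [QeGR.w00, hε.supp i x hx, QeGR.isBil_wedgeV.zero_left])
  · exact ⟨QeGR.Bundle.topologicalSector_of_firstClass hR₂ hRc,
      QeGR.Bundle.firstClass_of_topologicalSector hR₂ hRc⟩
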